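/- **Setting.** Let $\mathcal P$ be a partition of a polygon $\omega\subset\mathbb R^2$ into closed cells (rectangles or triangles). For a space $S$ of polynomials, let $S_{\mathcal P}$ be the space of continuous functions on $\bar\omega$ whose restriction to each cell lies in $S$. Let $\mathbb Q_\ell$ be the polynomials of degree at most $\ell$ in each of the two variables, and $\mathbb P_\ell$ those of total degree at most $\ell$. The pair $\mathbb Q_2^2\times\mathbb Q_1$ on $\mathcal P$ consists of $V=[(\mathbb Q_2)_{\mathcal P}]^2\cap H^1_0(\omega)^2$ and $M=(\mathbb Q_1)_{\mathcal P}\cap L^2_0(\omega)$, where $L^2_0(\omega)$ is the space of square integrable functions with zero mean; the pair $\mathbb P_2^2\times\mathbb P_1$ is defined in the same way. **Edge patches.** Let $\sigma\in\mathbb R$. An *edge patch* of regularity $\sigma$ is one of the following rectangular partitions, for real $x_0,y_0$, or its image under compositions of the reflections $(x,y)\mapsto(y,x)$ and $(x,y)\mapsto(-x,y)$. Let $M'=[x_0,x_0+W]\times[y_0,y_0+T]$ with $W,T>0$, $W\le\sigma T$ and $T\le\sigma W$. 1. *(One strip.)* $\bar\omega=M\cup M'$ with $M=[x_0,x_0+W]\times[y_0-t,y_0]$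 and $0<t\le W$. Both $M$ and $M'$ are cut into two cells by the line $x=x_0+W/2$. The two cells of $M$ are either kept, or each of them is cut once more by the line $y=y_0-t/2$. 2. *(Overlapped patch.)* $\bar\omega=M_1\cup M'\cup M_2$ with $M_1=[x_0,x_0+W]\times[y_0-t_1,y_0]$, $M_2=[x_0-t_2,x_0]\times[y_0,y_0+T]$, $0<t_1\le W$ and $0<t_2\le T$. Both $M_1$ and $M'$ are cut by the line $x=x_0+W/2$, and both $M_2$ and $M'$ are cut by the line $y=y_0+T/2$, so that $M'$ has four cells and $M_1$, $M_2$ have two each. Independently of each other, the two cells of $M_1$ may each be cut once more by the line $y=y_0-t_1/2$, and those of $M_2$ by the line $x=x_0-t_2/2$. **Theorem.** For every $\sigma$ there is a constant $\beta>0$, depending only on $\sigma$, such that for every edge patch $\mathcal P$ of regularity $\sigma$, with domain $\omega$ (the interior of the union of the cells), the pair $V\times M=\mathbb Q_2^2\times\mathbb Q_1$ on $\mathcal P$ satisfies $$\inf_{0\ne q\in M}\ \sup_{0\ne v\in V}\ \frac{\int_\omega q\,\operatorname{div}v}{|v|_{1,\omega}\,\|q\|_{L^2(\omega)}}\ \ge\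 \beta .$$ With the same $\beta$, this inequality also holds for the pair $V\times M=\mathbb P_2^2\times\mathbb P_1$ on every triangulation obtained by cutting each rectangle of $\mathcal P$ along either one of its two diagonals. In particular, $\beta$ does not depend on the size of the elements or on the aspect ratio of the thin ones ($t$, $t_1$, $t_2$ may be arbitrarily small). -/

import Mathlib

open MeasureTheory Set Filter Topology
open scoped ContDiff ENNReal

namespace TaylorHood

/-! ### Sobolev spaces on an open subset of the plane -/

/-- The plane (coordinates `z.1`, `z.2`). -/
abbrev Plane : Type := ℝ × ℝ

/-- The coordinate unit vectors. -/
def unitVec (i : Fin 2) : Plane := if i = 0 then (1, 0) else (0, 1)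

/-- Classical partial derivative in direction `i`. -/
noncomputable def partialDeriv (i : Fin 2) (φ : Plane → ℝ) (z : Plane) : ℝ :=
  fderiv ℝ φ z (unitVec i)

/-- Smooth functions with compact support contained in `Ω`. -/
structure IsTestFunction (Ω : Set Plane) (φ : Plane → ℝ) : Prop where
  smooth : ContDiff ℝ ∞ φ
  compact : HasCompactSupport φ
  support_subset : tsupport φ ⊆ Ω

/-- `g` is square integrable on `Ω` and is the weak derivative of `f` on `Ω` in direction `i`. -/
def IsWeakPartial (Ω : Set Plane) (i : Fin 2) (f g : Plane → ℝ) : Prop :=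
  MemLp g 2 (volume.restrict Ω) ∧
    ∀ φ, IsTestFunction Ω φ →
      ∫ z in Ω, f z * partialDeriv i φ z = -∫ z in Ω, g z * φ z

/-- `f ∈ H¹₀(Ω)`, the closure of the test functions in `H¹(Ω)`: `f` and its weak first derivatives
are in `L²(Ω)`, and some sequence of test functions converges to `f` in `H¹(Ω)`. -/
def MemH10 (Ω : Set Plane) (f : Plane → ℝ) : Prop :=
  MemLp f 2 (volume.restrict Ω) ∧
    ∃ g : Fin 2 → Plane → ℝ, (∀ i, IsWeakPartial Ω i f (g i)) ∧
      ∃ φ : ℕ → Plane → ℝ, (∀ n, IsTestFunction Ω (φ n)) ∧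
        Tendsto (fun n => eLpNorm (f - φ n) 2 (volume.restrict Ω)) atTop (𝓝 0) ∧
        ∀ i, Tendsto (fun n => eLpNorm (g i - partialDeriv i (φ n)) 2 (volume.restrict Ω))
          atTop (𝓝 0)

open scoped Classical in
/-- The weak derivative of `f` on `Ω` (unique almost everywhere in `Ω`). -/
noncomputable def weakPartial (Ω : Set Plane) (i : Fin 2) (f : Plane → ℝ) : Plane → ℝ :=
  if h : ∃ g, IsWeakPartial Ω i f g then h.choose else 0

/-- `f ∈ L²₀(Ω)`: square integrable with zero mean. -/
def MemL20 (Ω : Set Plane) (f : Plane → ℝ) : Prop :=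
  MemLp f 2 (volume.restrict Ω) ∧ ∫ z in Ω, f z = 0

/-- The norm of `L²(Ω)`. -/
noncomputable def l2Norm (Ω : Set Plane) (q : Plane → ℝ) : ℝ :=
  √(∫ z in Ω, q z ^ 2)

/-- The seminorm `|v|_{1,Ω}` of a vector field. -/
noncomputable def h1Seminorm (Ω : Set Plane) (v : Fin 2 → Plane → ℝ) : ℝ :=
  √(∑ i, ∑ j, ∫ z in Ω, weakPartial Ω j (v i) z ^ 2)

/-- The (weak) divergence. -/
noncomputable def divergence (Ω : Set Plane) (v : Fin 2 → Plane → ℝ) (z : Plane) : ℝ :=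
  ∑ i, weakPartial Ω i (v i) z

/-- `inf_{q ∈ M} sup_{v ∈ V} (div v, q)_Ω / (|v|_{1,Ω} ‖q‖_Ω)`, over nonzero `q` and `v`. -/
noncomputable def infSup (Ω : Set Plane) (V : Set (Fin 2 → Plane → ℝ)) (M : Set (Plane → ℝ)) :
    EReal :=
  ⨅ q ∈ {q | q ∈ M ∧ l2Norm Ω q ≠ 0}, ⨆ v ∈ {v | v ∈ V ∧ h1Seminorm Ω v ≠ 0},
    (((∫ z in Ω, divergence Ω v z * q z) / (h1Seminorm Ω v * l2Norm Ω q) : ℝ) : EReal)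

/-! ### Finite element spaces

A partition is given by the set `𝒦` of its closed cells. -/

/-- The closed region covered by a partition. -/
def region (𝒦 : Set (Set Plane)) : Set Plane := ⋃₀ 𝒦

/-- The open domain partitioned by `𝒦`. -/
def domain (𝒦 : Set (Set Plane)) : Set Plane := interior (region 𝒦)

/-- Continuous functions on the region that on every cell are given by a polynomial from `S`. -/
def feSpace (𝒦 : Set (Set Plane)) (S : Submodule ℝ (MvPolynomial (Fin 2) ℝ)) :
    Set (Plane → ℝ) :=
  {f | ContinuousOn f (region 𝒦) ∧
    ∀ K ∈ 𝒦, ∃ p ∈ S, ∀ z ∈ K, f z = MvPolynomial.eval ![z.1, z.2] p}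

/-- Velocities: both components in the finite element space and in `H¹₀`. -/
def velocitySpace (𝒦 : Set (Set Plane)) (S : Submodule ℝ (MvPolynomial (Fin 2) ℝ)) :
    Set (Fin 2 → Plane → ℝ) :=
  {v | ∀ i, v i ∈ feSpace 𝒦 S ∧ MemH10 (domain 𝒦) (v i)}

/-- Pressures: the finite element functions with zero mean. -/
def pressureSpace (𝒦 : Set (Set Plane)) (S : Submodule ℝ (MvPolynomial (Fin 2) ℝ)) :
    Set (Plane → ℝ) :=
  {q | q ∈ feSpace 𝒦 S ∧ MemL20 (domain 𝒦) q}

/-- `ℚ_ℓ`: polynomials of degree at most `ℓ` in each variable. -/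
noncomputable abbrev polyQ (l : ℕ) : Submodule ℝ (MvPolynomial (Fin 2) ℝ) :=
  MvPolynomial.restrictDegree (Fin 2) ℝ l

/-- `ℙ_ℓ`: polynomials of total degree at most `ℓ`. -/
noncomputable abbrev polyP (l : ℕ) : Submodule ℝ (MvPolynomial (Fin 2) ℝ) :=
  MvPolynomial.restrictTotalDegree (Fin 2) ℝ l

/-- The inf-sup constant of the pair `ℚ₂² × ℚ₁`. -/
noncomputable def infSupQ2Q1 (𝒦 : Set (Set Plane)) : EReal :=
  infSup (domain 𝒦) (velocitySpace 𝒦 (polyQ 2)) (pressureSpace 𝒦 (polyQ 1))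

/-- The inf-sup constant of the pair `ℙ₂² × ℙ₁`. -/
noncomputable def infSupP2P1 (𝒦 : Set (Set Plane)) : EReal :=
  infSup (domain 𝒦) (velocitySpace 𝒦 (polyP 2)) (pressureSpace 𝒦 (polyP 1))

/-! ### Edge patches -/

/-- The rectangle `[x.1, x.2] × [y.1, y.2]`. -/
@[ext] structure Rect where
  x : ℝ × ℝ
  y : ℝ × ℝ

namespace Rect

/-- The closed rectangle as a set of points. -/
def toSet (R : Rect) : Set Plane := Icc R.x.1 R.x.2 ×ˢ Icc R.y.1 R.y.2

/-- The image under `(x, y) ↦ (y, x)`. -/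
def swap (R : Rect) : Rect := ⟨R.y, R.x⟩

/-- The image under `(x, y) ↦ (-x, y)`. -/
def reflect (R : Rect) : Rect := ⟨(-R.x.2, -R.x.1), R.y⟩

/-- The two closed triangles into which the rectangle is cut by its diagonal through the lower left
corner (`true`), or by the one through the lower right corner (`false`). -/
def triangles (R : Rect) : Bool → Set (Set Plane)
  | true => {convexHull ℝ {(R.x.1, R.y.1), (R.x.2, R.y.1), (R.x.2, R.y.2)},
             convexHull ℝ {(R.x.1, R.y.1), (R.x.1, R.y.2), (R.x.2, R.y.2)}}
  | false => {convexHull ℝ {(R.x.1, R.y.1), (R.x.2, R.y.1), (R.x.1, R.y.2)},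
              convexHull ℝ {(R.x.2, R.y.1), (R.x.1, R.y.2), (R.x.2, R.y.2)}}

end Rect

/-- The interval `[a, b]` cut at its midpoint. -/
noncomputable def halves (a b : ℝ) : Set (ℝ × ℝ) := {(a, (a + b) / 2), ((a + b) / 2, b)}

/-- The interval `[a, b]`, cut at its midpoint if `refined`. -/
noncomputable def pieces (refined : Bool) (a b : ℝ) : Set (ℝ × ℝ) :=
  if refined then halves a b else {(a, b)}

/-- All rectangles `I × J` with `I ∈ 𝓘`, `J ∈ 𝓙`. -/
def grid (𝓘 𝓙 : Set (ℝ × ℝ)) : Set Rect := {R | R.x ∈ 𝓘 ∧ R.y ∈ 𝓙}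

/-- Anisotropic edge patches in which the long, thin elements have been bisected in the direction
orthogonal to them. Here `W` and `T` are the sides of the isotropic block `M'`, with
aspect ratio at most `σ`; the widths `t`, `t₁`, `t₂` of the thin strips may be arbitrarily small. -/
inductive IsEdgePatch (σ : ℝ) : Set Rect → Prop
  /-- One thin strip `M` (of height `t`) below `M'`. The vertical midline cuts both `M` and `M'`
  into two cells; if `refined`, the horizontal midline of `M` cuts its two cells once more. -/
  | strip (x₀ y₀ W T t : ℝ) (refined : Bool) (hW : 0 < W) (hT : 0 < T)
      (hWT : W ≤ σ * T) (hTW : T ≤ σ * W) (ht : 0 < t) (htW : t ≤ W) :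
      IsEdgePatch σ
        (grid (halves x₀ (x₀ + W)) (pieces refined (y₀ - t) y₀ ∪ {(y₀, y₀ + T)}))
  /-- Overlapped (L-shaped) patch: one thin strip `M₁` (of height `t₁`) below `M'` and one thin
  strip `M₂` (of width `t₂`) to the left of it. Both midlines of `M'` are cut lines, and continue
  through the strips. Each strip may be cut once more along its own long midline. -/
  | overlapped (x₀ y₀ W T t₁ t₂ : ℝ) (refined₁ refined₂ : Bool) (hW : 0 < W) (hT : 0 < T)
      (hWT : W ≤ σ * T) (hTW : T ≤ σ * W) (ht₁ : 0 < t₁) (ht₁W : t₁ ≤ W)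
      (ht₂ : 0 < t₂) (ht₂T : t₂ ≤ T) :
      IsEdgePatch σ
        (grid (halves x₀ (x₀ + W)) (pieces refined₁ (y₀ - t₁) y₀ ∪ halves y₀ (y₀ + T)) ∪
          grid (pieces refined₂ (x₀ - t₂) x₀) (halves y₀ (y₀ + T)))
  /-- The other orientations of the patch, generated by two reflections. -/
  | swap {P : Set Rect} (h : IsEdgePatch σ P) : IsEdgePatch σ (Rect.swap '' P)
  | reflect {P : Set Rect} (h : IsEdgePatch σ P) : IsEdgePatch σ (Rect.reflect '' P)

/-- The cells of a rectangular partition. -/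
def rectCells (P : Set Rect) : Set (Set Plane) := Rect.toSet '' P

/-- The cells of the triangulation that cuts every rectangle `R ∈ P` into two triangles of equal
area, by the diagonal chosen by `d R`. -/
def triCells (P : Set Rect) (d : Rect → Bool) : Set (Set Plane) := ⋃ R ∈ P, R.triangles (d R)

end TaylorHood

/-!
The proof is by duality with explicit scalar test functions. If the inf-sup quotient of a pressure
`q` were at most a small `β`, then testing with fields `±φ eᵢ`, for one nonnegative finite element
function `φ`, would give `|∫ ∂ᵢφ q| ≤ β ‖q‖ |φ|₁` (`weakBound_of_forall_le`). That such fields are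
admissible, i.e. that a nonnegative Lipschitz function vanishing outside `Ω` belongs to `H¹₀(Ω)`
whatever the boundary of `Ω` looks like, is `memH10_of_lipschitz`: the truncations `(φ - ε)₊` have
compact support in `Ω` and can be mollified.

Two kinds of test functions suffice for all meshes.

* The bubble of a rectangle, or of the diagonal of a cut rectangle, is even under the point
  reflection in the centre. The odd part of a pressure is affine, for `ℚ₁` and also for two `ℙ₁`
  pieces that agree on the diagonal. So both directions of differentiation yield the difference of
  the means of the corner values over two opposite sides (`bubble_bound`).
* The function of an edge between two cells of equal size, used with its tangential derivative,
  yields the difference of the pressure at the end points of that edge; in the `ℚ₁` case this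
  holds after a correction by the bubble bounds on the two adjacent cells (`edge_bound`).

On a `w × h` cell the norm `|φ|₁` is of order `√(w / h + h / w)`. In the scaling
`|δq| √(w h)` of `L²` on the cell, the difference of `q` in the direction of the side of length `h`
is therefore bounded by `β ‖q‖ (1 + h / w)`, up to a constant factor. This is uniform for differences *across* a
thin strip. On the block `M'`, whose cells have bounded aspect ratio, differences in all directions
are controlled. From there the bounds pass across the thin strips: the two mean differences and the
difference along the edge in the middle determine the corner values on one side of a strip by those
on the other side. The weight `√(w h)` of a thin cell is not larger than a multiple of the
weight of a cell of `M'`, so nothing is lost for thin cells (`IsEdgePatch.exists_cornersNear`).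

Thus all corner values are close to one constant `c`, in the scaling of `L²`. Since `q` has mean
zero, `‖q‖ ≤ ‖q - c‖`, and on every cell `q - c` is bounded by its corner values
(`l2Norm_sq_le`). Hence `‖q‖² ≤ C β² ‖q‖²`, a contradiction for small `β`. The images of a patch
under the two reflections are treated on the level of corner values. For the test functions only
the exchange of the coordinates is needed, to obtain horizontal edges from vertical ones.
-/

open scoped NNReal Convolution

namespace TaylorHood

/-! ### Weak derivatives of Lipschitz functions -/

theorem partialDeriv_eq_lineDeriv {φ : Plane → ℝ} (hφ : ContDiff ℝ ∞ φ) (i : Fin 2) (z : Plane) :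
    partialDeriv i φ z = lineDeriv ℝ φ z (unitVec i) := by
  rw [partialDeriv]
  exact ((hφ.differentiable (by simp)).differentiableAt.lineDeriv_eq_fderiv).symm

theorem unitVec_norm (i : Fin 2) : ‖unitVec i‖ = 1 := by
  fin_cases i <;> simp [unitVec, Prod.norm_def]

theorem memLp_lineDeriv_restrict {Ω : Set Plane} (hb : volume Ω ≠ ⊤) {f : Plane → ℝ} {C : ℝ≥0}
    (hf : LipschitzWith C f) (v : Plane) :
    MemLp (fun z => lineDeriv ℝ f z v) 2 (volume.restrict Ω) := by
  have : IsFiniteMeasure (volume.restrict Ω) := ⟨by simpa using hb.lt_top⟩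
  exact (hf.memLp_lineDeriv v).mono_exponent le_top

/-- Integration by parts for Lipschitz functions against test functions. -/
theorem isWeakPartial_lineDeriv {Ω : Set Plane} (hb : volume Ω ≠ ⊤) {f : Plane → ℝ} {C : ℝ≥0}
    (hf : LipschitzWith C f) (i : Fin 2) :
    IsWeakPartial Ω i f (fun z => lineDeriv ℝ f z (unitVec i)) := by
  refine ⟨memLp_lineDeriv_restrict hb hf _, fun φ hφ => ?_⟩
  obtain ⟨D, hD⟩ := (hφ.smooth.of_le (by simp)).lipschitzWith_of_hasCompactSupport (n := ∞)
    hφ.compact (by simp)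
  have h0 : ∀ z, z ∉ Ω → φ z = 0 := fun z hz =>
    image_eq_zero_of_notMem_tsupport fun h => hz (hφ.support_subset h)
  have h1 : ∀ z, z ∉ Ω → partialDeriv i φ z = 0 := fun z hz => by
    have : z ∉ tsupport (fderiv ℝ φ) := fun h =>
      hz (hφ.support_subset (tsupport_fderiv_subset ℝ h))
    simp [partialDeriv, image_eq_zero_of_notMem_tsupport this]
  rw [setIntegral_eq_integral_of_forall_compl_eq_zero fun z hz => by simp [h1 z hz],
    setIntegral_eq_integral_of_forall_compl_eq_zero fun z hz => by simp [h0 z hz],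
    hf.integral_lineDeriv_mul_eq hD hφ.compact, ← integral_neg]
  congr 1 with z
  rw [partialDeriv_eq_lineDeriv hφ.smooth, lineDeriv_neg]
  ring

theorem IsWeakPartial.ae_eq {Ω : Set Plane} (hΩ : IsOpen Ω) {i : Fin 2} {f g g' : Plane → ℝ}
    (hg : IsWeakPartial Ω i f g) (hg' : IsWeakPartial Ω i f g') :
    g =ᵐ[volume.restrict Ω] g' := by
  have hl : ∀ {h : Plane → ℝ}, MemLp h 2 (volume.restrict Ω) → LocallyIntegrableOn h Ω volume := by
    intro h hh
    have := hh.locallyIntegrable (by norm_num)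
    exact locallyIntegrableOn_of_locallyIntegrable_restrict this
  have key := hΩ.ae_eq_zero_of_integral_contDiff_smul_eq_zero
    ((hl hg.1).sub (hl hg'.1)) (fun φ h1 h2 h3 => ?_)
  · rw [EventuallyEq, ae_restrict_iff' hΩ.measurableSet]
    filter_upwards [key] with z hz hzΩ
    simpa [sub_eq_zero] using hz hzΩ
  · have hφ : IsTestFunction Ω φ := ⟨h1, h2, h3⟩
    have hi : ∀ {h : Plane → ℝ}, MemLp h 2 (volume.restrict Ω) →
        IntegrableOn (fun z => h z * φ z) Ω := fun hh =>
      hh.integrable_mul ((h1.continuous.memLp_of_hasCompactSupport (p := 2) h2).restrict Ω)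
    have h0 : ∀ z, z ∉ Ω → φ z = 0 := fun z hz =>
      image_eq_zero_of_notMem_tsupport fun h => hz (h3 h)
    have e := hg.2 φ hφ
    rw [hg'.2 φ hφ, neg_inj] at e
    rw [← setIntegral_eq_integral_of_forall_compl_eq_zero (s := Ω)
      fun z hz => by simp [h0 z hz]]
    have : ∀ z, φ z • (g - g') z = g z * φ z - g' z * φ z := fun z => by
      simp; ring
    simp_rw [this]
    rw [integral_sub (hi hg.1) (hi hg'.1), e, sub_self]

/-- The chosen weak derivative agrees with any weak derivative at hand. -/
theorem weakPartial_ae_eq {Ω : Set Plane} (hΩ : IsOpen Ω) {i : Fin 2} {f g : Plane → ℝ}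
    (hg : IsWeakPartial Ω i f g) : weakPartial Ω i f =ᵐ[volume.restrict Ω] g := by
  have h : ∃ g, IsWeakPartial Ω i f g := ⟨g, hg⟩
  rw [weakPartial, dif_pos h]
  exact h.choose_spec.ae_eq hΩ hg

/-- A bounded family of functions on a set of finite measure that converges almost everywhere
converges in `L²`. -/
theorem tendsto_eLpNorm_two_of_bounded {Ω : Set Plane} (hb : volume Ω ≠ ⊤) {F : ℕ → Plane → ℝ}
    {B : ℝ} (hm : ∀ n, AEStronglyMeasurable (F n) (volume.restrict Ω)) (hB : ∀ n z, |F n z| ≤ B)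
    (hF : ∀ᵐ z ∂(volume.restrict Ω), Tendsto (fun n => F n z) atTop (𝓝 0)) :
    Tendsto (fun n => eLpNorm (F n) 2 (volume.restrict Ω)) atTop (𝓝 0) := by
  have h2 : Tendsto (fun n => ∫⁻ z in Ω, ‖F n z‖ₑ ^ (2 : ℝ)) atTop (𝓝 (∫⁻ z in Ω, 0)) := by
    refine tendsto_lintegral_of_dominated_convergence' (fun _ => ENNReal.ofReal B ^ (2 : ℝ))
      (fun n => (hm n).enorm.pow_const _) (fun n => Eventually.of_forall fun z => ?_) ?_ ?_
    · refine ENNReal.rpow_le_rpow ?_ (by norm_num)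
      rw [Real.enorm_eq_ofReal_abs]
      exact ENNReal.ofReal_le_ofReal (hB n z)
    · simp only [lintegral_const, Measure.restrict_apply MeasurableSet.univ, univ_inter]
      exact ENNReal.mul_ne_top (by simp) hb
    · filter_upwards [hF] with z hz
      have := ((ENNReal.continuous_rpow_const (y := 2)).tendsto 0).comp
        ((continuous_enorm.tendsto (0 : ℝ)).comp hz |>.trans (by simp))
      simpa [Function.comp_def] using this
  simp only [lintegral_zero] at h2
  have h3 := ((ENNReal.continuous_rpow_const (y := 1 / 2)).tendsto 0).comp h2
  rw [ENNReal.zero_rpow_of_pos (by norm_num)] at h3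
  refine h3.congr fun n => ?_
  rw [eLpNorm_eq_lintegral_rpow_enorm_toReal (by norm_num) (by norm_num)]
  simp

/-! ### Lipschitz functions with zero boundary values belong to `H¹₀` -/

/-- Mollification of a Lipschitz function commutes with differentiation. -/
theorem hasLineDerivAt_normed_convolution (ρ : ContDiffBump (0 : Plane)) {g : Plane → ℝ} {C : ℝ≥0}
    (hg : LipschitzWith C g) (z v : Plane) :
    HasLineDerivAt ℝ (ρ.normed volume ⋆[ContinuousLinearMap.lsmul ℝ ℝ, volume] g)
      (∫ w, ρ.normed volume w * lineDeriv ℝ g (z - w) v) z v := by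
  have hρc : Continuous (ρ.normed volume) := ρ.continuous_normed
  have hρs : HasCompactSupport (ρ.normed volume) := ρ.hasCompactSupport_normed
  have key := hasDerivAt_integral_of_dominated_loc_of_lip (μ := (volume : Measure Plane))
    (F := fun (t : ℝ) w => ρ.normed volume w * g (z + t • v - w))
    (F' := fun w => ρ.normed volume w * lineDeriv ℝ g (z - w) v) (x₀ := 0) (s := univ)
    (bound := fun w => ρ.normed volume w * (C * ‖v‖)) univ_mem ?_ ?_ ?_ ?_ ?_ ?_
  · simpa [HasLineDerivAt, convolution_def] using key.2
  · refine Eventually.of_forall fun t => Continuous.aestronglyMeasurable ?_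
    exact hρc.mul (hg.continuous.comp (by fun_prop))
  · refine Continuous.integrable_of_hasCompactSupport ?_ hρs.mul_right
    exact hρc.mul (hg.continuous.comp (by fun_prop))
  · refine hρc.aestronglyMeasurable.mul ?_
    exact ((measurable_lineDeriv hg.continuous).comp (measurable_const.sub measurable_id))
      |>.aestronglyMeasurable
  · refine Eventually.of_forall fun w => LipschitzOnWith.of_dist_le_mul fun s _ t _ => ?_
    have h0 := ρ.nonneg_normed (μ := volume) w
    rw [Real.coe_nnabs, abs_of_nonneg (by positivity), Real.dist_eq, ← mul_sub, abs_mul,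
      abs_of_nonneg h0, mul_assoc]
    refine mul_le_mul_of_nonneg_left ?_ h0
    have := hg.dist_le_mul (z + s • v - w) (z + t • v - w)
    rw [Real.dist_eq, dist_eq_norm, show z + s • v - w - (z + t • v - w) = (s - t) • v by
      rw [sub_smul]; abel, norm_smul] at this
    rw [Real.dist_eq]
    calc _ ≤ _ := this
      _ = _ := by rw [Real.norm_eq_abs]; ring
  · exact (hρc.integrable_of_hasCompactSupport hρs).mul_const _
  · have h1 : ∀ᵐ w : Plane, LineDifferentiableAt ℝ g (z - w) v :=
      (Measure.measurePreserving_sub_left volume z).quasiMeasurePreserving.ae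
        (hg.ae_lineDifferentiableAt (μ := volume) v)
    filter_upwards [h1] with w hw
    have := hw.hasLineDerivAt
    rw [HasLineDerivAt] at this
    have h2 := this.const_mul (ρ.normed volume w)
    refine h2.congr_of_eventuallyEq (Eventually.of_forall fun t => ?_)
    simp only
    congr 2
    abel

/-- At a zero of a nonnegative function all line derivatives vanish. -/
theorem lineDeriv_eq_zero_of_nonneg {f : Plane → ℝ} (h0 : ∀ z, 0 ≤ f z) {z : Plane} (hz : f z = 0)
    (v : Plane) : lineDeriv ℝ f z v = 0 := by
  have : IsLocalMin (fun t : ℝ => f (z + t • v)) 0 :=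
    Eventually.of_forall fun t => by simpa [hz] using h0 _
  exact this.deriv_eq_zero

/-- A nonnegative Lipschitz function that vanishes outside a bounded set `Ω` belongs to `H¹₀(Ω)`.
No regularity of the boundary is needed: the approximating test functions are mollifications of
the truncations `(f - ε)₊`, with a radius of mollification small compared to `ε`. -/
theorem memH10_of_lipschitz {Ω : Set Plane} (hb : Bornology.IsBounded Ω)
    {f : Plane → ℝ} {C : ℝ≥0} (hf : LipschitzWith C f) (h0 : ∀ z, 0 ≤ f z)
    (hs : ∀ z, f z ≠ 0 → z ∈ Ω) : MemH10 Ω f := by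
  have hvol : volume Ω ≠ ⊤ := hb.measure_lt_top.ne
  have hfin : IsFiniteMeasure (volume.restrict Ω) := ⟨by simpa using hvol.lt_top⟩
  set ε : ℕ → ℝ := fun n => 1 / ((n : ℝ) + 1) with hε
  have εpos : ∀ n, 0 < ε n := fun n => by positivity
  have εlim : Tendsto ε atTop (𝓝 0) := tendsto_one_div_add_atTop_nhds_zero_nat
  -- on a ball of radius `δ` the function `f` varies by at most `ε / 2`
  set δ : ℕ → ℝ := fun n => ε n / (2 * (C + 1)) with hδ
  have δpos : ∀ n, 0 < δ n := fun n => by have := εpos n; positivity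
  have Cδ : ∀ n, C * δ n ≤ ε n / 2 := fun n => by
    have h1 : (C + 1 : ℝ) * δ n = ε n / 2 := by
      simp only [hδ]; field_simp
    nlinarith [δpos n]
  have δlim : Tendsto δ atTop (𝓝 0) := by
    simpa [hδ] using εlim.div_const (2 * (C + 1 : ℝ))
  let ρ : ℕ → ContDiffBump (0 : Plane) := fun n =>
    ⟨δ n / 2, δ n, half_pos (δpos n), half_lt_self (δpos n)⟩
  let g : ℕ → Plane → ℝ := fun n z => max (f z - ε n) 0
  have hg : ∀ n, LipschitzWith C (g n) := fun n => by
    refine LipschitzWith.of_dist_le_mul fun z w => ?_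
    refine le_trans ?_ (hf.dist_le_mul z w)
    rw [Real.dist_eq, Real.dist_eq]
    refine (abs_max_sub_max_le_abs _ _ _).trans (le_of_eq ?_)
    congr 1; ring
  let φ : ℕ → Plane → ℝ := fun n =>
    (ρ n).normed volume ⋆[ContinuousLinearMap.lsmul ℝ ℝ, volume] (g n)
  have hball : ∀ n z, ∀ w ∈ Metric.ball z (δ n), |f w - f z| ≤ ε n / 2 := fun n z w hw => by
    have := hf.dist_le_mul w z
    rw [Real.dist_eq] at this
    have h2 : C * dist w z ≤ C * δ n :=
      mul_le_mul_of_nonneg_left (Metric.mem_ball.1 hw).le C.2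
    linarith [Cδ n]
  -- the mollified functions live on `{f ≥ ε / 2}`, a compact subset of `Ω`
  have hφ0 : ∀ n z, f z < ε n / 2 → φ n z = 0 := fun n z hz => by
    have hc : ∀ w ∈ Metric.ball z (δ n), g n w = 0 := fun w hw => by
      have := abs_le.1 (hball n z w hw)
      exact max_eq_right (by linarith [this.2])
    have h1 := (ρ n).normed_convolution_eq_right (μ := volume) (g := g n) (x₀ := z) fun w hw => by
      rw [hc w hw, hc z (Metric.mem_ball_self (δpos n))]
    change φ n z = g n z at h1
    rw [h1, hc z (Metric.mem_ball_self (δpos n))]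
  have hts : ∀ n, tsupport (φ n) ⊆ {z | ε n / 2 ≤ f z} := fun n => by
    refine closure_minimal (fun z hz => ?_) (isClosed_le continuous_const hf.continuous)
    by_contra h
    exact hz (hφ0 n z (not_le.1 h))
  have htest : ∀ n, IsTestFunction Ω (φ n) := fun n => by
    have hsub : {z | ε n / 2 ≤ f z} ⊆ Ω := fun z hz =>
      hs z (by have := εpos n; have hz' : ε n / 2 ≤ f z := hz; linarith)
    refine ⟨(ρ n).hasCompactSupport_normed.contDiff_convolution_left _ (ρ n).contDiff_normed
      (hg n).continuous.locallyIntegrable, ?_, (hts n).trans hsub⟩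
    exact Metric.isCompact_of_isClosed_isBounded (isClosed_tsupport _)
      (hb.subset ((hts n).trans hsub))
  have hpd : ∀ n i z, partialDeriv i (φ n) z =
      ∫ w, (ρ n).normed volume w * lineDeriv ℝ (g n) (z - w) (unitVec i) := fun n i z => by
    rw [partialDeriv_eq_lineDeriv (htest n).smooth]
    exact (hasLineDerivAt_normed_convolution (ρ n) (hg n) z _).lineDeriv
  have hpdb : ∀ n i z, |partialDeriv i (φ n) z| ≤ C := fun n i z => by
    have hL : LipschitzWith C (φ n) := by
      refine LipschitzWith.of_dist_le_mul fun z w => ?_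
      simp only [φ, convolution_def, ContinuousLinearMap.lsmul_apply, smul_eq_mul]
      have hi : ∀ z, Integrable (fun t => (ρ n).normed volume t * g n (z - t)) := fun z => by
        refine Continuous.integrable_of_hasCompactSupport ?_
          (ρ n).hasCompactSupport_normed.mul_right
        exact (ρ n).continuous_normed.mul ((hg n).continuous.comp (by fun_prop))
      rw [dist_eq_norm, ← integral_sub (hi z) (hi w)]
      calc _ ≤ ∫ t, (ρ n).normed volume t * (C * dist z w) := by
            refine norm_integral_le_of_norm_le
              ((ρ n).integrable_normed.mul_const _) (Eventually.of_forall fun t => ?_)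
            rw [← mul_sub, norm_mul, Real.norm_of_nonneg ((ρ n).nonneg_normed t)]
            refine mul_le_mul_of_nonneg_left ?_ ((ρ n).nonneg_normed t)
            have := (hg n).dist_le_mul (z - t) (w - t)
            rwa [dist_sub_right, dist_eq_norm] at this
        _ = C * dist z w := by
            rw [integral_mul_const, (ρ n).integral_normed, one_mul]
    rw [partialDeriv_eq_lineDeriv (htest n).smooth]
    simpa [unitVec_norm] using norm_lineDeriv_le_of_lipschitz ℝ hL (x₀ := z) (v := unitVec i)
  have hldb : ∀ i z, |lineDeriv ℝ f z (unitVec i)| ≤ C := fun i z => by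
    simpa [unitVec_norm] using norm_lineDeriv_le_of_lipschitz ℝ hf (x₀ := z) (v := unitVec i)
  refine ⟨?_, fun i z => lineDeriv ℝ f z (unitVec i),
    fun i => isWeakPartial_lineDeriv hvol hf i, φ, htest, ?_, fun i => ?_⟩
  · have hcs : HasCompactSupport f := by
      refine HasCompactSupport.of_support_subset_isCompact (K := closure Ω)
        hb.isCompact_closure fun z hz => subset_closure (hs z hz)
    exact (hf.continuous.memLp_of_hasCompactSupport hcs).restrict Ω
  · have hφf : ∀ n z, |f z - φ n z| ≤ 2 * ε n := fun n z => by
      have h1 : dist (φ n z) (g n z) ≤ ε n / 2 :=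
        (ρ n).dist_normed_convolution_le (μ := volume) (hg n).continuous.aestronglyMeasurable
          fun w hw => by
            have h2 := hball n z w hw
            rw [Real.dist_eq]
            refine (abs_max_sub_max_le_abs _ _ _).trans (le_trans (le_of_eq ?_) h2)
            congr 1; ring
      rw [Real.dist_eq] at h1
      have h3 : |f z - g n z| ≤ ε n := by
        simp only [g]
        rcases le_total (f z - ε n) 0 with h | h
        · rw [max_eq_right h, sub_zero, abs_of_nonneg (h0 z)]; linarith
        · rw [max_eq_left h, sub_sub_cancel, abs_of_pos (εpos n)]
      have := abs_sub_le (f z) (g n z) (φ n z)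
      rw [abs_sub_comm (g n z)] at this
      linarith [εpos n]
    refine tendsto_eLpNorm_two_of_bounded hvol (B := 2) (fun n => ?_) (fun n z => ?_)
      (Eventually.of_forall fun z => ?_)
    · exact (hf.continuous.sub (htest n).smooth.continuous).aestronglyMeasurable
    · refine (hφf n z).trans ?_
      have : ε n ≤ 1 := by
        simp only [hε]
        rw [div_le_one (by positivity)]
        linarith [Nat.cast_nonneg (α := ℝ) n]
      linarith
    · refine squeeze_zero_norm (fun n => hφf n z) ?_
      simpa using εlim.const_mul 2
  · refine tendsto_eLpNorm_two_of_bounded hvol (B := C + C) (fun n => ?_) (fun n z => ?_) ?_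
    · refine AEStronglyMeasurable.sub
        (measurable_lineDeriv hf.continuous).aestronglyMeasurable ?_
      have : partialDeriv i (φ n) = fun z => fderiv ℝ (φ n) z (unitVec i) := rfl
      rw [this]
      exact (((htest n).smooth.continuous_fderiv (by simp)).clm_apply
        continuous_const).aestronglyMeasurable
    · exact (abs_sub _ _).trans (add_le_add (hldb i z) (hpdb n i z))
    · refine ae_restrict_of_ae ?_
      -- the mollified derivatives of `f` itself converge almost everywhere, by Lebesgue's theorem
      have hleb := ContDiffBump.ae_convolution_tendsto_right_of_locallyIntegrable
        (μ := (volume : Measure Plane)) (φ := ρ) (l := atTop) (K := 2) δlim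
        (Eventually.of_forall fun n => by
          change δ n ≤ 2 * (δ n / 2)
          linarith) (hf.locallyIntegrable_lineDeriv (unitVec i))
      filter_upwards [hleb] with z hz
      suffices h : Tendsto (fun n => partialDeriv i (φ n) z) atTop
          (𝓝 (lineDeriv ℝ f z (unitVec i))) by
        simpa using (tendsto_const_nhds (x := lineDeriv ℝ f z (unitVec i))).sub h
      rcases (h0 z).eq_or_lt with h | h
      · -- near a zero of `f` the truncations vanish
        rw [lineDeriv_eq_zero_of_nonneg h0 h.symm]
        refine tendsto_const_nhds.congr fun n => ?_
        rw [hpd]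
        refine (integral_eq_zero_of_ae (Eventually.of_forall fun w => ?_)).symm
        simp only [Pi.zero_apply, mul_eq_zero]
        by_cases hw : (ρ n).normed volume w = 0
        · exact Or.inl hw
        · right
          have hw' : w ∈ Metric.ball (0 : Plane) (δ n) := by
            have : w ∈ Function.support ((ρ n).normed volume) := hw
            rwa [(ρ n).support_normed_eq] at this
          have hw2 : z - w ∈ Metric.ball z (δ n) := by
            simpa [dist_eq_norm] using hw'
          refine lineDeriv_eq_zero_of_nonneg (fun _ => le_max_right _ _) ?_ _
          have := abs_le.1 (hball n z _ hw2)
          exact max_eq_right (by linarith [this.2, εpos n])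
      · -- where `f` is positive, the truncations differ from it by constants
        refine hz.congr' ?_
        filter_upwards [(tendsto_order.1 εlim).2 (f z / 2) (half_pos h)] with n hn
        rw [hpd, convolution_def]
        congr 1 with w
        simp only [ContinuousLinearMap.lsmul_apply, smul_eq_mul]
        by_cases hw : (ρ n).normed volume w = 0
        · simp [hw]
        · have hw' : w ∈ Metric.ball (0 : Plane) (δ n) := by
            have : w ∈ Function.support ((ρ n).normed volume) := hw
            rwa [(ρ n).support_normed_eq] at this
          have hw2 : z - w ∈ Metric.ball z (δ n) := by
            simpa [dist_eq_norm] using hw'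
          have h3 := abs_le.1 (hball n z _ hw2)
          have h4 : ε n < f (z - w) := by linarith [h3.1, εpos n]
          have h5 : g n =ᶠ[𝓝 (z - w)] fun y => f y - ε n := by
            filter_upwards [(hf.continuous.tendsto _).eventually (lt_mem_nhds h4)] with y hy
            exact max_eq_left (by linarith)
          rw [h5.lineDeriv_eq]
          congr 1
          simp only [lineDeriv]
          rw [deriv_sub_const]

theorem MemH10.neg {Ω : Set Plane} {f : Plane → ℝ} (h : MemH10 Ω f) : MemH10 Ω (-f) := by
  obtain ⟨hf, g, hg, φ, hφ, h1, h2⟩ := h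
  have hp : ∀ i n, partialDeriv i (-φ n) = -partialDeriv i (φ n) := fun i n => by
    funext z
    simp [partialDeriv, fderiv_neg]
  refine ⟨hf.neg, fun i => -g i, fun i => ⟨(hg i).1.neg, fun ψ hψ => ?_⟩, fun n => -φ n,
    fun n => ⟨(hφ n).smooth.neg, (hφ n).compact.comp_left (g := fun x => -x) neg_zero, ?_⟩,
    ?_, fun i => ?_⟩
  · have := (hg i).2 ψ hψ
    simp only [Pi.neg_apply, neg_mul, integral_neg, this]
  · rw [tsupport_neg]; exact (hφ n).support_subset
  · refine h1.congr fun n => ?_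
    rw [← eLpNorm_neg]; congr 1; funext z; simp only [Pi.neg_apply, Pi.sub_apply]; ring
  · refine (h2 i).congr fun n => ?_
    rw [hp, ← eLpNorm_neg]; congr 1; funext z; simp only [Pi.neg_apply, Pi.sub_apply]; ring

theorem memH10_zero (Ω : Set Plane) : MemH10 Ω 0 := by
  have hp : ∀ i, partialDeriv i 0 = 0 := fun i => by
    funext z
    simp [partialDeriv]
  exact ⟨MemLp.zero, 0, fun i => ⟨MemLp.zero, fun _ _ => by simp⟩, fun _ => 0,
    fun _ => ⟨contDiff_const, HasCompactSupport.zero, by simp⟩, by simp, fun i => by simp [hp]⟩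

/-! ### Testing the inf-sup condition with one scalar function -/

/-- An anisotropic Lipschitz condition, with constant `A` in `x` and `B` in `y`. -/
def LipXY (A B : ℝ) (φ : Plane → ℝ) : Prop :=
  ∀ z w : Plane, |φ z - φ w| ≤ A * |z.1 - w.1| + B * |z.2 - w.2|

theorem LipXY.lipschitzWith {A B : ℝ} {φ : Plane → ℝ} (h : LipXY A B φ) (hA : 0 ≤ A) (hB : 0 ≤ B) :
    LipschitzWith (A + B).toNNReal φ := by
  refine LipschitzWith.of_dist_le_mul fun z w => ?_
  rw [Real.coe_toNNReal _ (by positivity), Real.dist_eq, Prod.dist_eq, Real.dist_eq, Real.dist_eq,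
    add_mul]
  exact (h z w).trans (add_le_add (mul_le_mul_of_nonneg_left (le_max_left _ _) hA)
    (mul_le_mul_of_nonneg_left (le_max_right _ _) hB))

theorem LipXY.abs_lineDeriv_le {A B : ℝ} {φ : Plane → ℝ} (h : LipXY A B φ) (hA : 0 ≤ A)
    (hB : 0 ≤ B) (i : Fin 2) (z : Plane) : |lineDeriv ℝ φ z (unitVec i)| ≤ ![A, B] i := by
  have key : ∀ D : ℝ, 0 ≤ D → (∀ s t : ℝ, |φ (z + s • unitVec i) - φ (z + t • unitVec i)| ≤
      D * |s - t|) → |lineDeriv ℝ φ z (unitVec i)| ≤ D := fun D hD hl => by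
    have : LipschitzWith D.toNNReal (fun t : ℝ => φ (z + t • unitVec i)) :=
      LipschitzWith.of_dist_le_mul fun s t => by
        rw [Real.coe_toNNReal _ hD]; exact hl s t
    simpa [Real.coe_toNNReal _ hD, lineDeriv] using
      norm_deriv_le_of_lipschitz (x₀ := (0 : ℝ)) this
  fin_cases i
  · refine key A hA fun s t => (h _ _).trans (le_of_eq ?_)
    simp [unitVec]
  · refine key B hB fun s t => (h _ _).trans (le_of_eq ?_)
    simp [unitVec]

/-- The squared `H¹`-seminorm of a Lipschitz function on the plane. -/
noncomputable def gradSq (φ : Plane → ℝ) : ℝ :=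
  ∑ j, ∫ z, lineDeriv ℝ φ z (unitVec j) ^ 2

theorem gradSq_le {A B a b c d : ℝ} {φ : Plane → ℝ} (h : LipXY A B φ) (hA : 0 ≤ A)
    (hB : 0 ≤ B) (h0 : ∀ z, 0 ≤ φ z) (hab : a ≤ b) (hcd : c ≤ d)
    (hs : ∀ z, φ z ≠ 0 → z ∈ Icc a b ×ˢ Icc c d) :
    gradSq φ ≤ (A ^ 2 + B ^ 2) * ((b - a) * (d - c)) := by
  have hm : volume.real (Icc a b ×ˢ Icc c d : Set Plane) = (b - a) * (d - c) := by
    rw [Measure.volume_eq_prod, measureReal_prod_prod, Real.volume_real_Icc_of_le hab,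
      Real.volume_real_Icc_of_le hcd]
  have key : ∀ j, ∫ z, lineDeriv ℝ φ z (unitVec j) ^ 2 ≤ ![A, B] j ^ 2 * ((b - a) * (d - c)) := by
    intro j
    rw [← setIntegral_eq_integral_of_forall_compl_eq_zero (s := Icc a b ×ˢ Icc c d)
      (fun z hz => by
        rw [lineDeriv_eq_zero_of_nonneg h0 (by_contra fun hne => hz (hs z hne))]; simp)]
    have := norm_setIntegral_le_of_norm_le_const (μ := volume)
      (s := (Icc a b ×ˢ Icc c d : Set Plane))
      (f := fun z => lineDeriv ℝ φ z (unitVec j) ^ 2) (C := ![A, B] j ^ 2)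
      ((isCompact_Icc.prod isCompact_Icc).measure_lt_top) (fun z _ => by
        rw [Real.norm_of_nonneg (sq_nonneg _), ← sq_abs]
        exact pow_le_pow_left₀ (abs_nonneg _) (h.abs_lineDeriv_le hA hB j z) 2)
    rw [hm] at this
    exact (le_abs_self _).trans this
  have := add_le_add (key 0) (key 1)
  simp only [gradSq, Fin.sum_univ_two]
  simp only [Matrix.cons_val_zero, Matrix.cons_val_one] at this
  linarith

/-- `φ` is a nonnegative scalar finite element function that vanishes on the boundary. -/
structure IsBump (𝒦 : Set (Set Plane)) (S : Submodule ℝ (MvPolynomial (Fin 2) ℝ))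
    (φ : Plane → ℝ) : Prop where
  mem : φ ∈ feSpace 𝒦 S
  lip : ∃ C, LipschitzWith C φ
  nonneg : ∀ z, 0 ≤ φ z
  support : ∀ z, φ z ≠ 0 → z ∈ domain 𝒦

/-- The negative norm of `∇q`, tested only with fields that have one nonzero component and that
component of one sign, is at most `s`. -/
def WeakBound (𝒦 : Set (Set Plane)) (S : Submodule ℝ (MvPolynomial (Fin 2) ℝ)) (q : Plane → ℝ)
    (s : ℝ) : Prop :=
  ∀ φ, IsBump 𝒦 S φ → ∀ i, |∫ z, lineDeriv ℝ φ z (unitVec i) * q z| ≤ s * √(gradSq φ)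

theorem IsBump.integrable_mul {𝒦 : Set (Set Plane)} {S : Submodule ℝ (MvPolynomial (Fin 2) ℝ)}
    {φ q : Plane → ℝ} (hφ : IsBump 𝒦 S φ) (hb : Bornology.IsBounded (domain 𝒦))
    (hq : MemLp q 2 (volume.restrict (domain 𝒦))) (i : Fin 2) :
    Integrable (fun z => lineDeriv ℝ φ z (unitVec i) * q z) := by
  obtain ⟨C, hC⟩ := hφ.lip
  have h1 : IntegrableOn (fun z => lineDeriv ℝ φ z (unitVec i) * q z) (domain 𝒦) :=
    (memLp_lineDeriv_restrict hb.measure_lt_top.ne hC (unitVec i)).integrable_mul hq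
  rwa [integrableOn_iff_integrable_of_support_subset] at h1
  intro z hz
  by_contra h
  refine hz ?_
  simp only
  rw [lineDeriv_eq_zero_of_nonneg hφ.nonneg (by_contra fun hne => h (hφ.support z hne)), zero_mul]

theorem zero_mem_feSpace (𝒦 : Set (Set Plane)) (S : Submodule ℝ (MvPolynomial (Fin 2) ℝ)) :
    (0 : Plane → ℝ) ∈ feSpace 𝒦 S :=
  ⟨continuousOn_const, fun _ _ => ⟨0, S.zero_mem, by simp⟩⟩

theorem neg_mem_feSpace {𝒦 : Set (Set Plane)} {S : Submodule ℝ (MvPolynomial (Fin 2) ℝ)}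
    {f : Plane → ℝ} (h : f ∈ feSpace 𝒦 S) : -f ∈ feSpace 𝒦 S :=
  ⟨h.1.neg, fun K hK => by
    obtain ⟨p, hp, hf⟩ := h.2 K hK
    exact ⟨-p, S.neg_mem hp, fun z hz => by simp [hf z hz]⟩⟩

/-- An upper bound for the inf-sup quotients of `q` gives a bound for the negative norm of `∇q`.
Only integrals of line derivatives over the whole plane appear in the result, and no weak
derivatives. -/
theorem weakBound_of_forall_le {𝒦 : Set (Set Plane)} {S : Submodule ℝ (MvPolynomial (Fin 2) ℝ)}
    (hb : Bornology.IsBounded (domain 𝒦)) {q : Plane → ℝ}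
    (hq0 : l2Norm (domain 𝒦) q ≠ 0) {β : ℝ}
    (H : ∀ v ∈ velocitySpace 𝒦 S, h1Seminorm (domain 𝒦) v ≠ 0 →
      (∫ z in domain 𝒦, divergence (domain 𝒦) v z * q z) /
        (h1Seminorm (domain 𝒦) v * l2Norm (domain 𝒦) q) ≤ β) :
    WeakBound 𝒦 S q (β * l2Norm (domain 𝒦) q) := by
  intro φ hφ i
  set Ω := domain 𝒦 with hΩ
  have hopen : IsOpen Ω := isOpen_interior
  have hvol : volume Ω ≠ ⊤ := hb.measure_lt_top.ne
  obtain ⟨C, hC⟩ := hφ.lip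
  have hH10 := memH10_of_lipschitz hb hC hφ.nonneg hφ.support
  have hd0 : ∀ j z, z ∉ Ω → lineDeriv ℝ φ z (unitVec j) = 0 := fun j z hz =>
    lineDeriv_eq_zero_of_nonneg hφ.nonneg (by_contra fun hne => hz (hφ.support z hne)) _
  have hgrad : gradSq φ = ∑ j, ∫ z in Ω, lineDeriv ℝ φ z (unitVec j) ^ 2 := by
    refine Finset.sum_congr rfl fun j _ => ?_
    rw [setIntegral_eq_integral_of_forall_compl_eq_zero fun z hz => by simp [hd0 j z hz]]
  have hint : ∫ z, lineDeriv ℝ φ z (unitVec i) * q z =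
      ∫ z in Ω, lineDeriv ℝ φ z (unitVec i) * q z := by
    rw [setIntegral_eq_integral_of_forall_compl_eq_zero fun z hz => by simp [hd0 i z hz]]
  have hz : ∀ j, weakPartial Ω j 0 =ᵐ[volume.restrict Ω] 0 := fun j =>
    weakPartial_ae_eq hopen ⟨MemLp.zero, fun _ _ => by simp⟩
  -- the bound for the field `Φ eᵢ`, where `Φ = φ` or `Φ = -φ`
  have key : ∀ (Φ : Plane → ℝ) (s : ℝ), Φ ∈ feSpace 𝒦 S → MemH10 Ω Φ → s ^ 2 = 1 →
      (∀ j, IsWeakPartial Ω j Φ fun z => s * lineDeriv ℝ φ z (unitVec j)) →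
      s * ∫ z in Ω, lineDeriv ℝ φ z (unitVec i) * q z ≤ β * l2Norm Ω q * √(gradSq φ) := by
    intro Φ s hΦ hΦ' hs hw
    let v : Fin 2 → Plane → ℝ := fun k => if k = i then Φ else 0
    have hv : v ∈ velocitySpace 𝒦 S := fun k => by
      by_cases hk : k = i
      · simpa only [v, if_pos hk] using ⟨hΦ, hΦ'⟩
      · simpa only [v, if_neg hk] using ⟨zero_mem_feSpace 𝒦 S, memH10_zero Ω⟩
    have hvp : ∀ k j, weakPartial Ω j (v k) =ᵐ[volume.restrict Ω]
        fun z => if k = i then s * lineDeriv ℝ φ z (unitVec j) else 0 := fun k j => by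
      by_cases hk : k = i
      · simpa only [v, if_pos hk] using weakPartial_ae_eq hopen (hw j)
      · simp only [v, if_neg hk]
        exact hz j
    have hsn : h1Seminorm Ω v = √(gradSq φ) := by
      rw [h1Seminorm, hgrad]
      congr 1
      rw [Finset.sum_eq_single i]
      · refine Finset.sum_congr rfl fun j _ => integral_congr_ae ?_
        filter_upwards [hvp i j] with z h
        rw [h, if_pos rfl, mul_pow, hs, one_mul]
      · intro k _ hk
        refine Finset.sum_eq_zero fun j _ => integral_eq_zero_of_ae ?_
        filter_upwards [hvp k j] with z h
        simp [h, if_neg hk]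
      · simp
    have hdiv : ∫ z in Ω, divergence Ω v z * q z =
        s * ∫ z in Ω, lineDeriv ℝ φ z (unitVec i) * q z := by
      rw [← integral_const_mul]
      refine integral_congr_ae ?_
      filter_upwards [hvp 0 0, hvp 1 1] with z h1 h2
      rw [divergence, Fin.sum_univ_two, h1, h2]
      fin_cases i <;> simp <;> ring
    -- if the seminorm vanishes, the quotient says nothing, but the left-hand side is zero
    by_cases hne : √(gradSq φ) = 0
    · have hge : 0 ≤ gradSq φ := Finset.sum_nonneg fun j _ => integral_nonneg fun z => sq_nonneg _
      have h0 : gradSq φ = 0 := by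
        rwa [Real.sqrt_eq_zero hge] at hne
      rw [hgrad, Finset.sum_eq_zero_iff_of_nonneg
        (fun j _ => integral_nonneg fun z => sq_nonneg _)] at h0
      have h1 := h0 i (Finset.mem_univ _)
      rw [integral_eq_zero_iff_of_nonneg (fun z => sq_nonneg _)
        (memLp_lineDeriv_restrict hvol hC _).integrable_sq] at h1
      have h2 : ∫ z in Ω, lineDeriv ℝ φ z (unitVec i) * q z = 0 := by
        refine integral_eq_zero_of_ae ?_
        filter_upwards [h1] with z hz
        have : lineDeriv ℝ φ z (unitVec i) = 0 := by simpa using hz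
        simp [this]
      rw [h2, hne]; simp
    · have h1 := H v hv (by rwa [hsn])
      have hp1 : 0 < √(gradSq φ) := lt_of_le_of_ne (Real.sqrt_nonneg _) (Ne.symm hne)
      have hp2 : 0 < l2Norm Ω q := lt_of_le_of_ne (Real.sqrt_nonneg _) (Ne.symm hq0)
      rw [hdiv, hsn, div_le_iff₀ (by positivity)] at h1
      linarith
  have h1 := key φ 1 hφ.mem hH10 (by norm_num) fun j => by
    simpa using isWeakPartial_lineDeriv hvol hC j
  have h2 := key (-φ) (-1) (neg_mem_feSpace hφ.mem) hH10.neg (by norm_num) fun j => by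
    have := isWeakPartial_lineDeriv (Ω := Ω) hvol hC j
    refine ⟨by simpa [Pi.neg_def] using this.1.neg, fun ψ hψ => ?_⟩
    have e := this.2 ψ hψ
    simp only [Pi.neg_apply, neg_mul, one_mul, integral_neg, e]
  rw [hint, abs_le]
  constructor <;> linarith

/-- Integration by parts in `y` against a function that is affine in `y` on every vertical
slice. -/
theorem integral_lineDeriv_mul_of_slices {φ q : Plane → ℝ} {C : ℝ≥0} (hφ : LipschitzWith C φ)
    (hc : HasCompactSupport φ) (h0 : ∀ z, 0 ≤ φ z)
    (hint : Integrable fun z => lineDeriv ℝ φ z (unitVec 1) * q z) {B g : ℝ → ℝ}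
    (hq : ∀ z, φ z ≠ 0 → q z = z.2 * B z.1 + g z.1) :
    ∫ z, lineDeriv ℝ φ z (unitVec 1) * q z = -∫ x, B x * ∫ y, φ (x, y) := by
  rw [Measure.volume_eq_prod] at hint ⊢
  rw [integral_prod _ hint, ← integral_neg]
  congr 1 with x
  set ψ : ℝ → ℝ := fun y => φ (x, y) with hψ
  have hψL : LipschitzWith C ψ := LipschitzWith.of_dist_le_mul fun s t => by
    simpa [Prod.dist_eq] using hφ.dist_le_mul (x, s) (x, t)
  have hψc : HasCompactSupport ψ := by
    refine HasCompactSupport.of_support_subset_isCompact (hc.isCompact.image continuous_snd) ?_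
    exact fun y hy => ⟨(x, y), subset_tsupport _ hy, rfl⟩
  have hd : ∀ y, lineDeriv ℝ φ (x, y) (unitVec 1) = lineDeriv ℝ ψ y 1 := fun y => by
    simp [lineDeriv, hψ, unitVec]
  have haff : LipschitzWith |B x|.toNNReal fun y => y * B x + g x :=
    LipschitzWith.of_dist_le_mul fun s t => by
      rw [Real.coe_toNNReal _ (abs_nonneg _), Real.dist_eq, Real.dist_eq, ← abs_mul]
      exact le_of_eq (by congr 1; ring)
  have hda : ∀ y, lineDeriv ℝ (fun y => y * B x + g x) y (-1) = -B x := fun y => by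
    refine HasLineDerivAt.lineDeriv ?_
    have := (((hasDerivAt_id (0 : ℝ)).const_sub y).mul_const (B x)).add_const (g x)
    rw [HasLineDerivAt]
    refine (this.congr_deriv (by ring)).congr_of_eventuallyEq (Eventually.of_forall fun t => ?_)
    simp only [id_eq, smul_eq_mul]
    ring
  have key := haff.integral_lineDeriv_mul_eq (μ := volume) hψL hψc (-1)
  simp only [hda, neg_neg] at key
  rw [integral_const_mul] at key
  rw [← neg_mul, key]
  congr 1 with y
  rw [hd]
  by_cases hz : φ (x, y) = 0
  · rw [← hd, lineDeriv_eq_zero_of_nonneg h0 hz]; simp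
  · rw [hq _ hz]

/-! ### Polynomial functions on cells -/

/-- Functions on the plane given by a polynomial from `S`. -/
def PolyFun (S : Submodule ℝ (MvPolynomial (Fin 2) ℝ)) (f : Plane → ℝ) : Prop :=
  ∃ p ∈ S, ∀ z : Plane, f z = MvPolynomial.eval ![z.1, z.2] p

theorem polyFun_zero (S : Submodule ℝ (MvPolynomial (Fin 2) ℝ)) : PolyFun S fun _ => 0 :=
  ⟨0, S.zero_mem, by simp⟩

theorem polyFun_affine (a b c : ℝ) : PolyFun (polyP 1) fun z => a + b * z.1 + c * z.2 := by
  refine ⟨MvPolynomial.C a + MvPolynomial.C b * MvPolynomial.X 0 +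
    MvPolynomial.C c * MvPolynomial.X 1, ?_, fun z => by simp⟩
  have hm : ∀ (r : ℝ) (i : Fin 2), MvPolynomial.C r * MvPolynomial.X i ∈ polyP 1 := fun r i => by
    rw [MvPolynomial.mem_restrictTotalDegree]
    refine (MvPolynomial.totalDegree_mul _ _).trans ?_
    rw [MvPolynomial.totalDegree_C, MvPolynomial.totalDegree_X]
  refine add_mem (add_mem ?_ (hm b 0)) (hm c 1)
  rw [MvPolynomial.mem_restrictTotalDegree, MvPolynomial.totalDegree_C]
  exact zero_le_one

theorem PolyFun.mul {f g : Plane → ℝ} (hf : PolyFun (polyP 1) f) (hg : PolyFun (polyP 1) g) :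
    PolyFun (polyP 2) fun z => f z * g z := by
  obtain ⟨p, hp, hf⟩ := hf
  obtain ⟨r, hr, hg⟩ := hg
  refine ⟨p * r, ?_, fun z => by simp [hf, hg]⟩
  rw [MvPolynomial.mem_restrictTotalDegree] at *
  exact (MvPolynomial.totalDegree_mul _ _).trans (by omega)

theorem mem_polyQ_iff (l : ℕ) (p : MvPolynomial (Fin 2) ℝ) :
    p ∈ polyQ l ↔ ∀ i, p.degreeOf i ≤ l := by
  rw [MvPolynomial.mem_restrictDegree]
  simp only [MvPolynomial.degreeOf_le_iff]
  exact ⟨fun h i s hs => h s hs i, fun h s hs i => h i s hs⟩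

/-- A product of a quadratic polynomial in `x` and a quadratic polynomial in `y`. -/
theorem polyFun_quadratic_mul (a b c a' b' c' : ℝ) : PolyFun (polyQ 2) fun z =>
    (a + b * z.1 + c * z.1 ^ 2) * (a' + b' * z.2 + c' * z.2 ^ 2) := by
  have hm : ∀ (r : ℝ) (k l : ℕ), k ≤ 2 → l ≤ 2 →
      MvPolynomial.monomial (Finsupp.single 0 k + Finsupp.single 1 l) r ∈ polyQ 2 := by
    intro r k l hk hl
    rw [mem_polyQ_iff]
    intro i
    refine (MvPolynomial.degreeOf_le_iff).2 fun s hs => ?_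
    have := MvPolynomial.support_monomial_subset hs
    rw [Finset.mem_singleton] at this
    subst this
    fin_cases i <;> simp [hk, hl]
  have he : ∀ (r : ℝ) (k l : ℕ) (z : Plane), MvPolynomial.eval ![z.1, z.2]
      (MvPolynomial.monomial (Finsupp.single 0 k + Finsupp.single 1 l) r) =
        r * (z.1 ^ k * z.2 ^ l) := by
    intro r k l z
    rw [MvPolynomial.eval_monomial, Finsupp.prod_add_index' (by simp) (by simp [pow_add])]
    simp [Finsupp.prod_single_index]
  refine ⟨∑ k : Fin 3, ∑ l : Fin 3, MvPolynomial.monomial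
    (Finsupp.single 0 (k : ℕ) + Finsupp.single 1 (l : ℕ)) (![a, b, c] k * ![a', b', c'] l),
    sum_mem fun k _ => sum_mem fun l _ => hm _ _ _ (by omega) (by omega), fun z => ?_⟩
  simp only [Fin.sum_univ_three, map_add, he]
  simp
  ring

theorem eval_polyQ_one {p : MvPolynomial (Fin 2) ℝ} (hp : p ∈ polyQ 1) :
    ∃ a b c d : ℝ, ∀ x y, MvPolynomial.eval ![x, y] p = a + b * x + c * y + d * (x * y) := by
  rw [MvPolynomial.mem_restrictDegree] at hp
  have key : ∀ s ∈ p.support, ∃ a b c d : ℝ, ∀ x y : ℝ,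
      p.coeff s * ∏ i, (![x, y] : Fin 2 → ℝ) i ^ s i = a + b * x + c * y + d * (x * y) := by
    intro s hs
    have h0 := hp s hs 0
    have h1 := hp s hs 1
    simp only [Fin.prod_univ_two, Matrix.cons_val_zero, Matrix.cons_val_one]
    interval_cases s 0 <;> interval_cases s 1
    · exact ⟨p.coeff s, 0, 0, 0, fun x y => by ring⟩
    · exact ⟨0, 0, p.coeff s, 0, fun x y => by ring⟩
    · exact ⟨0, p.coeff s, 0, 0, fun x y => by ring⟩
    · exact ⟨0, 0, 0, p.coeff s, fun x y => by ring⟩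
  choose! a b c d h using key
  refine ⟨∑ s ∈ p.support, a s, ∑ s ∈ p.support, b s, ∑ s ∈ p.support, c s,
    ∑ s ∈ p.support, d s, fun x y => ?_⟩
  rw [MvPolynomial.eval_eq', Finset.sum_mul, Finset.sum_mul, Finset.sum_mul,
    ← Finset.sum_add_distrib, ← Finset.sum_add_distrib, ← Finset.sum_add_distrib]
  exact Finset.sum_congr rfl fun s hs => h s hs x y

theorem eval_polyP_one {p : MvPolynomial (Fin 2) ℝ} (hp : p ∈ polyP 1) :
    ∃ a b c : ℝ, ∀ x y, MvPolynomial.eval ![x, y] p = a + b * x + c * y := by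
  rw [MvPolynomial.mem_restrictTotalDegree] at hp
  have key : ∀ s ∈ p.support, ∃ a b c : ℝ, ∀ x y : ℝ,
      p.coeff s * ∏ i, (![x, y] : Fin 2 → ℝ) i ^ s i = a + b * x + c * y := by
    intro s hs
    have hs' := (MvPolynomial.le_totalDegree hs).trans hp
    rw [Finsupp.sum_fintype _ _ (by simp), Fin.sum_univ_two] at hs'
    have h0 : s 0 ≤ 1 := by omega
    have h1 : s 1 ≤ 1 := by omega
    simp only [Fin.prod_univ_two, Matrix.cons_val_zero, Matrix.cons_val_one]
    interval_cases s 0 <;> interval_cases s 1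
    · exact ⟨p.coeff s, 0, 0, fun x y => by ring⟩
    · exact ⟨0, 0, p.coeff s, fun x y => by ring⟩
    · exact ⟨0, p.coeff s, 0, fun x y => by ring⟩
    · omega
  choose! a b c h using key
  refine ⟨∑ s ∈ p.support, a s, ∑ s ∈ p.support, b s, ∑ s ∈ p.support, c s, fun x y => ?_⟩
  rw [MvPolynomial.eval_eq', Finset.sum_mul, Finset.sum_mul,
    ← Finset.sum_add_distrib, ← Finset.sum_add_distrib]
  exact Finset.sum_congr rfl fun s hs => h s hs x y

/-! ### Rectangles, their halves, and meshes -/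

namespace Rect

/-- The width of a rectangle. -/
def width (R : Rect) : ℝ := R.x.2 - R.x.1

/-- The height of a rectangle. -/
def height (R : Rect) : ℝ := R.y.2 - R.y.1

/-- The horizontal coordinate, scaled to run from `0` to `1` across the rectangle. -/
noncomputable def u (R : Rect) (z : Plane) : ℝ := (z.1 - R.x.1) / R.width

/-- The vertical coordinate, scaled to run from `0` to `1` across the rectangle. -/
noncomputable def v (R : Rect) (z : Plane) : ℝ := (z.2 - R.y.1) / R.height

/-- The rectangle has nonempty interior. -/
def Nondeg (R : Rect) : Prop := R.x.1 < R.x.2 ∧ R.y.1 < R.y.2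

/-- Two rectangles are separated by a horizontal or vertical line. -/
def Sep (R R' : Rect) : Prop :=
  R.x.2 ≤ R'.x.1 ∨ R'.x.2 ≤ R.x.1 ∨ R.y.2 ≤ R'.y.1 ∨ R'.y.2 ≤ R.y.1

variable {R : Rect}

theorem Nondeg.width_pos (h : R.Nondeg) : 0 < R.width := sub_pos.2 h.1

theorem Nondeg.height_pos (h : R.Nondeg) : 0 < R.height := sub_pos.2 h.2

theorem Nondeg.mem_toSet_iff (h : R.Nondeg) (z : Plane) :
    z ∈ R.toSet ↔ (0 ≤ R.u z ∧ R.u z ≤ 1) ∧ (0 ≤ R.v z ∧ R.v z ≤ 1) := by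
  rw [toSet, mem_prod, mem_Icc, mem_Icc, u, v, div_le_one h.width_pos, div_le_one h.height_pos,
    le_div_iff₀ h.width_pos, le_div_iff₀ h.height_pos, zero_mul, zero_mul]
  simp only [width, height, sub_nonneg, sub_le_sub_iff_right]

theorem Nondeg.fst_eq (h : R.Nondeg) (z : Plane) : z.1 = R.x.1 + R.u z * R.width := by
  rw [u, div_mul_cancel₀ _ h.width_pos.ne']; ring

theorem Nondeg.snd_eq (h : R.Nondeg) (z : Plane) : z.2 = R.y.1 + R.v z * R.height := by
  rw [v, div_mul_cancel₀ _ h.height_pos.ne']; ring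

theorem polyFun_coord (R : Rect) (a b c : ℝ) :
    PolyFun (polyP 1) fun z => a + b * R.u z + c * R.v z := by
  have := polyFun_affine (a - b * R.x.1 / R.width - c * R.y.1 / R.height) (b / R.width)
    (c / R.height)
  convert this using 2 with z
  simp only [u, v]
  ring

theorem polyFun_coord_quadratic (R : Rect) (a b c a' b' c' : ℝ) :
    PolyFun (polyQ 2) fun z => (a + b * R.u z + c * R.u z ^ 2) *
      (a' + b' * R.v z + c' * R.v z ^ 2) := by
  have := polyFun_quadratic_mul
    (a - b * R.x.1 / R.width + c * R.x.1 ^ 2 / R.width ^ 2)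
    (b / R.width - 2 * c * R.x.1 / R.width ^ 2) (c / R.width ^ 2)
    (a' - b' * R.y.1 / R.height + c' * R.y.1 ^ 2 / R.height ^ 2)
    (b' / R.height - 2 * c' * R.y.1 / R.height ^ 2) (c' / R.height ^ 2)
  convert this using 2 with z
  simp only [u, v]
  ring

/-- The two halves of a rectangle, in scaled coordinates. -/
def halfSet (R : Rect) (b upper : Bool) : Set Plane :=
  match b, upper with
  | true, false => {z | z ∈ R.toSet ∧ R.v z ≤ R.u z}
  | true, true => {z | z ∈ R.toSet ∧ R.u z ≤ R.v z}
  | false, false => {z | z ∈ R.toSet ∧ R.u z + R.v z ≤ 1}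
  | false, true => {z | z ∈ R.toSet ∧ 1 ≤ R.u z + R.v z}

end Rect

theorem mem_convexHull_triple {A B C z : Plane} {a b c : ℝ} (ha : 0 ≤ a) (hb : 0 ≤ b) (hc : 0 ≤ c)
    (h : a + b + c = 1) (hz : z = a • A + b • B + c • C) : z ∈ convexHull ℝ {A, B, C} := by
  have := (convex_convexHull ℝ ({A, B, C} : Set Plane)).sum_mem (t := Finset.univ)
    (w := ![a, b, c]) (z := ![A, B, C]) (fun i _ => by fin_cases i <;> simpa)
    (by simp [Fin.sum_univ_three, h])
    (fun i _ => subset_convexHull ℝ _ (by fin_cases i <;> simp))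
  rw [hz]
  simpa [Fin.sum_univ_three] using this

theorem Rect.triangles_eq {R : Rect} (h : R.Nondeg) (b : Bool) :
    R.triangles b = {R.halfSet b false, R.halfSet b true} := by
  have hw := h.width_pos
  have hh := h.height_pos
  have conv : ∀ α β γ : ℝ, Convex ℝ {z | z ∈ R.toSet ∧ 0 ≤ α + β * R.u z + γ * R.v z} := by
    intro α β γ z hz w hw a b ha hb hab
    refine ⟨((convex_Icc _ _).prod (convex_Icc _ _)) hz.1 hw.1 ha hb hab, ?_⟩
    have e : α + β * R.u (a • z + b • w) + γ * R.v (a • z + b • w) =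
        a * (α + β * R.u z + γ * R.v z) + b * (α + β * R.u w + γ * R.v w) := by
      have : b = 1 - a := by linarith
      subst this
      simp only [Rect.u, Rect.v, Prod.fst_add, Prod.snd_add, Prod.smul_fst, Prod.smul_snd,
        smul_eq_mul]
      ring
    change 0 ≤ _
    rw [e]
    exact add_nonneg (mul_nonneg ha hz.2) (mul_nonneg hb hw.2)
  have ext : ∀ z : Plane, z = (R.x.1 + R.u z * R.width, R.y.1 + R.v z * R.height) := fun z =>
    Prod.ext (h.fst_eq z) (h.snd_eq z)
  have w2 : R.x.2 = R.x.1 + R.width := by simp [Rect.width]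
  have h2 : R.y.2 = R.y.1 + R.height := by simp [Rect.height]
  have sub : ∀ (α β γ : ℝ) (A B C : Plane), (∀ z ∈ ({A, B, C} : Set Plane),
      z ∈ R.toSet ∧ 0 ≤ α + β * R.u z + γ * R.v z) →
      convexHull ℝ {A, B, C} ⊆ {z | z ∈ R.toSet ∧ 0 ≤ α + β * R.u z + γ * R.v z} :=
    fun α β γ A B C hABC => convexHull_min hABC (conv α β γ)
  have u1 : ∀ y, R.u (R.x.1, y) = 0 := fun y => by simp [Rect.u]
  have u2 : ∀ y, R.u (R.x.2, y) = 1 := fun y => by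
    simp only [Rect.u]; exact div_self hw.ne'
  have v1 : ∀ x, R.v (x, R.y.1) = 0 := fun x => by simp [Rect.v]
  have v2 : ∀ x, R.v (x, R.y.2) = 1 := fun x => by
    simp only [Rect.v]; exact div_self hh.ne'
  cases b
  · simp only [Rect.triangles]
    congr 1
    · refine Subset.antisymm ((sub 1 (-1) (-1) _ _ _ ?_).trans ?_) ?_
      · simp only [mem_insert_iff, mem_singleton_iff, forall_eq_or_imp, forall_eq,
          h.mem_toSet_iff, u1, u2, v1, v2]
        norm_num
      · exact fun z hz => ⟨hz.1, by linarith [hz.2]⟩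
      · rintro z ⟨hz, hz'⟩
        obtain ⟨⟨a1, a2⟩, b1, b2⟩ := (h.mem_toSet_iff z).1 hz
        refine mem_convexHull_triple (a := 1 - R.u z - R.v z) (b := R.u z) (c := R.v z)
          (by linarith) a1 b1 (by ring) ?_
        conv_lhs => rw [ext z]
        rw [w2, h2]
        ext <;> simp <;> ring
    · congr 1
      refine Subset.antisymm ((sub (-1) 1 1 _ _ _ ?_).trans ?_) ?_
      · simp only [mem_insert_iff, mem_singleton_iff, forall_eq_or_imp, forall_eq,
          h.mem_toSet_iff, u1, u2, v1, v2]
        norm_num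
      · exact fun z hz => ⟨hz.1, by linarith [hz.2]⟩
      · rintro z ⟨hz, hz'⟩
        obtain ⟨⟨a1, a2⟩, b1, b2⟩ := (h.mem_toSet_iff z).1 hz
        refine mem_convexHull_triple (a := 1 - R.v z) (b := 1 - R.u z) (c := R.u z + R.v z - 1)
          (by linarith) (by linarith) (by linarith) (by ring) ?_
        conv_lhs => rw [ext z]
        rw [w2, h2]
        ext <;> simp <;> ring
  · simp only [Rect.triangles]
    congr 1
    · refine Subset.antisymm ((sub 0 1 (-1) _ _ _ ?_).trans ?_) ?_
      · simp only [mem_insert_iff, mem_singleton_iff, forall_eq_or_imp, forall_eq,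
          h.mem_toSet_iff, u1, u2, v1, v2]
        norm_num
      · exact fun z hz => ⟨hz.1, by linarith [hz.2]⟩
      · rintro z ⟨hz, hz'⟩
        obtain ⟨⟨a1, a2⟩, b1, b2⟩ := (h.mem_toSet_iff z).1 hz
        refine mem_convexHull_triple (a := 1 - R.u z) (b := R.u z - R.v z) (c := R.v z)
          (by linarith) (by linarith) b1 (by ring) ?_
        conv_lhs => rw [ext z]
        rw [w2, h2]
        ext <;> simp <;> ring
    · congr 1
      refine Subset.antisymm ((sub 0 (-1) 1 _ _ _ ?_).trans ?_) ?_
      · simp only [mem_insert_iff, mem_singleton_iff, forall_eq_or_imp, forall_eq,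
          h.mem_toSet_iff, u1, u2, v1, v2]
        norm_num
      · exact fun z hz => ⟨hz.1, by linarith [hz.2]⟩
      · rintro z ⟨hz, hz'⟩
        obtain ⟨⟨a1, a2⟩, b1, b2⟩ := (h.mem_toSet_iff z).1 hz
        refine mem_convexHull_triple (a := 1 - R.v z) (b := R.v z - R.u z) (c := R.u z)
          (by linarith) (by linarith) a1 (by ring) ?_
        conv_lhs => rw [ext z]
        rw [w2, h2]
        ext <;> simp <;> ring

/-! ### The meshes over a rectangular partition -/

/-- The cells of a mesh over the rectangular partition `P`: the rectangles themselves, or the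
triangles obtained with the given choice of diagonals. -/
def meshCells (P : Set Rect) : Option (Rect → Bool) → Set (Set Plane)
  | none => rectCells P
  | some d => triCells P d

/-- The polynomials used for the velocities: `ℚ₂` on rectangles, `ℙ₂` on triangles. -/
noncomputable def velPoly : Option (Rect → Bool) → Submodule ℝ (MvPolynomial (Fin 2) ℝ)
  | none => polyQ 2
  | some _ => polyP 2

/-- The polynomials used for the pressures: `ℚ₁` on rectangles, `ℙ₁` on triangles. -/
noncomputable def prePoly : Option (Rect → Bool) → Submodule ℝ (MvPolynomial (Fin 2) ℝ)
  | none => polyQ 1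
  | some _ => polyP 1

/-- A finite family of nondegenerate rectangles with disjoint interiors. -/
structure IsRectPartition (P : Set Rect) : Prop where
  finite : P.Finite
  nondeg : ∀ R ∈ P, R.Nondeg
  sep : ∀ R ∈ P, ∀ R' ∈ P, R ≠ R' → R.Sep R'

theorem Rect.halfSet_subset (R : Rect) (b c : Bool) : R.halfSet b c ⊆ R.toSet := by
  cases b <;> cases c <;> exact fun z hz => hz.1

theorem Rect.exists_mem_halfSet {R : Rect} (b : Bool) {z : Plane} (hz : z ∈ R.toSet) :
    ∃ c, z ∈ R.halfSet b c := by
  cases b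
  · rcases le_total (R.u z + R.v z) 1 with h | h
    · exact ⟨false, hz, h⟩
    · exact ⟨true, hz, h⟩
  · rcases le_total (R.v z) (R.u z) with h | h
    · exact ⟨false, hz, h⟩
    · exact ⟨true, hz, h⟩

namespace IsRectPartition

theorem mem_triCells {P : Set Rect} (hP : IsRectPartition P) {d : Rect → Bool} {K : Set Plane} :
    K ∈ triCells P d ↔ ∃ R ∈ P, ∃ c, K = R.halfSet (d R) c := by
  simp only [triCells, mem_iUnion, exists_prop]
  refine exists_congr fun R => and_congr_right fun hR => ?_
  rw [Rect.triangles_eq (hP.nondeg R hR)]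
  simp [Bool.exists_bool]

theorem region_meshCells {P : Set Rect} (hP : IsRectPartition P)
    (D : Option (Rect → Bool)) :
    region (meshCells P D) = ⋃ R ∈ P, R.toSet := by
  cases D with
  | none => simp [region, meshCells, rectCells]
  | some d =>
    refine Subset.antisymm ?_ ?_
    · rintro z ⟨K, hK, hz⟩
      obtain ⟨R, hR, c, rfl⟩ := hP.mem_triCells.1 hK
      exact mem_biUnion hR (R.halfSet_subset _ _ hz)
    · refine iUnion₂_subset fun R hR z hz => ?_
      obtain ⟨c, hc⟩ := Rect.exists_mem_halfSet (d R) hz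
      exact ⟨_, hP.mem_triCells.2 ⟨R, hR, c, rfl⟩, hc⟩

theorem isCompact_region {P : Set Rect} (hP : IsRectPartition P) (D : Option (Rect → Bool)) :
    IsCompact (region (meshCells P D)) := by
  rw [hP.region_meshCells]
  exact hP.finite.isCompact_biUnion fun R _ => isCompact_Icc.prod isCompact_Icc

theorem isBounded_domain {P : Set Rect} (hP : IsRectPartition P)
    (D : Option (Rect → Bool)) :
    Bornology.IsBounded (domain (meshCells P D)) :=
  (hP.isCompact_region D).isBounded.subset interior_subset

end IsRectPartition

/-- `φ` is given by a velocity polynomial on every cell of the rectangle `R`. -/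
def IsLocalPoly (D : Option (Rect → Bool)) (R : Rect) (φ : Plane → ℝ) : Prop :=
  match D with
  | none => ∃ f, PolyFun (polyQ 2) f ∧ ∀ z ∈ R.toSet, φ z = f z
  | some d => ∀ c, ∃ f, PolyFun (polyP 2) f ∧ ∀ z ∈ R.halfSet (d R) c, φ z = f z

theorem isLocalPoly_of_eq_zero (D : Option (Rect → Bool)) {R : Rect} {φ : Plane → ℝ}
    (h : ∀ z ∈ R.toSet, φ z = 0) : IsLocalPoly D R φ := by
  cases D with
  | none => exact ⟨_, polyFun_zero _, h⟩
  | some d => exact fun c => ⟨_, polyFun_zero _, fun z hz => h z (R.halfSet_subset _ _ hz)⟩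

theorem IsRectPartition.isBump {P : Set Rect} (hP : IsRectPartition P) {D : Option (Rect → Bool)}
    {φ : Plane → ℝ} {C : ℝ≥0} (hl : LipschitzWith C φ) (h0 : ∀ z, 0 ≤ φ z) {U : Set Plane}
    (hU : IsOpen U) (hUP : U ⊆ ⋃ R ∈ P, R.toSet) (hs : ∀ z, φ z ≠ 0 → z ∈ U)
    (hp : ∀ R ∈ P, IsLocalPoly D R φ) : IsBump (meshCells P D) (velPoly D) φ := by
  refine ⟨⟨hl.continuous.continuousOn, fun K hK => ?_⟩, ⟨C, hl⟩, h0, fun z hz => ?_⟩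
  · cases D with
    | none =>
      obtain ⟨R, hR, rfl⟩ := hK
      obtain ⟨f, ⟨p, hp, hf⟩, hφ⟩ := hp R hR
      exact ⟨p, hp, fun z hz => by rw [hφ z hz, hf]⟩
    | some d =>
      obtain ⟨R, hR, c, rfl⟩ := hP.mem_triCells.1 hK
      obtain ⟨f, ⟨p, hp, hf⟩, hφ⟩ := hp R hR c
      exact ⟨p, hp, fun z hz => by rw [hφ z hz, hf]⟩
  · refine interior_maximal ?_ hU (hs z hz)
    rwa [hP.region_meshCells]

theorem pressure_quad {P : Set Rect} {q : Plane → ℝ}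
    (hq : q ∈ feSpace (meshCells P none) (prePoly none)) {R : Rect} (hR : R ∈ P) :
    ∃ a b c d : ℝ, ∀ z ∈ R.toSet, q z = a + b * z.1 + c * z.2 + d * (z.1 * z.2) := by
  obtain ⟨p, hp, h⟩ := hq.2 R.toSet (mem_image_of_mem _ hR)
  obtain ⟨a, b, c, d, he⟩ := eval_polyQ_one hp
  exact ⟨a, b, c, d, fun z hz => by rw [h z hz, he]⟩

theorem pressure_tri {P : Set Rect} (hP : IsRectPartition P) {q : Plane → ℝ} {d : Rect → Bool}
    (hq : q ∈ feSpace (meshCells P (some d)) (prePoly (some d))) {R : Rect} (hR : R ∈ P)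
    (s : Bool) : ∃ a b c : ℝ, ∀ z ∈ R.halfSet (d R) s, q z = a + b * z.1 + c * z.2 := by
  obtain ⟨p, hp, h⟩ := hq.2 _ (hP.mem_triCells.2 ⟨R, hR, s, rfl⟩)
  obtain ⟨a, b, c, he⟩ := eval_polyP_one hp
  exact ⟨a, b, c, fun z hz => by rw [h z hz, he]⟩

/-! ### Point reflection of a cell -/

namespace Rect

/-- The point reflection in the centre of the rectangle. -/
def refl (R : Rect) (z : Plane) : Plane := (R.x.1 + R.x.2 - z.1, R.y.1 + R.y.2 - z.2)

variable {R : Rect}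

theorem Nondeg.u_refl (h : R.Nondeg) (z : Plane) : R.u (R.refl z) = 1 - R.u z := by
  have := h.width_pos.ne'
  rw [u, u, refl, eq_sub_iff_add_eq, ← add_div, div_eq_one_iff_eq this, width]
  ring

theorem Nondeg.v_refl (h : R.Nondeg) (z : Plane) : R.v (R.refl z) = 1 - R.v z := by
  have := h.height_pos.ne'
  rw [v, v, refl, eq_sub_iff_add_eq, ← add_div, div_eq_one_iff_eq this, height]
  ring

theorem Nondeg.refl_mem (h : R.Nondeg) {z : Plane} (hz : z ∈ R.toSet) : R.refl z ∈ R.toSet := by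
  rw [h.mem_toSet_iff] at *
  rw [h.u_refl, h.v_refl]
  obtain ⟨⟨h1, h2⟩, h3, h4⟩ := hz
  exact ⟨⟨by linarith, by linarith⟩, by linarith, by linarith⟩

theorem Nondeg.refl_mem_halfSet (h : R.Nondeg) {b c : Bool} {z : Plane} (hz : z ∈ R.halfSet b c) :
    R.refl z ∈ R.halfSet b !c := by
  cases b <;> cases c <;> refine ⟨h.refl_mem hz.1, ?_⟩ <;> rw [h.u_refl, h.v_refl] <;>
    linarith [hz.2]

end Rect

/-- On every rectangle, the odd part of a discrete pressure with respect to the point reflection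
is affine, for `ℚ₁` as well as for `ℙ₁` on both halves. -/
theorem exists_affine_odd_part {P : Set Rect} (hP : IsRectPartition P) {D : Option (Rect → Bool)}
    {q : Plane → ℝ} (hq : q ∈ feSpace (meshCells P D) (prePoly D)) {R : Rect} (hR : R ∈ P) :
    ∃ l m n : ℝ, ∀ z ∈ R.toSet, q z - q (R.refl z) = l * z.1 + m * z.2 + n := by
  have hn := hP.nondeg R hR
  cases D with
  | none =>
    obtain ⟨a, b, c, d, h⟩ := pressure_quad hq hR
    refine ⟨2 * b + d * (R.y.1 + R.y.2), 2 * c + d * (R.x.1 + R.x.2),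
      -(b * (R.x.1 + R.x.2) + c * (R.y.1 + R.y.2) + d * ((R.x.1 + R.x.2) * (R.y.1 + R.y.2))),
      fun z hz => ?_⟩
    rw [h z hz, h _ (hn.refl_mem hz)]
    simp only [Rect.refl]
    ring
  | some d =>
    obtain ⟨a, b, c, h⟩ := pressure_tri hP hq hR false
    obtain ⟨a', b', c', h'⟩ := pressure_tri hP hq hR true
    -- the centre belongs to both halves
    obtain ⟨e, he, he'⟩ : ∃ e : Plane, e = ((R.x.1 + R.x.2) / 2, (R.y.1 + R.y.2) / 2) ∧
        e ∈ R.toSet := by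
      refine ⟨_, rfl, ?_⟩
      have := hn.1; have := hn.2
      constructor <;> constructor <;> simp <;> linarith
    have hu : R.u e = 1 / 2 ∧ R.v e = 1 / 2 := by
      have h1 := hn.width_pos.ne'
      have h2 := hn.height_pos.ne'
      rw [he]
      simp only [Rect.u, Rect.v]
      rw [div_eq_iff h1, div_eq_iff h2, Rect.width, Rect.height]
      constructor <;> ring
    have hb : ∀ s, e ∈ R.halfSet (d R) s := fun s => by
      cases d R <;> cases s <;> refine ⟨he', ?_⟩ <;> rw [hu.1, hu.2] <;> norm_num
    have e1 := h e (hb false)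
    rw [h' e (hb true), he] at e1
    simp only at e1
    refine ⟨b + b', c + c', a - a' - b' * (R.x.1 + R.x.2) - c' * (R.y.1 + R.y.2),
      fun z hz => ?_⟩
    obtain ⟨s, hs⟩ := Rect.exists_mem_halfSet (d R) hz
    have hs' := hn.refl_mem_halfSet hs
    cases s
    · rw [h z hs, h' _ hs']
      simp only [Rect.refl]
      ring
    · rw [h' z hs, h _ hs']
      simp only [Rect.refl]
      linarith

/-! ### Products of clamped affine functions -/

/-- The nearest number in `[0, 1]`. -/
def clamp (t : ℝ) : ℝ := max 0 (min t 1)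

theorem clamp_nonneg (t : ℝ) : 0 ≤ clamp t := le_max_left _ _

theorem clamp_le_one (t : ℝ) : clamp t ≤ 1 := max_le zero_le_one (min_le_right _ _)

theorem clamp_of_nonpos {t : ℝ} (h : t ≤ 0) : clamp t = 0 :=
  max_eq_left ((min_le_left _ _).trans h)

theorem clamp_of_mem {t : ℝ} (h0 : 0 ≤ t) (h1 : t ≤ 1) : clamp t = t := by
  rw [clamp, min_eq_left h1, max_eq_right h0]

theorem clamp_one : clamp 1 = 1 := clamp_of_mem zero_le_one le_rfl

theorem pos_of_clamp_ne_zero {t : ℝ} (h : clamp t ≠ 0) : 0 < t :=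
  not_le.1 fun h' => h (clamp_of_nonpos h')

theorem le_clamp {a t : ℝ} (h : a ≤ t) (h1 : a ≤ 1) : a ≤ clamp t :=
  (le_min h h1).trans (le_max_right _ _)

theorem abs_clamp_sub_le (s t : ℝ) : |clamp s - clamp t| ≤ |s - t| := by
  refine (abs_max_sub_max_le_max _ _ _ _).trans (max_le (by simp) ?_)
  exact (abs_min_sub_min_le_max _ _ _ _).trans (max_le le_rfl (by simp))

theorem LipXY.clamp {A B : ℝ} {f : Plane → ℝ} (h : LipXY A B f) :
    LipXY A B fun z => clamp (f z) := fun z w => (abs_clamp_sub_le _ _).trans (h z w)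

theorem LipXY.min {A B : ℝ} {f g : Plane → ℝ} (hf : LipXY A B f) (hg : LipXY A B g) :
    LipXY A B fun z => min (f z) (g z) := fun z w =>
  (abs_min_sub_min_le_max _ _ _ _).trans (max_le (hf z w) (hg z w))

theorem LipXY.mono {A B A' B' : ℝ} {f : Plane → ℝ} (h : LipXY A B f) (hA : A ≤ A')
    (hB : B ≤ B') : LipXY A' B' f := fun z w =>
  (h z w).trans (add_le_add (mul_le_mul_of_nonneg_right hA (abs_nonneg _))
    (mul_le_mul_of_nonneg_right hB (abs_nonneg _)))

theorem LipXY.add {A B A' B' : ℝ} {f g : Plane → ℝ} (hf : LipXY A B f) (hg : LipXY A' B' g) :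
    LipXY (A + A') (B + B') fun z => f z + g z := fun z w => by
  have h1 := abs_add_le (f z - f w) (g z - g w)
  have h2 := hf z w
  have h3 := hg z w
  rw [show f z + g z - (f w + g w) = f z - f w + (g z - g w) by ring]
  linarith

theorem LipXY.neg {A B : ℝ} {f : Plane → ℝ} (hf : LipXY A B f) :
    LipXY A B fun z => -f z := fun z w => by
  rw [show -f z - -f w = -(f z - f w) by ring, abs_neg]
  exact hf z w

theorem lipXY_const (c : ℝ) : LipXY 0 0 fun _ => c := fun z w => by simp

theorem LipXY.mul {A B A' B' : ℝ} {f g : Plane → ℝ} (hf : LipXY A B f) (hg : LipXY A' B' g)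
    (hf1 : ∀ z, |f z| ≤ 1) (hg1 : ∀ z, |g z| ≤ 1) :
    LipXY (A + A') (B + B') fun z => f z * g z := fun z w => by
  rw [show f z * g z - f w * g w = (f z - f w) * g z + f w * (g z - g w) by ring]
  have h1 := abs_add_le ((f z - f w) * g z) (f w * (g z - g w))
  rw [abs_mul, abs_mul] at h1
  have h2 := mul_le_mul_of_nonneg_left (hg1 z) (abs_nonneg (f z - f w))
  have h3 := mul_le_mul_of_nonneg_right (hf1 w) (abs_nonneg (g z - g w))
  have h4 := hf z w
  have h5 := hg z w
  linarith

theorem abs_clamp_le_one (t : ℝ) : |clamp t| ≤ 1 := by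
  rw [abs_of_nonneg (clamp_nonneg t)]; exact clamp_le_one t

theorem LipXY.clamp_mul {A B A' B' : ℝ} {f g : Plane → ℝ} (hf : LipXY A B f)
    (hg : LipXY A' B' g) :
    LipXY (A + A') (B + B') fun z => TaylorHood.clamp (f z) * TaylorHood.clamp (g z) :=
  hf.clamp.mul hg.clamp (fun _ => abs_clamp_le_one _) fun _ => abs_clamp_le_one _

theorem Rect.Nondeg.lipXY_coord {R : Rect} (h : R.Nondeg) (a b c : ℝ) :
    LipXY (|b| / R.width) (|c| / R.height) fun z => a + b * R.u z + c * R.v z := fun z w => by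
  have e : a + b * R.u z + c * R.v z - (a + b * R.u w + c * R.v w) =
      b / R.width * (z.1 - w.1) + c / R.height * (z.2 - w.2) := by
    simp only [u, v]; ring
  rw [e]
  refine (abs_add_le _ _).trans (le_of_eq ?_)
  rw [abs_mul, abs_mul, abs_div, abs_div, abs_of_pos h.width_pos, abs_of_pos h.height_pos]

theorem le_integral_of_le_on_box {φ : Plane → ℝ} (hc : Continuous φ) (hs : HasCompactSupport φ)
    (h0 : ∀ z, 0 ≤ φ z) {a b c d m : ℝ} (hab : a ≤ b) (hcd : c ≤ d)
    (h : ∀ z ∈ Icc a b ×ˢ Icc c d, m ≤ φ z) : m * ((b - a) * (d - c)) ≤ ∫ z, φ z := by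
  have hm : volume.real (Icc a b ×ˢ Icc c d : Set Plane) = (b - a) * (d - c) := by
    rw [Measure.volume_eq_prod, measureReal_prod_prod, Real.volume_real_Icc_of_le hab,
      Real.volume_real_Icc_of_le hcd]
  have hi := hc.integrable_of_hasCompactSupport hs (μ := volume)
  have h1 := setIntegral_ge_of_const_le_real (μ := (volume : Measure Plane))
    (measurableSet_Icc.prod measurableSet_Icc)
    ((isCompact_Icc.prod isCompact_Icc).measure_lt_top.ne) h hi.integrableOn
  rw [hm] at h1
  exact h1.trans (setIntegral_le_integral hi (Eventually.of_forall h0))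

/-! ### Cell bubbles -/

/-- The bubble of a rectangle: the tensor product of quadratic bubbles, or, on a cut rectangle,
the product of the barycentric coordinates of the end points of the diagonal. -/
noncomputable def bubble (D : Option (Rect → Bool)) (R : Rect) (z : Plane) : ℝ :=
  match D with
  | none => (clamp (R.u z) * clamp (1 - R.u z)) * (clamp (R.v z) * clamp (1 - R.v z))
  | some d =>
    if d R then clamp (min (R.u z) (R.v z)) * clamp (min (1 - R.u z) (1 - R.v z))
    else clamp (min (1 - R.u z) (R.v z)) * clamp (min (R.u z) (1 - R.v z))

theorem bubble_nonneg (D : Option (Rect → Bool)) (R : Rect) (z : Plane) : 0 ≤ bubble D R z := by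
  have h := clamp_nonneg
  cases D with
  | none => exact mul_nonneg (mul_nonneg (h _) (h _)) (mul_nonneg (h _) (h _))
  | some d =>
    simp only [bubble]
    split_ifs <;> exact mul_nonneg (h _) (h _)

theorem lipXY_bubble (D : Option (Rect → Bool)) {R : Rect} (hR : R.Nondeg) :
    LipXY (2 / R.width) (2 / R.height) (bubble D R) := by
  have hw := hR.width_pos
  have hh := hR.height_pos
  have l1 : LipXY (1 / R.width) 0 R.u := by simpa using hR.lipXY_coord 0 1 0
  have l2 : LipXY (1 / R.width) 0 fun z => 1 - R.u z := by
    simpa [sub_eq_add_neg] using hR.lipXY_coord 1 (-1) 0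
  have l3 : LipXY 0 (1 / R.height) R.v := by simpa using hR.lipXY_coord 0 0 1
  have l4 : LipXY 0 (1 / R.height) fun z => 1 - R.v z := by
    simpa [sub_eq_add_neg] using hR.lipXY_coord 1 0 (-1)
  have e1 : 1 / R.width + 1 / R.width = 2 / R.width := by ring
  have e2 : 1 / R.height + 1 / R.height = 2 / R.height := by ring
  have hw0 : 0 ≤ 1 / R.width := by positivity
  have hh0 : 0 ≤ 1 / R.height := by positivity
  cases D with
  | none =>
    have hb : ∀ s t : ℝ, |clamp s * clamp t| ≤ 1 := fun s t => by
      rw [abs_mul]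
      exact mul_le_one₀ (abs_clamp_le_one _) (abs_nonneg _) (abs_clamp_le_one _)
    refine ((l1.clamp_mul l2).mul (l3.clamp_mul l4) (fun _ => hb _ _) fun _ => hb _ _).mono ?_ ?_
    · rw [e1]; simp
    · rw [e2]; simp
  | some d =>
    have m1 := l1.mono (le_refl _) hh0
    have m2 := l2.mono (le_refl _) hh0
    have m3 := l3.mono hw0 (le_refl _)
    have m4 := l4.mono hw0 (le_refl _)
    rw [← e1, ← e2]
    by_cases hd : d R
    · intro z w
      simp only [bubble, if_pos hd]
      exact (m1.min m3).clamp_mul (m2.min m4) z w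
    · intro z w
      simp only [bubble, if_neg hd]
      exact (m2.min m3).clamp_mul (m1.min m4) z w

theorem bubble_support {D : Option (Rect → Bool)} {R : Rect} {z : Plane} (h : bubble D R z ≠ 0) :
    (0 < R.u z ∧ R.u z < 1) ∧ (0 < R.v z ∧ R.v z < 1) := by
  cases D with
  | none =>
    simp only [bubble, mul_ne_zero_iff] at h
    obtain ⟨⟨h1, h2⟩, h3, h4⟩ := h
    have := pos_of_clamp_ne_zero h2
    have := pos_of_clamp_ne_zero h4
    exact ⟨⟨pos_of_clamp_ne_zero h1, by linarith⟩, pos_of_clamp_ne_zero h3, by linarith⟩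
  | some d =>
    simp only [bubble] at h
    split_ifs at h
    all_goals
      rw [mul_ne_zero_iff] at h
      have h1 := lt_min_iff.1 (pos_of_clamp_ne_zero h.1)
      have h2 := lt_min_iff.1 (pos_of_clamp_ne_zero h.2)
      refine ⟨⟨?_, ?_⟩, ?_, ?_⟩ <;> linarith [h1.1, h1.2, h2.1, h2.2]

theorem bubble_refl (D : Option (Rect → Bool)) {R : Rect} (hR : R.Nondeg) (z : Plane) :
    bubble D R (R.refl z) = bubble D R z := by
  cases D with
  | none =>
    simp only [bubble, hR.u_refl, hR.v_refl, sub_sub_cancel]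
    ring
  | some d =>
    simp only [bubble, hR.u_refl, hR.v_refl, sub_sub_cancel]
    split_ifs
    · exact mul_comm _ _
    · rw [min_comm (R.u z), min_comm (1 - R.u z), mul_comm, min_comm, mul_comm,
        min_comm (1 - R.v z), mul_comm]

theorem isLocalPoly_bubble (D : Option (Rect → Bool)) {R : Rect} (hR : R.Nondeg) :
    IsLocalPoly D R (bubble D R) := by
  have key : ∀ z ∈ R.toSet, (0 ≤ R.u z ∧ R.u z ≤ 1) ∧ (0 ≤ R.v z ∧ R.v z ≤ 1) :=
    fun z hz => (hR.mem_toSet_iff z).1 hz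
  cases D with
  | none =>
    refine ⟨_, R.polyFun_coord_quadratic 0 1 (-1) 0 1 (-1), fun z hz => ?_⟩
    obtain ⟨⟨h1, h2⟩, h3, h4⟩ := key z hz
    simp only [bubble]
    rw [clamp_of_mem h1 h2, clamp_of_mem h3 h4, clamp_of_mem (by linarith) (by linarith),
      clamp_of_mem (by linarith) (by linarith)]
    ring
  | some d =>
    intro c
    by_cases hd : d R
    · cases c
      · refine ⟨_, (R.polyFun_coord 0 0 1).mul (R.polyFun_coord 1 (-1) 0), fun z hz => ?_⟩
        rw [hd] at hz
        obtain ⟨⟨h1, h2⟩, h3, h4⟩ := key z hz.1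
        have h5 : R.v z ≤ R.u z := hz.2
        simp only [bubble, hd, if_true]
        rw [min_eq_right h5, min_eq_left (by linarith), clamp_of_mem h3 h4,
          clamp_of_mem (by linarith) (by linarith)]
        ring
      · refine ⟨_, (R.polyFun_coord 0 1 0).mul (R.polyFun_coord 1 0 (-1)), fun z hz => ?_⟩
        rw [hd] at hz
        obtain ⟨⟨h1, h2⟩, h3, h4⟩ := key z hz.1
        have h5 : R.u z ≤ R.v z := hz.2
        simp only [bubble, hd, if_true]
        rw [min_eq_left h5, min_eq_right (by linarith), clamp_of_mem h1 h2,
          clamp_of_mem (by linarith) (by linarith)]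
        ring
    · rw [Bool.not_eq_true] at hd
      cases c
      · refine ⟨_, (R.polyFun_coord 0 0 1).mul (R.polyFun_coord 0 1 0), fun z hz => ?_⟩
        rw [hd] at hz
        obtain ⟨⟨h1, h2⟩, h3, h4⟩ := key z hz.1
        have h5 : R.u z + R.v z ≤ 1 := hz.2
        simp only [bubble, hd]
        rw [if_neg (by simp), min_eq_right (by linarith), min_eq_left (by linarith),
          clamp_of_mem h3 h4, clamp_of_mem (by linarith) (by linarith)]
        ring
      · refine ⟨_, (R.polyFun_coord 1 (-1) 0).mul (R.polyFun_coord 1 0 (-1)), fun z hz => ?_⟩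
        rw [hd] at hz
        obtain ⟨⟨h1, h2⟩, h3, h4⟩ := key z hz.1
        have h5 : 1 ≤ R.u z + R.v z := hz.2
        simp only [bubble, hd]
        rw [if_neg (by simp), min_eq_left (by linarith), min_eq_right (by linarith),
          clamp_of_mem (by linarith) (by linarith), clamp_of_mem (by linarith) (by linarith)]
        ring

theorem le_bubble (D : Option (Rect → Bool)) {R : Rect} {z : Plane}
    (hu : 1 / 4 ≤ R.u z ∧ R.u z ≤ 3 / 4) (hv : 1 / 4 ≤ R.v z ∧ R.v z ≤ 3 / 4) :
    1 / 256 ≤ bubble D R z := by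
  have hc : ∀ t : ℝ, 1 / 4 ≤ t → 1 / 4 ≤ clamp t := fun t ht => le_clamp ht (by norm_num)
  have hm : ∀ s t : ℝ, 1 / 4 ≤ s → 1 / 4 ≤ t → 1 / 16 ≤ clamp s * clamp t := fun s t hs ht => by
    have := mul_le_mul (hc s hs) (hc t ht) (by norm_num) (clamp_nonneg _)
    linarith
  cases D with
  | none =>
    have h1 := hm (R.u z) (1 - R.u z) hu.1 (by linarith [hu.2])
    have h2 := hm (R.v z) (1 - R.v z) hv.1 (by linarith [hv.2])
    have := mul_le_mul h1 h2 (by norm_num) (by linarith)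
    simp only [bubble]
    linarith
  | some d =>
    simp only [bubble]
    split_ifs
    all_goals
      refine le_trans (by norm_num) (hm _ _ (le_min ?_ ?_) (le_min ?_ ?_)) <;>
        linarith [hu.1, hu.2, hv.1, hv.2]

namespace Rect

theorem Nondeg.mem_Ioo_iff {R : Rect} (h : R.Nondeg) (z : Plane) :
    z ∈ Ioo R.x.1 R.x.2 ×ˢ Ioo R.y.1 R.y.2 ↔
      (0 < R.u z ∧ R.u z < 1) ∧ (0 < R.v z ∧ R.v z < 1) := by
  rw [mem_prod, mem_Ioo, mem_Ioo, u, v, div_lt_one h.width_pos, div_lt_one h.height_pos,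
    lt_div_iff₀ h.width_pos, lt_div_iff₀ h.height_pos, zero_mul, zero_mul]
  simp only [width, height, sub_pos, sub_lt_sub_iff_right]

end Rect

theorem hasCompactSupport_of_ne_zero_mem {φ : Plane → ℝ} {a b c d : ℝ}
    (h : ∀ z, φ z ≠ 0 → z ∈ Icc a b ×ˢ Icc c d) : HasCompactSupport φ :=
  HasCompactSupport.of_support_subset_isCompact (isCompact_Icc.prod isCompact_Icc) h

theorem Rect.Nondeg.mem_toSet_of_bubble_ne_zero {D : Option (Rect → Bool)} {R : Rect}
    (hR : R.Nondeg) {z : Plane} (h : bubble D R z ≠ 0) : z ∈ R.toSet := by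
  obtain ⟨⟨h1, h2⟩, h3, h4⟩ := bubble_support h
  exact (hR.mem_toSet_iff z).2 ⟨⟨h1.le, h2.le⟩, h3.le, h4.le⟩

theorem le_integral_bubble (D : Option (Rect → Bool)) {R : Rect} (hR : R.Nondeg) :
    R.width * R.height / 1024 ≤ ∫ z, bubble D R z := by
  have hw := hR.width_pos
  have hh := hR.height_pos
  have hl := (lipXY_bubble D hR).lipschitzWith (by positivity) (by positivity)
  have := le_integral_of_le_on_box (m := 1 / 256) (a := R.x.1 + R.width / 4)
    (b := R.x.1 + 3 * R.width / 4) (c := R.y.1 + R.height / 4) (d := R.y.1 + 3 * R.height / 4)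
    hl.continuous (hasCompactSupport_of_ne_zero_mem fun z hz => hR.mem_toSet_of_bubble_ne_zero hz)
    (bubble_nonneg D R) (by linarith) (by linarith) fun z hz => by
      obtain ⟨⟨h1, h2⟩, h3, h4⟩ := hz
      refine le_bubble D ?_ ?_
      · rw [Rect.u, le_div_iff₀ hw, div_le_iff₀ hw]
        constructor <;> linarith
      · rw [Rect.v, le_div_iff₀ hh, div_le_iff₀ hh]
        constructor <;> linarith
  refine le_trans (le_of_eq ?_) this
  ring

theorem IsRectPartition.isBump_bubble {P : Set Rect} (hP : IsRectPartition P)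
    (D : Option (Rect → Bool)) {R : Rect} (hR : R ∈ P) :
    IsBump (meshCells P D) (velPoly D) (bubble D R) := by
  have hn := hP.nondeg R hR
  have hw := hn.width_pos
  have hh := hn.height_pos
  refine hP.isBump ((lipXY_bubble D hn).lipschitzWith (by positivity) (by positivity))
    (bubble_nonneg D R) (U := Ioo R.x.1 R.x.2 ×ˢ Ioo R.y.1 R.y.2) (isOpen_Ioo.prod isOpen_Ioo)
    ((Set.prod_mono Ioo_subset_Icc_self Ioo_subset_Icc_self).trans
      (subset_biUnion_of_mem (u := Rect.toSet) hR))
    (fun z hz => (hn.mem_Ioo_iff z).2 (bubble_support hz)) fun R' hR' => ?_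
  by_cases he : R = R'
  · subst he
    exact isLocalPoly_bubble D hn
  · refine isLocalPoly_of_eq_zero D fun z hz => ?_
    by_contra hne
    obtain ⟨⟨h1, h2⟩, h3, h4⟩ := (hn.mem_Ioo_iff z).2 (bubble_support hne)
    obtain ⟨⟨g1, g2⟩, g3, g4⟩ := hz
    rcases hP.sep R hR R' hR' he with h | h | h | h <;> linarith

/-! ### Bounds for pressure differences -/

/-- Conversion of a bound obtained with one test function on a `w × h` cell into the scaling of
`L²`: the factor `√G ≤ K √(w / h + h / w)` is the seminorm of the test function. -/
theorem scaled_bound {w h δ s G c K : ℝ} (hw : 0 < w) (hh : 0 < h) (hc : 0 < c) (hs : 0 ≤ s)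
    (hK : 0 ≤ K) (h1 : |δ| * w * c ≤ s * √G)
    (h2 : G ≤ K ^ 2 * (1 / w ^ 2 + 1 / h ^ 2) * (w * h)) :
    |δ| * √(w * h) ≤ K / c * s * (1 + h / w) := by
  have hwh : 0 < w * h := mul_pos hw hh
  have h3 : √G * √(w * h) ≤ K * (h + w) := by
    rw [← Real.sqrt_mul' _ hwh.le]
    refine Real.sqrt_le_iff.2 ⟨by positivity, ?_⟩
    calc G * (w * h) ≤ K ^ 2 * (1 / w ^ 2 + 1 / h ^ 2) * (w * h) * (w * h) :=
          mul_le_mul_of_nonneg_right h2 hwh.le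
      _ = K ^ 2 * (h ^ 2 + w ^ 2) := by field_simp
      _ ≤ (K * (h + w)) ^ 2 := by
          rw [mul_pow]
          exact mul_le_mul_of_nonneg_left (by nlinarith) (sq_nonneg K)
  have h4 : |δ| * √(w * h) * (w * c) ≤ s * (K * (h + w)) := by
    calc |δ| * √(w * h) * (w * c) = |δ| * w * c * √(w * h) := by ring
      _ ≤ s * √G * √(w * h) := mul_le_mul_of_nonneg_right h1 (Real.sqrt_nonneg _)
      _ = s * (√G * √(w * h)) := by ring
      _ ≤ _ := mul_le_mul_of_nonneg_left h3 hs
  rw [← le_div_iff₀ (by positivity)] at h4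
  refine h4.trans (le_of_eq ?_)
  field_simp
  ring

/-- Testing with a function that is even under the point reflection of `R` sees only the odd part
of the pressure. -/
theorem integral_lineDeriv_mul_of_even {φ q : Plane → ℝ} {C : ℝ≥0} (hφ : LipschitzWith C φ)
    (hc : HasCompactSupport φ) (h0 : ∀ z, 0 ≤ φ z) {R : Rect} (hs : ∀ z, φ z ≠ 0 → z ∈ R.toSet)
    (he : ∀ z, φ (R.refl z) = φ z) {l m n : ℝ}
    (hq : ∀ z ∈ R.toSet, q z - q (R.refl z) = l * z.1 + m * z.2 + n) (i : Fin 2)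
    (hint : Integrable fun z => lineDeriv ℝ φ z (unitVec i) * q z) :
    ∫ z, lineDeriv ℝ φ z (unitVec i) * q z = -(![l, m] i / 2 * ∫ z, φ z) := by
  have hr : R.refl = fun z => (R.x.1 + R.x.2, R.y.1 + R.y.2) - z := rfl
  have hd : ∀ z, lineDeriv ℝ φ (R.refl z) (unitVec i) = -lineDeriv ℝ φ z (unitVec i) := fun z => by
    rw [← lineDeriv_neg, lineDeriv, lineDeriv]
    congr 1 with t
    rw [← he (z + t • -unitVec i)]
    congr 1
    rw [hr]
    simp only [smul_neg]
    abel
  have hint' : Integrable fun z => lineDeriv ℝ φ z (unitVec i) * q (R.refl z) := by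
    have := (hint.comp_sub_left (R.x.1 + R.x.2, R.y.1 + R.y.2)).neg
    refine this.congr (Eventually.of_forall fun z => ?_)
    change -(lineDeriv ℝ φ (R.refl z) (unitVec i) * q (R.refl z)) = _
    rw [hd]; ring
  have e1 : ∫ z, lineDeriv ℝ φ z (unitVec i) * q (R.refl z) =
      -∫ z, lineDeriv ℝ φ z (unitVec i) * q z := by
    rw [← integral_sub_left_eq_self _ volume (R.x.1 + R.x.2, R.y.1 + R.y.2), ← integral_neg]
    congr 1 with z
    have hrr : R.refl (R.refl z) = z := by simp [Rect.refl]
    change lineDeriv ℝ φ (R.refl z) (unitVec i) * q (R.refl (R.refl z)) = _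
    rw [hd, hrr]; ring
  have haff : LipschitzWith (|l| + |m|).toNNReal fun z : Plane => l * z.1 + m * z.2 + n := by
    refine LipXY.lipschitzWith (fun z w => ?_) (abs_nonneg _) (abs_nonneg _)
    rw [← abs_mul, ← abs_mul]
    refine le_trans (le_of_eq ?_) (abs_add_le _ _)
    congr 1; ring
  have hda : ∀ z : Plane, lineDeriv ℝ (fun z : Plane => l * z.1 + m * z.2 + n) z (-unitVec i) =
      -![l, m] i := fun z => by
    refine HasLineDerivAt.lineDeriv ?_
    rw [HasLineDerivAt]
    have h1 := ((hasDerivAt_id (0 : ℝ)).const_mul (-![l, m] i)).add_const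
      (l * z.1 + m * z.2 + n)
    rw [mul_one] at h1
    refine h1.congr_of_eventuallyEq (Eventually.of_forall fun t => ?_)
    fin_cases i <;> simp [unitVec] <;> ring
  have key := haff.integral_lineDeriv_mul_eq (μ := volume) hφ hc (-unitVec i)
  simp only [hda, neg_neg] at key
  rw [integral_const_mul] at key
  have e2 : ∫ z, lineDeriv ℝ φ z (unitVec i) * (l * z.1 + m * z.2 + n) =
      ∫ z, (lineDeriv ℝ φ z (unitVec i) * q z -
        lineDeriv ℝ φ z (unitVec i) * q (R.refl z)) := by
    congr 1 with z
    by_cases hz : φ z = 0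
    · rw [lineDeriv_eq_zero_of_nonneg h0 hz]; simp
    · rw [← hq z (hs z hz)]; ring
  rw [integral_sub hint hint', e1] at e2
  linarith

/-- Testing with the bubble of a cell bounds the mean difference of the pressure between opposite
sides of the cell. -/
theorem bubble_bound {P : Set Rect} (hP : IsRectPartition P) {D : Option (Rect → Bool)}
    {q : Plane → ℝ} (hq : q ∈ feSpace (meshCells P D) (prePoly D))
    (hq2 : MemLp q 2 (volume.restrict (domain (meshCells P D)))) {s : ℝ} (hs : 0 ≤ s)
    (H : WeakBound (meshCells P D) (velPoly D) q s) {R : Rect} (hR : R ∈ P) :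
    |q (R.x.2, R.y.2) + q (R.x.1, R.y.2) - q (R.x.1, R.y.1) - q (R.x.2, R.y.1)| *
        √(R.width * R.height) ≤ 4096 * s * (1 + R.height / R.width) ∧
      |q (R.x.2, R.y.2) + q (R.x.2, R.y.1) - q (R.x.1, R.y.1) - q (R.x.1, R.y.2)| *
        √(R.width * R.height) ≤ 4096 * s * (1 + R.width / R.height) := by
  have hn := hP.nondeg R hR
  have hw := hn.width_pos
  have hh := hn.height_pos
  obtain ⟨l, m, n, ho⟩ := exists_affine_odd_part hP hq hR
  have hlip := lipXY_bubble D hn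
  have hsup : ∀ z, bubble D R z ≠ 0 → z ∈ R.toSet := fun z => hn.mem_toSet_of_bubble_ne_zero
  have hb := hP.isBump_bubble D hR
  have hG := gradSq_le hlip (by positivity) (by positivity) (bubble_nonneg D R) hn.1.le hn.2.le hsup
  have hG' : gradSq (bubble D R) ≤
      2 ^ 2 * (1 / R.width ^ 2 + 1 / R.height ^ 2) * (R.width * R.height) := by
    refine hG.trans (le_of_eq ?_)
    change _ * (R.width * R.height) = _
    ring
  have hI := le_integral_bubble D hn
  have hfull : ∀ i, |![l, m] i| / 2 * (R.width * R.height / 1024) ≤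
      s * √(gradSq (bubble D R)) := fun i => by
    have h1 := H _ hb i
    rw [integral_lineDeriv_mul_of_even (hlip.lipschitzWith (by positivity) (by positivity))
      (hasCompactSupport_of_ne_zero_mem hsup) (bubble_nonneg D R) hsup (bubble_refl D hn) ho i
      (hb.integrable_mul (hP.isBounded_domain D) hq2 i), abs_neg, abs_mul, abs_div, abs_two,
      abs_of_nonneg (integral_nonneg (bubble_nonneg D R))] at h1
    exact (mul_le_mul_of_nonneg_left hI (by positivity)).trans h1
  -- the slopes of the odd part in terms of the corner values
  have hx := hn.1.le
  have hy := hn.2.le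
  have o1 := ho (R.x.2, R.y.2) ⟨⟨hx, le_rfl⟩, hy, le_rfl⟩
  have o2 := ho (R.x.1, R.y.2) ⟨⟨le_rfl, hx⟩, hy, le_rfl⟩
  have o3 := ho (R.x.2, R.y.1) ⟨⟨hx, le_rfl⟩, le_rfl, hy⟩
  simp only [Rect.refl, add_sub_cancel_right, add_sub_cancel_left] at o1 o2 o3
  have d1 : q (R.x.2, R.y.2) + q (R.x.1, R.y.2) - q (R.x.1, R.y.1) - q (R.x.2, R.y.1) =
      m * R.height := by
    have : m * R.height = m * R.y.2 - m * R.y.1 := by rw [Rect.height]; ring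
    linarith
  have d2 : q (R.x.2, R.y.2) + q (R.x.2, R.y.1) - q (R.x.1, R.y.1) - q (R.x.1, R.y.2) =
      l * R.width := by
    have : l * R.width = l * R.x.2 - l * R.x.1 := by rw [Rect.width]; ring
    linarith
  rw [d1, d2]
  constructor
  · refine (scaled_bound (c := 1 / 2048) (K := 2) hw hh (by norm_num) hs (by norm_num)
      ?_ hG').trans (le_of_eq (by ring))
    have := hfull 1
    rw [abs_mul, abs_of_pos hh]
    refine le_trans (le_of_eq ?_) this
    simp only [Matrix.cons_val_one, Matrix.cons_val_zero]
    ring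
  · rw [mul_comm R.width R.height]
    refine (scaled_bound (c := 1 / 2048) (K := 2) hh hw (by norm_num) hs (by norm_num)
      ?_ (hG'.trans (le_of_eq (by ring)))).trans (le_of_eq (by ring))
    have := hfull 0
    rw [abs_mul, abs_of_pos hw]
    refine le_trans (le_of_eq ?_) this
    simp only [Matrix.cons_val_zero]
    ring

/-! ### Edge functions -/

/-- Half of an edge function, on a unit cell whose edge is `s = 1`. All variants have the trace
`v (1 - v)` on the edge and vanish on the other sides: `none` is the one on an uncut cell,
`some b` the one on the triangle at the edge, where `b` tells whether the diagonal of the cell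
starts in the corner `(0, 0)`. -/
noncomputable def edgeShape (o : Option Bool) (s v : ℝ) : ℝ :=
  match o with
  | none => clamp s * (clamp v * clamp (1 - v))
  | some true => clamp v * clamp (s - v)
  | some false => clamp (1 - v) * clamp (s + v - 1)

theorem edgeShape_one (o : Option Bool) (v : ℝ) :
    edgeShape o 1 v = clamp v * clamp (1 - v) := by
  rcases o with _ | _ | _
  · simp [edgeShape, clamp_one]
  · simp [edgeShape, mul_comm]
  · simp [edgeShape]

theorem edgeShape_nonneg (o : Option Bool) (s v : ℝ) : 0 ≤ edgeShape o s v := by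
  have h := clamp_nonneg
  rcases o with _ | _ | _
  · exact mul_nonneg (h _) (mul_nonneg (h _) (h _))
  · exact mul_nonneg (h _) (h _)
  · exact mul_nonneg (h _) (h _)

theorem edgeShape_support {o : Option Bool} {s v : ℝ} (hs : s ≤ 1) (h : edgeShape o s v ≠ 0) :
    0 < s ∧ 0 < v ∧ v < 1 := by
  rcases o with _ | _ | _ <;> simp only [edgeShape, mul_ne_zero_iff] at h
  · have h1 := pos_of_clamp_ne_zero h.2.2
    exact ⟨pos_of_clamp_ne_zero h.1, pos_of_clamp_ne_zero h.2.1, by linarith⟩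
  · have h1 := pos_of_clamp_ne_zero h.1
    have h2 := pos_of_clamp_ne_zero h.2
    exact ⟨by linarith, by linarith, by linarith⟩
  · have h1 := pos_of_clamp_ne_zero h.1
    have h2 := pos_of_clamp_ne_zero h.2
    exact ⟨by linarith, by linarith, by linarith⟩

theorem lipXY_edgeShape (o : Option Bool) {R : Rect} (hR : R.Nondeg) {f : Plane → ℝ}
    (hf : LipXY (1 / R.width) 0 f) :
    LipXY (1 / R.width) (2 / R.height) fun z => edgeShape o (f z) (R.v z) := by
  have l3 : LipXY 0 (1 / R.height) R.v := by simpa using hR.lipXY_coord 0 0 1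
  have l4 : LipXY 0 (1 / R.height) fun z => 1 - R.v z := by
    simpa [sub_eq_add_neg] using hR.lipXY_coord 1 0 (-1)
  have e2 : 2 / R.height = 1 / R.height + 1 / R.height := by ring
  rw [e2]
  rcases o with _ | _ | _
  · have hb : ∀ s t : ℝ, |clamp s * clamp t| ≤ 1 := fun s t => by
      rw [abs_mul]
      exact mul_le_one₀ (abs_clamp_le_one _) (abs_nonneg _) (abs_clamp_le_one _)
    have := hf.clamp.mul (l3.clamp_mul l4) (fun _ => abs_clamp_le_one _) fun _ => hb _ _
    simpa [edgeShape] using this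
  · have := l4.clamp_mul ((hf.add l3).add (lipXY_const (-1)))
    simpa [edgeShape, sub_eq_add_neg] using this
  · have := l3.clamp_mul (hf.add l3.neg)
    simpa [edgeShape, sub_eq_add_neg] using this

/-- `R'` is the right neighbour of `R`, and of the same size. -/
structure IsRightNeighbour (R R' : Rect) : Prop where
  fst : R'.x.1 = R.x.2
  y : R'.y = R.y
  width : R'.width = R.width

namespace IsRightNeighbour

variable {R R' : Rect}

theorem height (h : IsRightNeighbour R R') : R'.height = R.height := by
  rw [Rect.height, Rect.height, h.y]

theorem nondeg (h : IsRightNeighbour R R') (hR : R.Nondeg) : R'.Nondeg :=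
  ⟨by have := hR.width_pos; rw [← h.width] at this; exact sub_pos.1 this, by rw [h.y]; exact hR.2⟩

theorem u (h : IsRightNeighbour R R') (hR : R.Nondeg) (z : Plane) : R'.u z = R.u z - 1 := by
  have := hR.width_pos.ne'
  rw [Rect.u, Rect.u, h.width, h.fst, eq_sub_iff_add_eq, div_add_one this]
  congr 1
  rw [Rect.width]
  ring

theorem v (h : IsRightNeighbour R R') (z : Plane) : R'.v z = R.v z := by
  rw [Rect.v, Rect.v, h.height, h.y]

end IsRightNeighbour

/-- The velocity function of the common edge of `R` and its right neighbour `R'`. Both halves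
are continued constantly beyond the edge, and the trace is subtracted once. -/
noncomputable def edgeFun (D : Option (Rect → Bool)) (R R' : Rect) (z : Plane) : ℝ :=
  edgeShape (D.map fun d => d R) (min (R.u z) 1) (R.v z) +
    edgeShape (D.map fun d => !d R') (min (2 - R.u z) 1) (R.v z) -
      clamp (R.v z) * clamp (1 - R.v z)

section EdgeFun

variable {D : Option (Rect → Bool)} {R R' : Rect}

theorem edgeFun_left {z : Plane} (h : R.u z ≤ 1) :
    edgeFun D R R' z = edgeShape (D.map fun d => d R) (R.u z) (R.v z) := by
  rw [edgeFun, min_eq_left h, min_eq_right (by linarith), edgeShape_one]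
  ring

theorem edgeFun_right {z : Plane} (h : 1 ≤ R.u z) :
    edgeFun D R R' z = edgeShape (D.map fun d => !d R') (2 - R.u z) (R.v z) := by
  rw [edgeFun, min_eq_right h, min_eq_left (by linarith), edgeShape_one]
  ring

theorem edgeFun_nonneg (z : Plane) : 0 ≤ edgeFun D R R' z := by
  rcases le_total (R.u z) 1 with h | h
  · rw [edgeFun_left h]; exact edgeShape_nonneg _ _ _
  · rw [edgeFun_right h]; exact edgeShape_nonneg _ _ _

theorem edgeFun_support {z : Plane} (hz : edgeFun D R R' z ≠ 0) :
    (0 < R.u z ∧ R.u z < 2) ∧ (0 < R.v z ∧ R.v z < 1) := by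
  rcases le_total (R.u z) 1 with h | h
  · rw [edgeFun_left h] at hz
    have := edgeShape_support h hz
    exact ⟨⟨this.1, by linarith⟩, this.2⟩
  · rw [edgeFun_right h] at hz
    have := edgeShape_support (by linarith) hz
    exact ⟨⟨by linarith, by linarith [this.1]⟩, this.2⟩

theorem lipXY_edgeFun (hR : R.Nondeg) :
    LipXY (6 / R.width) (6 / R.height) (edgeFun D R R') := by
  have hw := hR.width_pos
  have hh := hR.height_pos
  have l1 : LipXY (1 / R.width) 0 R.u := by simpa using hR.lipXY_coord 0 1 0
  have l2 : LipXY (1 / R.width) 0 fun z => 2 - R.u z := by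
    simpa [sub_eq_add_neg] using hR.lipXY_coord 2 (-1) 0
  have l3 : LipXY 0 (1 / R.height) R.v := by simpa using hR.lipXY_coord 0 0 1
  have l4 : LipXY 0 (1 / R.height) fun z => 1 - R.v z := by
    simpa [sub_eq_add_neg] using hR.lipXY_coord 1 0 (-1)
  have lc := (lipXY_const 1).mono (A' := 1 / R.width) (by positivity) le_rfl
  have := ((lipXY_edgeShape (D.map fun d => d R) hR (l1.min lc)).add
    (lipXY_edgeShape (D.map fun d => !d R') hR (l2.min lc))).add (l3.clamp_mul l4).neg
  refine LipXY.mono (A := 1 / R.width + 1 / R.width + (0 + 0))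
    (B := 2 / R.height + 2 / R.height + (1 / R.height + 1 / R.height)) ?_ ?_ ?_
  · intro z w
    simpa only [edgeFun, sub_eq_add_neg] using this z w
  · rw [show 1 / R.width + 1 / R.width + (0 + 0) = 2 / R.width by ring]
    gcongr
    norm_num
  · exact le_of_eq (by ring)

theorem mem_box_iff (hR : R.Nondeg) (hn : IsRightNeighbour R R') (z : Plane) :
    z ∈ Ioo R.x.1 R'.x.2 ×ˢ Ioo R.y.1 R.y.2 ↔
      (0 < R.u z ∧ R.u z < 2) ∧ (0 < R.v z ∧ R.v z < 1) := by
  have hw := hn.width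
  rw [mem_prod, mem_Ioo, mem_Ioo, Rect.u, Rect.v, div_lt_iff₀ hR.width_pos,
    div_lt_one hR.height_pos, lt_div_iff₀ hR.width_pos, lt_div_iff₀ hR.height_pos, zero_mul,
    zero_mul]
  rw [Rect.width, hn.fst] at hw
  simp only [Rect.width, Rect.height, sub_pos, sub_lt_sub_iff_right] at *
  refine and_congr_left fun _ => and_congr_right fun _ => ⟨fun h => ?_, fun h => ?_⟩ <;> linarith

theorem isLocalPoly_edgeFun_left (hR : R.Nondeg) : IsLocalPoly D R (edgeFun D R R') := by
  have key : ∀ z ∈ R.toSet, (0 ≤ R.u z ∧ R.u z ≤ 1) ∧ (0 ≤ R.v z ∧ R.v z ≤ 1) :=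
    fun z hz => (hR.mem_toSet_iff z).1 hz
  cases D with
  | none =>
    refine ⟨_, R.polyFun_coord_quadratic 0 1 0 0 1 (-1), fun z hz => ?_⟩
    obtain ⟨⟨h1, h2⟩, h3, h4⟩ := key z hz
    rw [edgeFun_left h2]
    simp only [edgeShape, Option.map_none]
    rw [clamp_of_mem h1 h2, clamp_of_mem h3 h4, clamp_of_mem (by linarith) (by linarith)]
    ring
  | some d =>
    intro c
    cases hd : d R <;> cases c
    · refine ⟨_, polyFun_zero _, fun z hz => ?_⟩
      obtain ⟨⟨h1, h2⟩, h3, h4⟩ := key z hz.1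
      have h5 : R.u z + R.v z ≤ 1 := hz.2
      rw [edgeFun_left h2]
      simp only [edgeShape, Option.map_some, hd]
      rw [clamp_of_nonpos (t := R.u z + R.v z - 1) (by linarith), mul_zero]
    · refine ⟨_, (R.polyFun_coord 1 0 (-1)).mul (R.polyFun_coord (-1) 1 1), fun z hz => ?_⟩
      obtain ⟨⟨h1, h2⟩, h3, h4⟩ := key z hz.1
      have h5 : 1 ≤ R.u z + R.v z := hz.2
      rw [edgeFun_left h2]
      simp only [edgeShape, Option.map_some, hd]
      rw [clamp_of_mem (by linarith) (by linarith), clamp_of_mem (by linarith) (by linarith)]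
      ring
    · refine ⟨_, (R.polyFun_coord 0 0 1).mul (R.polyFun_coord 0 1 (-1)), fun z hz => ?_⟩
      obtain ⟨⟨h1, h2⟩, h3, h4⟩ := key z hz.1
      have h5 : R.v z ≤ R.u z := hz.2
      rw [edgeFun_left h2]
      simp only [edgeShape, Option.map_some, hd]
      rw [clamp_of_mem (by linarith) (by linarith), clamp_of_mem (by linarith) (by linarith)]
      ring
    · refine ⟨_, polyFun_zero _, fun z hz => ?_⟩
      obtain ⟨⟨h1, h2⟩, h3, h4⟩ := key z hz.1
      have h5 : R.u z ≤ R.v z := hz.2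
      rw [edgeFun_left h2]
      simp only [edgeShape, Option.map_some, hd]
      rw [clamp_of_nonpos (t := R.u z - R.v z) (by linarith), mul_zero]

theorem isLocalPoly_edgeFun_right (hR : R.Nondeg) (hn : IsRightNeighbour R R') :
    IsLocalPoly D R' (edgeFun D R R') := by
  have key : ∀ z ∈ R'.toSet, (0 ≤ R'.u z ∧ R'.u z ≤ 1) ∧ (0 ≤ R'.v z ∧ R'.v z ≤ 1) :=
    fun z hz => ((hn.nondeg hR).mem_toSet_iff z).1 hz
  have val : ∀ z ∈ R'.toSet, edgeFun D R R' z =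
      edgeShape (D.map fun d => !d R') (1 - R'.u z) (R'.v z) := fun z hz => by
    have h1 := (key z hz).1.1
    rw [hn.u hR] at h1 ⊢
    rw [edgeFun_right (by linarith), hn.v]
    congr 1; ring
  cases D with
  | none =>
    refine ⟨_, R'.polyFun_coord_quadratic 1 (-1) 0 0 1 (-1), fun z hz => ?_⟩
    obtain ⟨⟨h1, h2⟩, h3, h4⟩ := key z hz
    rw [val z hz]
    simp only [edgeShape, Option.map_none]
    rw [clamp_of_mem (by linarith) (by linarith), clamp_of_mem h3 h4,
      clamp_of_mem (by linarith) (by linarith)]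
    ring
  | some d =>
    intro c
    cases hd : d R' <;> cases c
    · refine ⟨_, (R'.polyFun_coord 0 0 1).mul (R'.polyFun_coord 1 (-1) (-1)), fun z hz => ?_⟩
      obtain ⟨⟨h1, h2⟩, h3, h4⟩ := key z hz.1
      have h5 : R'.u z + R'.v z ≤ 1 := hz.2
      rw [val z hz.1]
      simp only [edgeShape, Option.map_some, hd, Bool.not_false]
      rw [clamp_of_mem (by linarith) (by linarith), clamp_of_mem (by linarith) (by linarith)]
      ring
    · refine ⟨_, polyFun_zero _, fun z hz => ?_⟩
      obtain ⟨⟨h1, h2⟩, h3, h4⟩ := key z hz.1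
      have h5 : 1 ≤ R'.u z + R'.v z := hz.2
      rw [val z hz.1]
      simp only [edgeShape, Option.map_some, hd, Bool.not_false]
      rw [clamp_of_nonpos (t := 1 - R'.u z - R'.v z) (by linarith), mul_zero]
    · refine ⟨_, polyFun_zero _, fun z hz => ?_⟩
      obtain ⟨⟨h1, h2⟩, h3, h4⟩ := key z hz.1
      have h5 : R'.v z ≤ R'.u z := hz.2
      rw [val z hz.1]
      simp only [edgeShape, Option.map_some, hd, Bool.not_true]
      rw [clamp_of_nonpos (t := 1 - R'.u z + R'.v z - 1) (by linarith), mul_zero]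
    · refine ⟨_, (R'.polyFun_coord 1 0 (-1)).mul (R'.polyFun_coord 0 (-1) 1), fun z hz => ?_⟩
      obtain ⟨⟨h1, h2⟩, h3, h4⟩ := key z hz.1
      have h5 : R'.u z ≤ R'.v z := hz.2
      rw [val z hz.1]
      simp only [edgeShape, Option.map_some, hd, Bool.not_true]
      rw [clamp_of_mem (by linarith) (by linarith), clamp_of_mem (by linarith) (by linarith)]
      ring

theorem le_edgeFun {z : Plane} (hu : 7 / 8 ≤ R.u z ∧ R.u z ≤ 1)
    (hv : 3 / 8 ≤ R.v z ∧ R.v z ≤ 5 / 8) : 1 / 16 ≤ edgeFun D R R' z := by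
  rw [edgeFun_left hu.2]
  have hc : ∀ t : ℝ, 1 / 4 ≤ t → 1 / 4 ≤ clamp t := fun t ht => le_clamp ht (by norm_num)
  have hm : ∀ s t : ℝ, 3 / 8 ≤ s → 1 / 4 ≤ t → 3 / 32 ≤ clamp s * clamp t := fun s t hs ht => by
    have := mul_le_mul (le_clamp hs (by norm_num)) (hc t ht) (by norm_num) (clamp_nonneg _)
    linarith
  rcases D with _ | d
  · have h1 := hm (R.v z) (1 - R.v z) hv.1 (by linarith)
    have := mul_le_mul (le_clamp hu.1 (by norm_num)) h1 (by norm_num) (clamp_nonneg _)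
    simp only [edgeShape, Option.map_none]
    linarith
  · cases hd : d R <;> simp only [edgeShape, Option.map_some, hd]
    · exact le_trans (by norm_num) (hm _ _ (by linarith) (by linarith))
    · exact le_trans (by norm_num) (hm _ _ (by linarith) (by linarith))

theorem edgeFun_mem_box (hR : R.Nondeg) (hn : IsRightNeighbour R R') {z : Plane}
    (hz : edgeFun D R R' z ≠ 0) : z ∈ Icc R.x.1 R'.x.2 ×ˢ Icc R.y.1 R.y.2 :=
  Set.prod_mono Ioo_subset_Icc_self Ioo_subset_Icc_self
    ((mem_box_iff hR hn z).2 (edgeFun_support hz))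

theorem le_integral_edgeFun (hR : R.Nondeg) (hn : IsRightNeighbour R R') :
    R.width * R.height / 512 ≤ ∫ z, edgeFun D R R' z := by
  have hw := hR.width_pos
  have hh := hR.height_pos
  have hl := (lipXY_edgeFun (D := D) (R' := R') hR).lipschitzWith (by positivity) (by positivity)
  have := le_integral_of_le_on_box (m := 1 / 16) (a := R.x.1 + 7 * R.width / 8)
    (b := R.x.1 + R.width) (c := R.y.1 + 3 * R.height / 8) (d := R.y.1 + 5 * R.height / 8)
    hl.continuous (hasCompactSupport_of_ne_zero_mem fun z hz => edgeFun_mem_box hR hn hz)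
    edgeFun_nonneg (by linarith) (by linarith) fun z hz => by
      obtain ⟨⟨h1, h2⟩, h3, h4⟩ := hz
      refine le_edgeFun ?_ ?_
      · rw [Rect.u, le_div_iff₀ hw, div_le_iff₀ hw]
        constructor <;> linarith
      · rw [Rect.v, le_div_iff₀ hh, div_le_iff₀ hh]
        constructor <;> linarith
  refine le_trans (le_of_eq ?_) this
  ring

theorem IsRectPartition.isBump_edgeFun {P : Set Rect} (hP : IsRectPartition P)
    (D : Option (Rect → Bool)) (hR : R ∈ P) (hR' : R' ∈ P) (hn : IsRightNeighbour R R') :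
    IsBump (meshCells P D) (velPoly D) (edgeFun D R R') := by
  have hd := hP.nondeg R hR
  have hd' := hP.nondeg R' hR'
  have hw := hd.width_pos
  have hh := hd.height_pos
  refine hP.isBump ((lipXY_edgeFun hd).lipschitzWith (by positivity) (by positivity))
    edgeFun_nonneg (U := Ioo R.x.1 R'.x.2 ×ˢ Ioo R.y.1 R.y.2) (isOpen_Ioo.prod isOpen_Ioo)
    (fun z hz => ?_) (fun z hz => (mem_box_iff hd hn z).2 (edgeFun_support hz)) fun S hS => ?_
  · obtain ⟨⟨h1, h2⟩, h3, h4⟩ := hz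
    rcases le_total z.1 R.x.2 with h | h
    · exact mem_biUnion hR ⟨⟨h1.le, h⟩, h3.le, h4.le⟩
    · refine mem_biUnion hR' ⟨⟨?_, h2.le⟩, ?_⟩
      · rw [hn.fst]; exact h
      · rw [hn.y]; exact ⟨h3.le, h4.le⟩
  · by_cases he : R = S
    · subst he
      exact isLocalPoly_edgeFun_left hd
    · by_cases he' : R' = S
      · subst he'
        exact isLocalPoly_edgeFun_right hd hn
      · refine isLocalPoly_of_eq_zero D fun z hz => ?_
        by_contra hne
        obtain ⟨⟨h1, h2⟩, h3, h4⟩ := (mem_box_iff hd hn z).2 (edgeFun_support hne)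
        obtain ⟨⟨g1, g2⟩, g3, g4⟩ := hz
        have hSd := (hP.nondeg S hS).1
        have e1 := hn.fst
        have e2 := hn.y
        rcases hP.sep R hR S hS he with h | h | h | h <;>
          rcases hP.sep R' hR' S hS he' with h' | h' | h' | h' <;>
            first | linarith | (rw [e2] at h'; linarith)

theorem gradSq_edgeFun_le (hR : R.Nondeg) (hn : IsRightNeighbour R R') :
    gradSq (edgeFun D R R') ≤
      9 ^ 2 * (1 / R.width ^ 2 + 1 / R.height ^ 2) * (R.width * R.height) := by
  have hw := hR.width_pos
  have hh := hR.height_pos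
  have e : R'.x.2 - R.x.1 = 2 * R.width := by
    have := hn.width
    rw [Rect.width, hn.fst] at this
    rw [Rect.width] at *
    linarith
  have := gradSq_le (lipXY_edgeFun (D := D) (R' := R') hR) (by positivity) (by positivity)
    edgeFun_nonneg (by linarith) hR.2.le fun z hz => edgeFun_mem_box hR hn hz
  rw [e] at this
  refine this.trans ?_
  change _ * (2 * R.width * R.height) ≤ _
  rw [show ((6 / R.width) ^ 2 + (6 / R.height) ^ 2) * (2 * R.width * R.height) =
    72 * ((1 / R.width ^ 2 + 1 / R.height ^ 2) * (R.width * R.height)) by ring, mul_assoc]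
  refine mul_le_mul_of_nonneg_right (by norm_num) (by positivity)

end EdgeFun

/-! ### The bound for the difference along an edge -/

section EdgeBound

variable {R R' : Rect}

/-- On triangles, the pressure is affine in `y` on the two triangles at the edge, with the same
slope. -/
theorem edge_slices_tri {P : Set Rect} (hP : IsRectPartition P) {d : Rect → Bool} {q : Plane → ℝ}
    (hq : q ∈ feSpace (meshCells P (some d)) (prePoly (some d))) (hR : R ∈ P) (hR' : R' ∈ P)
    (hn : IsRightNeighbour R R') : ∃ (c : ℝ) (g : ℝ → ℝ),
      c * R.height = q (R.x.2, R.y.2) - q (R.x.2, R.y.1) ∧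
      ∀ z, edgeFun (some d) R R' z ≠ 0 → q z = z.2 * c + g z.1 := by
  have hd := hP.nondeg R hR
  have hd' := hn.nondeg hd
  have hx := hd.1.le
  have hy := hd.2.le
  have hh := hd.height_pos
  obtain ⟨a, b, c, h⟩ := pressure_tri hP hq hR (!d R)
  obtain ⟨a', b', c', h'⟩ := pressure_tri hP hq hR' (d R')
  have u2 : ∀ y, R.u (R.x.2, y) = 1 := fun y => by
    simp only [Rect.u]; exact div_self hd.width_pos.ne'
  have v1 : ∀ x, R.v (x, R.y.1) = 0 := fun x => by simp [Rect.v]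
  have v2 : ∀ x, R.v (x, R.y.2) = 1 := fun x => by
    simp only [Rect.v]; exact div_self hh.ne'
  have m1 : (R.x.2, R.y.1) ∈ R.toSet := ⟨⟨hx, le_rfl⟩, le_rfl, hy⟩
  have m2 : (R.x.2, R.y.2) ∈ R.toSet := ⟨⟨hx, le_rfl⟩, hy, le_rfl⟩
  have m1' : (R.x.2, R.y.1) ∈ R'.toSet := by
    rw [hd'.mem_toSet_iff, hn.u hd, hn.v, u2, v1]; norm_num
  have m2' : (R.x.2, R.y.2) ∈ R'.toSet := by
    rw [hd'.mem_toSet_iff, hn.u hd, hn.v, u2, v2]; norm_num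
  have s1 : (R.x.2, R.y.1) ∈ R.halfSet (d R) (!d R) := by
    cases d R <;> refine ⟨m1, ?_⟩ <;> rw [u2, v1] <;> norm_num
  have s2 : (R.x.2, R.y.2) ∈ R.halfSet (d R) (!d R) := by
    cases d R <;> refine ⟨m2, ?_⟩ <;> rw [u2, v2]; norm_num
  have s1' : (R.x.2, R.y.1) ∈ R'.halfSet (d R') (d R') := by
    cases d R' <;> refine ⟨m1', ?_⟩ <;> rw [hn.u hd, hn.v, u2, v1] <;> norm_num
  have s2' : (R.x.2, R.y.2) ∈ R'.halfSet (d R') (d R') := by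
    cases d R' <;> refine ⟨m2', ?_⟩ <;> rw [hn.u hd, hn.v, u2, v2] <;> norm_num
  have e : c * R.height = q (R.x.2, R.y.2) - q (R.x.2, R.y.1) := by
    rw [h _ s1, h _ s2, Rect.height]; ring
  have e' : c' * R.height = q (R.x.2, R.y.2) - q (R.x.2, R.y.1) := by
    rw [h' _ s1', h' _ s2', Rect.height]; ring
  have hc : c' = c := mul_right_cancel₀ hh.ne' (e'.trans e.symm)
  refine ⟨c, fun x => if x ≤ R.x.2 then a + b * x else a' + b' * x, e, fun z hz => ?_⟩
  have hbox := edgeFun_support hz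
  by_cases hzx : z.1 ≤ R.x.2
  · have hu : R.u z ≤ 1 := by
      rw [Rect.u, div_le_one hd.width_pos, Rect.width]; linarith
    have hz' : z ∈ R.toSet := (hd.mem_toSet_iff z).2
      ⟨⟨hbox.1.1.le, hu⟩, hbox.2.1.le, hbox.2.2.le⟩
    rw [edgeFun_left hu] at hz
    have : z ∈ R.halfSet (d R) (!d R) := by
      cases hb : d R <;> simp only [edgeShape, Option.map_some, hb, mul_ne_zero_iff] at hz
      · exact ⟨hz', by have := pos_of_clamp_ne_zero hz.2; linarith⟩
      · exact ⟨hz', by have := pos_of_clamp_ne_zero hz.2; linarith⟩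
    rw [h z this]
    beta_reduce
    rw [if_pos hzx]
    ring
  · have hu : 1 ≤ R.u z := by
      rw [Rect.u, le_div_iff₀ hd.width_pos, Rect.width]; linarith
    have hz' : z ∈ R'.toSet := (hd'.mem_toSet_iff z).2 (by
      rw [hn.u hd, hn.v]
      exact ⟨⟨by linarith, by linarith [hbox.1.2]⟩, hbox.2.1.le, hbox.2.2.le⟩)
    rw [edgeFun_right hu] at hz
    have : z ∈ R'.halfSet (d R') (d R') := by
      cases hb : d R' <;>
        simp only [edgeShape, Option.map_some, hb, mul_ne_zero_iff, Bool.not_false,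
          Bool.not_true] at hz
      · exact ⟨hz', by
          have := pos_of_clamp_ne_zero hz.2
          rw [hn.u hd, hn.v]; linarith⟩
      · exact ⟨hz', by
          have := pos_of_clamp_ne_zero hz.2
          rw [hn.u hd, hn.v]; linarith⟩
    rw [h' z this]
    beta_reduce
    rw [if_neg hzx, hc]
    ring

/-- On rectangles, the pressure is affine in `y` on both cells, with a slope that is piecewise
affine in `x`, with the derivatives `k` and `k'`. They are determined by the difference along the
edge and the mean differences on the two cells. -/
theorem edge_slices_quad {P : Set Rect} (hP : IsRectPartition P) {q : Plane → ℝ}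
    (hq : q ∈ feSpace (meshCells P none) (prePoly none)) (hR : R ∈ P) (hR' : R' ∈ P)
    (hn : IsRightNeighbour R R') : ∃ (c k k' : ℝ) (g : ℝ → ℝ),
      c * R.height = q (R.x.2, R.y.2) - q (R.x.2, R.y.1) ∧
      q (R.x.2, R.y.2) + q (R.x.1, R.y.2) - q (R.x.1, R.y.1) - q (R.x.2, R.y.1) =
        R.height * (2 * c - k * R.width) ∧
      q (R'.x.2, R'.y.2) + q (R'.x.1, R'.y.2) - q (R'.x.1, R'.y.1) - q (R'.x.2, R'.y.1) =
        R.height * (2 * c + k' * R.width) ∧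
      ∀ z, edgeFun none R R' z ≠ 0 → q z =
        z.2 * (if z.1 ≤ R.x.2 then c + k * (z.1 - R.x.2) else c + k' * (z.1 - R.x.2)) +
          g z.1 := by
  have hd := hP.nondeg R hR
  have hd' := hn.nondeg hd
  have hx := hd.1.le
  have hy := hd.2.le
  have hx' := hd'.1.le
  have hh := hd.height_pos
  obtain ⟨a, b, c, k, h⟩ := pressure_quad hq hR
  obtain ⟨a', b', c', k', h'⟩ := pressure_quad hq hR'
  have e1 := hn.fst
  have e2 := hn.y
  have e3 : R'.x.2 = R.x.2 + R.width := by
    have := hn.width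
    rw [Rect.width, e1] at this
    linarith
  have n1 := h (R.x.1, R.y.1) ⟨⟨le_rfl, hx⟩, le_rfl, hy⟩
  have n2 := h (R.x.2, R.y.1) ⟨⟨hx, le_rfl⟩, le_rfl, hy⟩
  have n3 := h (R.x.1, R.y.2) ⟨⟨le_rfl, hx⟩, hy, le_rfl⟩
  have n4 := h (R.x.2, R.y.2) ⟨⟨hx, le_rfl⟩, hy, le_rfl⟩
  rw [e1, e3] at hx'
  have mem' : ∀ x y, R.x.2 ≤ x → x ≤ R.x.2 + R.width → R.y.1 ≤ y → y ≤ R.y.2 →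
      (x, y) ∈ R'.toSet := fun x y h1 h2 h3 h4 => by
    refine ⟨⟨?_, ?_⟩, ?_⟩
    · rw [e1]; exact h1
    · rw [e3]; exact h2
    · rw [e2]; exact ⟨h3, h4⟩
  have n1' := h' _ (mem' R.x.2 R.y.1 le_rfl hx' le_rfl hy)
  have n2' := h' _ (mem' (R.x.2 + R.width) R.y.1 hx' le_rfl le_rfl hy)
  have n3' := h' _ (mem' R.x.2 R.y.2 le_rfl hx' hy le_rfl)
  have n4' := h' _ (mem' (R.x.2 + R.width) R.y.2 hx' le_rfl hy le_rfl)
  have hc : c' + k' * R.x.2 = c + k * R.x.2 := by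
    refine mul_right_cancel₀ hh.ne' ?_
    have : (c' + k' * R.x.2) * R.height = q (R.x.2, R.y.2) - q (R.x.2, R.y.1) := by
      rw [n1', n3', Rect.height]; ring
    rw [this, n2, n4, Rect.height]; ring
  refine ⟨c + k * R.x.2, k, k', fun x => if x ≤ R.x.2 then a + b * x else a' + b' * x,
    ?_, ?_, ?_, fun z hz => ?_⟩
  · rw [n2, n4, Rect.height]; ring
  · rw [n1, n2, n3, n4, Rect.height, Rect.width]; ring
  · rw [e1, e2, e3, ← hc, n1', n2', n3', n4', Rect.height]; ring
  · obtain ⟨⟨p1, p2⟩, p3, p4⟩ := edgeFun_mem_box hd hn hz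
    by_cases hzx : z.1 ≤ R.x.2
    · rw [h z ⟨⟨p1, hzx⟩, p3, p4⟩, if_pos hzx]
      beta_reduce
      rw [if_pos hzx]
      ring
    · rw [h' z (mem' z.1 z.2 (not_le.1 hzx).le (by rwa [← e3]) p3 p4), if_neg hzx]
      beta_reduce
      rw [if_neg hzx, ← hc]
      ring

/-- The integral of a piecewise affine function against the hat function. -/
theorem integral_mul_hat {a w c k k' : ℝ} (hw : 0 < w) :
    ∫ x, (if x ≤ a + w then c + k * (x - (a + w)) else c + k' * (x - (a + w))) *
      (clamp (min ((x - a) / w) 1) + clamp (min (2 - (x - a) / w) 1) - 1) =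
        w * (c + (k' - k) * w / 6) := by
  set F : ℝ → ℝ := fun x => (if x ≤ a + w then c + k * (x - (a + w)) else
    c + k' * (x - (a + w))) *
      (clamp (min ((x - a) / w) 1) + clamp (min (2 - (x - a) / w) 1) - 1) with hF
  have F0 : ∀ x, x ∉ Ioc a (a + 2 * w) → F x = 0 := fun x hx => by
    have : clamp (min ((x - a) / w) 1) + clamp (min (2 - (x - a) / w) 1) - 1 = 0 := by
      rcases le_or_gt x a with h | h
      · have h1 : (x - a) / w ≤ 0 := div_nonpos_of_nonpos_of_nonneg (by linarith) hw.le
        rw [min_eq_left (by linarith), min_eq_right (by linarith), clamp_of_nonpos h1, clamp_one]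
        ring
      · have h1 : 2 ≤ (x - a) / w := by
          rw [le_div_iff₀ hw]
          by_contra h2
          exact hx ⟨h, by linarith⟩
        rw [min_eq_right (by linarith), min_eq_left (by linarith), clamp_one,
          clamp_of_nonpos (t := 2 - (x - a) / w) (by linarith)]
        ring
    simp only [hF, this, mul_zero]
  have c1 : ∀ x ∈ uIcc a (a + w), F x = (c + k * (x - (a + w))) * ((x - a) / w) := fun x hx => by
    rw [uIcc_of_le (by linarith)] at hx
    have h1 : (x - a) / w ≤ 1 := by rw [div_le_one hw]; linarith [hx.2]
    have h0 : 0 ≤ (x - a) / w := div_nonneg (by linarith [hx.1]) hw.le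
    simp only [hF]
    rw [if_pos hx.2, min_eq_left h1, min_eq_right (by linarith), clamp_one, clamp_of_mem h0 h1]
    ring
  have c2 : ∀ x ∈ uIcc (a + w) (a + 2 * w), F x =
      (c + k' * (x - (a + w))) * (2 - (x - a) / w) := fun x hx => by
    rw [uIcc_of_le (by linarith)] at hx
    have h1 : 1 ≤ (x - a) / w := by rw [le_div_iff₀ hw]; linarith [hx.1]
    have h2 : (x - a) / w ≤ 2 := by rw [div_le_iff₀ hw]; linarith [hx.2]
    simp only [hF]
    rw [min_eq_right h1, min_eq_left (by linarith), clamp_one,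
      clamp_of_mem (by linarith) (by linarith)]
    rcases hx.1.eq_or_lt with h | h
    · rw [if_pos h.symm.le, ← h]; ring
    · rw [if_neg (not_le.2 h)]; ring
  have i1 : ∫ x in a..(a + w), F x = w * (c / 2 - k * w / 6) := by
    rw [intervalIntegral.integral_congr c1]
    have hder : ∀ x ∈ uIcc a (a + w), HasDerivAt
        (fun x => (c * (x - a) ^ 2 / 2 + k * ((x - a) ^ 3 / 3 - w * (x - a) ^ 2 / 2)) / w)
        ((c + k * (x - (a + w))) * ((x - a) / w)) x := fun x _ => by
      have h1 := (hasDerivAt_id x).sub_const a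
      have h2 := h1.pow 2
      have h3 := h1.pow 3
      have := (((h2.const_mul c).div_const 2).add
        (((h3.div_const 3).sub ((h2.const_mul w).div_const 2)).const_mul k)).div_const w
      refine this.congr_deriv ?_
      simp only [id_eq]
      field_simp
      push_cast
      ring
    rw [intervalIntegral.integral_eq_sub_of_hasDerivAt hder
      (Continuous.intervalIntegrable (by fun_prop) _ _)]
    field_simp
    ring
  have i2 : ∫ x in (a + w)..(a + 2 * w), F x = w * (c / 2 + k' * w / 6) := by
    rw [intervalIntegral.integral_congr c2]
    have hder : ∀ x ∈ uIcc (a + w) (a + 2 * w), HasDerivAt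
        (fun x => -(c * (x - a - 2 * w) ^ 2 / 2 +
          k' * (w * (x - a - 2 * w) ^ 2 / 2 + (x - a - 2 * w) ^ 3 / 3)) / w)
        ((c + k' * (x - (a + w))) * (2 - (x - a) / w)) x := fun x _ => by
      have h1 := ((hasDerivAt_id x).sub_const a).sub_const (2 * w)
      have h2 := h1.pow 2
      have h3 := h1.pow 3
      have := (((h2.const_mul c).div_const 2).add
        ((((h2.const_mul w).div_const 2).add (h3.div_const 3)).const_mul k')).neg.div_const w
      refine this.congr_deriv ?_
      simp only [id_eq]
      field_simp
      push_cast
      ring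
    rw [intervalIntegral.integral_eq_sub_of_hasDerivAt hder
      (Continuous.intervalIntegrable (by fun_prop) _ _)]
    field_simp
    ring
  have hi1 : IntervalIntegrable F volume a (a + w) :=
    (Continuous.intervalIntegrable (u := fun x => (c + k * (x - (a + w))) * ((x - a) / w))
      (by fun_prop) _ _).congr fun x hx => (c1 x (uIoc_subset_uIcc hx)).symm
  have hi2 : IntervalIntegrable F volume (a + w) (a + 2 * w) :=
    (Continuous.intervalIntegrable
      (u := fun x => (c + k' * (x - (a + w))) * (2 - (x - a) / w))
      (by fun_prop) _ _).congr fun x hx => (c2 x (uIoc_subset_uIcc hx)).symm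
  rw [← setIntegral_eq_integral_of_forall_compl_eq_zero F0,
    ← intervalIntegral.integral_of_le (by linarith),
    ← intervalIntegral.integral_add_adjacent_intervals hi1 hi2, i1, i2]
  ring

/-- Testing with an edge function bounds the difference of the pressure along the edge. For `ℚ₁`,
where the slope in `y` is not constant, the tested quantity is a weighted mean of the differences
along the edge and along the two parallel sides, and `bubble_bound` provides the remaining
information. -/
theorem edge_bound {P : Set Rect} (hP : IsRectPartition P) {D : Option (Rect → Bool)}
    {q : Plane → ℝ} (hq : q ∈ feSpace (meshCells P D) (prePoly D))
    (hq2 : MemLp q 2 (volume.restrict (domain (meshCells P D)))) {s : ℝ} (hs : 0 ≤ s)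
    (H : WeakBound (meshCells P D) (velPoly D) q s) (hR : R ∈ P) (hR' : R' ∈ P)
    (hn : IsRightNeighbour R R') :
    |q (R.x.2, R.y.2) - q (R.x.2, R.y.1)| * √(R.width * R.height) ≤
      20000 * s * (1 + R.height / R.width) := by
  have hd := hP.nondeg R hR
  have hw := hd.width_pos
  have hh := hd.height_pos
  have hlip := (lipXY_edgeFun (D := D) (R' := R') hd).lipschitzWith (by positivity)
    (by positivity)
  have hc : HasCompactSupport (edgeFun D R R') :=
    hasCompactSupport_of_ne_zero_mem fun z hz => edgeFun_mem_box hd hn hz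
  have hb := hP.isBump_edgeFun D hR hR' hn
  have hG := gradSq_edgeFun_le (D := D) hd hn
  have hI := le_integral_edgeFun (D := D) hd hn
  have hint := hb.integrable_mul (hP.isBounded_domain D) hq2 1
  have hH := H _ hb 1
  have hr : 0 ≤ s * (1 + R.height / R.width) := by positivity
  have fub : ∫ z, edgeFun D R R' z = ∫ x, ∫ y, edgeFun D R R' (x, y) := by
    have := hlip.continuous.integrable_of_hasCompactSupport hc (μ := volume)
    rw [Measure.volume_eq_prod] at this ⊢
    exact integral_prod _ this
  cases D with
  | some d =>
    obtain ⟨c, g, hcq, hg⟩ := edge_slices_tri hP hq hR hR' hn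
    rw [integral_lineDeriv_mul_of_slices (B := fun _ => c) hlip hc edgeFun_nonneg hint hg,
      integral_const_mul, ← fub, abs_neg, abs_mul,
      abs_of_nonneg (integral_nonneg edgeFun_nonneg)] at hH
    have h1 := (mul_le_mul_of_nonneg_left hI (abs_nonneg c)).trans hH
    rw [← hcq]
    refine (scaled_bound (c := 1 / 512) (K := 9) hw hh (by norm_num) hs (by norm_num)
      ?_ hG).trans ?_
    · rw [abs_mul, abs_of_pos hh]
      exact le_trans (le_of_eq (by ring)) h1
    · rw [mul_assoc, mul_assoc]
      exact mul_le_mul_of_nonneg_right (by norm_num) hr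
  | none =>
    obtain ⟨c, k, k', g, hcq, hk, hk', hg⟩ := edge_slices_quad hP hq hR hR' hn
    -- the edge function is a tensor product
    set J : ℝ := ∫ y, clamp ((y - R.y.1) / R.height) * clamp (1 - (y - R.y.1) / R.height) with hJ
    have hx2 : R.x.1 + R.width = R.x.2 := by rw [Rect.width]; ring
    have hten : ∀ x, ∫ y, edgeFun none R R' (x, y) =
        (clamp (min ((x - R.x.1) / R.width) 1) + clamp (min (2 - (x - R.x.1) / R.width) 1) - 1) *
          J := fun x => by
      rw [hJ, ← integral_const_mul]
      congr 1 with y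
      simp only [edgeFun, edgeShape, Option.map_none, Rect.u, Rect.v]
      ring
    have hJI : R.width * J = ∫ z, edgeFun none R R' z := by
      rw [fub]
      simp_rw [hten]
      rw [integral_mul_const]
      have := integral_mul_hat (a := R.x.1) (c := 1) (k := 0) (k' := 0) hw
      simp only [zero_mul, add_zero, ite_self, one_mul, sub_self, zero_div, mul_one] at this
      rw [this]
    have hJ' : R.height / 512 ≤ J := by
      rw [← hJI] at hI
      refine le_of_mul_le_mul_left ?_ hw
      exact le_trans (le_of_eq (by ring)) hI
    rw [integral_lineDeriv_mul_of_slices (B := fun x => if x ≤ R.x.2 then c + k * (x - R.x.2)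
      else c + k' * (x - R.x.2)) hlip hc edgeFun_nonneg hint hg] at hH
    simp_rw [hten, ← mul_assoc] at hH
    have hhat := integral_mul_hat (a := R.x.1) (c := c) (k := k) (k' := k') hw
    rw [hx2] at hhat
    rw [integral_mul_const, hhat, abs_neg, abs_mul,
      abs_of_nonneg ((by positivity : (0 : ℝ) ≤ R.height / 512).trans hJ')] at hH
    have h1 := (mul_le_mul_of_nonneg_left hJ' (abs_nonneg _)).trans hH
    have h2 := scaled_bound (δ := R.height * (c + (k' - k) * R.width / 6)) (c := 1 / 512) (K := 9)
      hw hh (by norm_num) hs (by norm_num) (by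
        rw [abs_mul, abs_of_pos hh]
        rw [abs_mul, abs_of_pos hw] at h1
        exact le_trans (le_of_eq (by ring)) h1) hG
    have b1 := (bubble_bound hP hq hq2 hs H hR).1
    have b2 := (bubble_bound hP hq hq2 hs H hR').1
    rw [hk] at b1
    rw [hk', hn.width, hn.height] at b2
    set r := √(R.width * R.height)
    have hr0 : 0 ≤ r := Real.sqrt_nonneg _
    -- Simpson's rule: the difference along the edge from the three tested quantities
    have e : q (R.x.2, R.y.2) - q (R.x.2, R.y.1) =
        3 * (R.height * (c + (k' - k) * R.width / 6)) -
          (R.height * (2 * c - k * R.width) + R.height * (2 * c + k' * R.width)) / 2 := by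
      rw [← hcq]; ring
    rw [e, ← abs_of_nonneg hr0, ← abs_mul]
    rw [← abs_of_nonneg hr0, ← abs_mul] at h2 b1 b2
    obtain ⟨p1, p2⟩ := abs_le.1 h2
    obtain ⟨p3, p4⟩ := abs_le.1 b1
    obtain ⟨p5, p6⟩ := abs_le.1 b2
    rw [mul_assoc] at p1 p2 p3 p4 p5 p6 ⊢
    norm_num at p1 p2
    rw [abs_le]
    constructor <;> nlinarith

end EdgeBound

/-! ### Exchanging the coordinates -/

theorem mem_image_swap {K : Set Plane} {z : Plane} : z ∈ Prod.swap '' K ↔ z.swap ∈ K := by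
  rw [image_swap_eq_preimage_swap]; rfl

/-- The mirror images of the cells. -/
def swapCells (𝒦 : Set (Set Plane)) : Set (Set Plane) := (fun K => Prod.swap '' K) '' 𝒦

theorem swapCells_swapCells (𝒦 : Set (Set Plane)) : swapCells (swapCells 𝒦) = 𝒦 := by
  simp only [swapCells, image_image, Prod.swap_swap, image_id']

theorem region_swapCells (𝒦 : Set (Set Plane)) :
    region (swapCells 𝒦) = Prod.swap '' region 𝒦 := by
  rw [region, region, swapCells, sUnion_image, sUnion_eq_biUnion, image_iUnion₂]

theorem domain_swapCells (𝒦 : Set (Set Plane)) :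
    domain (swapCells 𝒦) = Prod.swap '' domain 𝒦 := by
  rw [domain, domain, region_swapCells]
  exact ((Homeomorph.prodComm ℝ ℝ).image_interior _).symm

/-- The space of polynomials is symmetric in the two variables. -/
def IsSymmPoly (S : Submodule ℝ (MvPolynomial (Fin 2) ℝ)) : Prop :=
  ∀ p ∈ S, MvPolynomial.rename (Equiv.swap (0 : Fin 2) 1) p ∈ S

theorem isSymmPoly_polyQ (l : ℕ) : IsSymmPoly (polyQ l) := fun p hp => by
  rw [mem_polyQ_iff] at *
  intro i
  obtain ⟨j, rfl⟩ := (Equiv.swap (0 : Fin 2) 1).surjective i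
  rw [MvPolynomial.degreeOf_rename_of_injective (Equiv.swap (0 : Fin 2) 1).injective]
  exact hp j

theorem isSymmPoly_polyP (l : ℕ) : IsSymmPoly (polyP l) := fun p hp => by
  rw [MvPolynomial.mem_restrictTotalDegree] at *
  exact (MvPolynomial.totalDegree_rename_le _ _).trans hp

theorem isSymmPoly_velPoly (D : Option (Rect → Bool)) : IsSymmPoly (velPoly D) := by
  cases D with
  | none => exact isSymmPoly_polyQ 2
  | some d => exact isSymmPoly_polyP 2

theorem isSymmPoly_prePoly (D : Option (Rect → Bool)) : IsSymmPoly (prePoly D) := by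
  cases D with
  | none => exact isSymmPoly_polyQ 1
  | some d => exact isSymmPoly_polyP 1

theorem comp_swap_mem_feSpace {𝒦 : Set (Set Plane)} {S : Submodule ℝ (MvPolynomial (Fin 2) ℝ)}
    (hS : IsSymmPoly S) {f : Plane → ℝ} (hf : f ∈ feSpace 𝒦 S) :
    f ∘ Prod.swap ∈ feSpace (swapCells 𝒦) S := by
  refine ⟨hf.1.comp continuous_swap.continuousOn fun z hz => ?_, ?_⟩
  · rwa [region_swapCells, mem_image_swap] at hz
  · rintro _ ⟨K, hK, rfl⟩
    obtain ⟨p, hp, h⟩ := hf.2 K hK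
    refine ⟨_, hS p hp, fun z hz => ?_⟩
    rw [mem_image_swap] at hz
    rw [Function.comp_apply, h _ hz, MvPolynomial.eval_rename]
    congr 2
    funext i
    fin_cases i <;> simp

theorem lineDeriv_comp_swap (f : Plane → ℝ) (z : Plane) (i : Fin 2) :
    lineDeriv ℝ (f ∘ Prod.swap) z (unitVec i) =
      lineDeriv ℝ f z.swap (unitVec (Equiv.swap 0 1 i)) := by
  fin_cases i <;> simp [lineDeriv, unitVec]

theorem integral_comp_swap (f : Plane → ℝ) : ∫ z : Plane, f z.swap = ∫ z, f z :=
  (Measure.measurePreserving_swap (μ := (volume : Measure ℝ))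
    (ν := (volume : Measure ℝ))).integral_comp
    (MeasurableEquiv.prodComm (α := ℝ) (β := ℝ)).measurableEmbedding f

theorem gradSq_comp_swap (f : Plane → ℝ) : gradSq (f ∘ Prod.swap) = gradSq f := by
  simp only [gradSq, lineDeriv_comp_swap, Fin.sum_univ_two]
  rw [integral_comp_swap fun z => lineDeriv ℝ f z (unitVec (Equiv.swap 0 1 0)) ^ 2,
    integral_comp_swap fun z => lineDeriv ℝ f z (unitVec (Equiv.swap 0 1 1)) ^ 2]
  simp [add_comm]

theorem IsBump.comp_swap {𝒦 : Set (Set Plane)} {S : Submodule ℝ (MvPolynomial (Fin 2) ℝ)}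
    (hS : IsSymmPoly S) {φ : Plane → ℝ} (h : IsBump 𝒦 S φ) :
    IsBump (swapCells 𝒦) S (φ ∘ Prod.swap) := by
  refine ⟨comp_swap_mem_feSpace hS h.mem, ?_, fun z => h.nonneg _, fun z hz => ?_⟩
  · obtain ⟨C, hC⟩ := h.lip
    refine ⟨C, LipschitzWith.of_dist_le_mul fun z w => ?_⟩
    refine (hC.dist_le_mul _ _).trans (le_of_eq ?_)
    simp [Prod.dist_eq, max_comm]
  · rw [domain_swapCells, mem_image_swap]
    exact h.support _ hz

theorem WeakBound.comp_swap {𝒦 : Set (Set Plane)} {S : Submodule ℝ (MvPolynomial (Fin 2) ℝ)}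
    (hS : IsSymmPoly S) {q : Plane → ℝ} {s : ℝ} (h : WeakBound 𝒦 S q s) :
    WeakBound (swapCells 𝒦) S (q ∘ Prod.swap) s := by
  intro φ hφ i
  have h1 := hφ.comp_swap hS
  rw [swapCells_swapCells] at h1
  have h2 := h _ h1 (Equiv.swap 0 1 i)
  rw [gradSq_comp_swap] at h2
  rw [← integral_comp_swap]
  simpa [lineDeriv_comp_swap] using h2

theorem memLp_comp_swap {Ω : Set Plane} {q : Plane → ℝ} (h : MemLp q 2 (volume.restrict Ω)) :
    MemLp (q ∘ Prod.swap) 2 (volume.restrict (Prod.swap '' Ω)) := by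
  have := (Measure.measurePreserving_swap (μ := (volume : Measure ℝ))
    (ν := (volume : Measure ℝ))).restrict_preimage_emb
    (MeasurableEquiv.prodComm (α := ℝ) (β := ℝ)).measurableEmbedding Ω
  rw [image_swap_eq_preimage_swap]
  exact h.comp_measurePreserving this

namespace Rect

theorem swap_swap (R : Rect) : R.swap.swap = R := rfl

theorem swap_toSet (R : Rect) : R.swap.toSet = Prod.swap '' R.toSet := by
  ext z
  rw [mem_image_swap]
  simp only [toSet, swap, mem_prod, Prod.fst_swap, Prod.snd_swap]
  exact and_comm

theorem swap_u (R : Rect) (z : Plane) : R.swap.u z = R.v z.swap := rfl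

theorem swap_v (R : Rect) (z : Plane) : R.swap.v z = R.u z.swap := rfl

theorem swap_halfSet (R : Rect) (b c : Bool) :
    R.swap.halfSet b c = Prod.swap '' R.halfSet b (b.xor c) := by
  ext z
  rw [mem_image_swap]
  cases b <;> cases c <;>
    simp only [halfSet, mem_ofPred_eq, swap_toSet, mem_image_swap, swap_u, swap_v, Bool.xor_false,
      Bool.xor_true, Bool.not_true, Bool.not_false, add_comm]

theorem Nondeg.swap {R : Rect} (h : R.Nondeg) : R.swap.Nondeg := ⟨h.2, h.1⟩

end Rect

theorem IsRectPartition.swap {P : Set Rect} (hP : IsRectPartition P) :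
    IsRectPartition (Rect.swap '' P) := by
  refine ⟨hP.finite.image _, ?_, ?_⟩
  · rintro _ ⟨R, hR, rfl⟩
    exact (hP.nondeg R hR).swap
  · rintro _ ⟨R, hR, rfl⟩ _ ⟨R', hR', rfl⟩ h
    have := hP.sep R hR R' hR' fun e => h (by rw [e])
    simp only [Rect.Sep, Rect.swap] at *
    tauto

theorem IsRectPartition.reflect {P : Set Rect} (hP : IsRectPartition P) :
    IsRectPartition (Rect.reflect '' P) := by
  refine ⟨hP.finite.image _, ?_, ?_⟩
  · rintro _ ⟨R, hR, rfl⟩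
    exact ⟨neg_lt_neg (hP.nondeg R hR).1, (hP.nondeg R hR).2⟩
  · rintro _ ⟨R, hR, rfl⟩ _ ⟨R', hR', rfl⟩ h
    have := hP.sep R hR R' hR' fun e => h (by rw [e])
    simp only [Rect.Sep, Rect.reflect, neg_le_neg_iff] at *
    tauto

theorem swapCells_meshCells {P : Set Rect} (hP : IsRectPartition P) (D : Option (Rect → Bool)) :
    meshCells (Rect.swap '' P) (D.map fun d => d ∘ Rect.swap) = swapCells (meshCells P D) := by
  cases D with
  | none =>
    simp only [meshCells, Option.map_none, rectCells, swapCells, image_image, Rect.swap_toSet]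
  | some d =>
    ext K
    simp only [meshCells, Option.map_some, swapCells, mem_image]
    rw [hP.swap.mem_triCells]
    constructor
    · rintro ⟨_, ⟨R, hR, rfl⟩, c, rfl⟩
      refine ⟨_, hP.mem_triCells.2 ⟨R, hR, (d R).xor c, rfl⟩, ?_⟩
      rw [Rect.swap_halfSet, Function.comp_apply, Rect.swap_swap]
    · rintro ⟨_, hK, rfl⟩
      obtain ⟨R, hR, c, rfl⟩ := hP.mem_triCells.1 hK
      refine ⟨_, ⟨R, hR, rfl⟩, (d R).xor c, ?_⟩
      rw [Rect.swap_halfSet, Function.comp_apply, Rect.swap_swap, ← Bool.xor_assoc,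
        Bool.xor_self, Bool.false_xor]

/-! ### Control of the corner values of a pressure -/

/-- The bounds for pressure differences that follow from testing with bubbles and edge functions.
They are stated purely in terms of values at the corners of the rectangles. -/
structure CornerControl (P : Set Rect) (q : Plane → ℝ) (s : ℝ) : Prop where
  nonneg : 0 ≤ s
  vertical : ∀ R ∈ P,
    |q (R.x.2, R.y.2) + q (R.x.1, R.y.2) - q (R.x.1, R.y.1) - q (R.x.2, R.y.1)| *
      √(R.width * R.height) ≤ s * (1 + R.height / R.width)
  horizontal : ∀ R ∈ P,
    |q (R.x.2, R.y.2) + q (R.x.2, R.y.1) - q (R.x.1, R.y.1) - q (R.x.1, R.y.2)| *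
      √(R.width * R.height) ≤ s * (1 + R.width / R.height)
  rightEdge : ∀ R ∈ P, ∀ R' ∈ P, IsRightNeighbour R R' →
    |q (R.x.2, R.y.2) - q (R.x.2, R.y.1)| * √(R.width * R.height) ≤
      s * (1 + R.height / R.width)
  topEdge : ∀ R ∈ P, ∀ R' ∈ P, IsRightNeighbour R.swap R'.swap →
    |q (R.x.2, R.y.2) - q (R.x.1, R.y.2)| * √(R.width * R.height) ≤
      s * (1 + R.width / R.height)

theorem cornerControl_of_weakBound {P : Set Rect} (hP : IsRectPartition P)
    {D : Option (Rect → Bool)} {q : Plane → ℝ} (hq : q ∈ feSpace (meshCells P D) (prePoly D))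
    (hq2 : MemLp q 2 (volume.restrict (domain (meshCells P D)))) {s : ℝ} (hs : 0 ≤ s)
    (H : WeakBound (meshCells P D) (velPoly D) q s) : CornerControl P q (20000 * s) := by
  have mono : ∀ r : ℝ, 0 ≤ r → 4096 * s * (1 + r) ≤ 20000 * s * (1 + r) := fun r hr => by
    have : 0 ≤ s * (1 + r) := by positivity
    linarith
  refine ⟨by positivity, fun R hR => ?_, fun R hR => ?_, fun R hR R' hR' hn => ?_,
    fun R hR R' hR' hn => ?_⟩
  · have hn := hP.nondeg R hR
    exact (bubble_bound hP hq hq2 hs H hR).1.trans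
      (mono _ (div_pos hn.height_pos hn.width_pos).le)
  · have hn := hP.nondeg R hR
    exact (bubble_bound hP hq hq2 hs H hR).2.trans
      (mono _ (div_pos hn.width_pos hn.height_pos).le)
  · exact edge_bound hP hq hq2 hs H hR hR' hn
  · have e1 : prePoly (D.map fun d => d ∘ Rect.swap) = prePoly D := by cases D <;> rfl
    have e2 : velPoly (D.map fun d => d ∘ Rect.swap) = velPoly D := by cases D <;> rfl
    have h1 := comp_swap_mem_feSpace (isSymmPoly_prePoly D) hq
    have h2 := memLp_comp_swap hq2
    have h3 := H.comp_swap (isSymmPoly_velPoly D)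
    rw [← domain_swapCells] at h2
    rw [← swapCells_meshCells hP] at h1 h2 h3
    rw [← e1] at h1
    rw [← e2] at h3
    have := edge_bound hP.swap h1 h2 hs h3 (mem_image_of_mem _ hR) (mem_image_of_mem _ hR') hn
    rw [mul_comm R.width R.height]
    exact this

theorem CornerControl.swap {P : Set Rect} {q : Plane → ℝ} {s : ℝ} (h : CornerControl P q s) :
    CornerControl (Rect.swap '' P) (q ∘ Prod.swap) s := by
  refine ⟨h.nonneg, ?_, ?_, ?_, ?_⟩
  · rintro _ ⟨R, hR, rfl⟩
    have := h.horizontal R hR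
    rw [mul_comm R.width] at this
    exact this
  · rintro _ ⟨R, hR, rfl⟩
    have := h.vertical R hR
    rw [mul_comm R.width] at this
    exact this
  · rintro _ ⟨R, hR, rfl⟩ _ ⟨R', hR', rfl⟩ hn
    have := h.topEdge R hR R' hR' hn
    rw [mul_comm R.width] at this
    exact this
  · rintro _ ⟨R, hR, rfl⟩ _ ⟨R', hR', rfl⟩ hn
    have := h.rightEdge R hR R' hR' hn
    rw [mul_comm R.width] at this
    exact this

theorem Rect.reflect_width (R : Rect) : R.reflect.width = R.width := by
  simp only [Rect.reflect, Rect.width]; ring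

theorem Rect.reflect_height (R : Rect) : R.reflect.height = R.height := rfl

theorem CornerControl.of_reflect {P : Set Rect} {q : Plane → ℝ} {s : ℝ}
    (h : CornerControl (Rect.reflect '' P) q s) : CornerControl P (fun z => q (-z.1, z.2)) s := by
  refine ⟨h.nonneg, fun R hR => ?_, fun R hR => ?_, fun R hR R' hR' hn => ?_,
    fun R hR R' hR' hn => ?_⟩
  · have := h.vertical _ (mem_image_of_mem _ hR)
    rw [R.reflect_width, R.reflect_height] at this
    refine le_trans (le_of_eq ?_) this
    congr 2
    simp only [Rect.reflect]
    ring
  · have := h.horizontal _ (mem_image_of_mem _ hR)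
    rw [R.reflect_width, R.reflect_height] at this
    refine le_trans (le_of_eq ?_) this
    congr 1
    rw [← abs_neg]
    congr 1
    simp only [Rect.reflect]
    ring
  · -- the reflection exchanges left and right neighbours
    have hn' : IsRightNeighbour R'.reflect R.reflect := by
      refine ⟨?_, hn.y.symm, ?_⟩
      · simp only [Rect.reflect, hn.fst]
      · rw [R.reflect_width, R'.reflect_width, hn.width]
    have := h.rightEdge _ (mem_image_of_mem _ hR') _ (mem_image_of_mem _ hR) hn'
    rw [R'.reflect_width, R'.reflect_height, hn.width, hn.height] at this
    simp only [Rect.reflect, hn.fst, hn.y] at this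
    exact this
  · have hn' : IsRightNeighbour R.reflect.swap R'.reflect.swap := by
      have hx : R'.x = R.x := hn.y
      refine ⟨hn.fst, ?_, hn.width⟩
      simp only [Rect.reflect, Rect.swap, hx]
    have := h.topEdge _ (mem_image_of_mem _ hR) _ (mem_image_of_mem _ hR') hn'
    rw [R.reflect_width, R.reflect_height, abs_sub_comm] at this
    exact this

/-! ### From differences to values: the geometry of edge patches -/

/-- The corner values of `q` on `R` differ from `c` by at most `d`, in the scaling of `L²(R)`. -/
def CornersNear (q : Plane → ℝ) (c d : ℝ) (R : Rect) : Prop :=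
  ∀ x ∈ ({R.x.1, R.x.2} : Set ℝ), ∀ y ∈ ({R.y.1, R.y.2} : Set ℝ),
    |q (x, y) - c| * √(R.width * R.height) ≤ d

/-- The values of `q` at the end points and the midpoint of a horizontal segment differ from `c`
by at most `d` after multiplication with the weight `w`. -/
def RowNear (q : Plane → ℝ) (c w d a b y : ℝ) : Prop :=
  ∀ x ∈ ({a, (a + b) / 2, b} : Set ℝ), |q (x, y) - c| * w ≤ d

theorem RowNear.mono {q : Plane → ℝ} {c w w' m d a b y : ℝ} (h : RowNear q c w d a b y)
    (hw : w' ≤ m * w) (hm : 0 ≤ m) : RowNear q c w' (m * d) a b y := fun x hx =>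
  calc |q (x, y) - c| * w' ≤ |q (x, y) - c| * (m * w) :=
        mul_le_mul_of_nonneg_left hw (abs_nonneg _)
    _ = m * (|q (x, y) - c| * w) := by ring
    _ ≤ m * d := mul_le_mul_of_nonneg_left (h x hx) hm

theorem RowNear.mono_right {q : Plane → ℝ} {c w d d' a b y : ℝ} (h : RowNear q c w d a b y)
    (hd : d ≤ d') : RowNear q c w d' a b y := fun x hx => (h x hx).trans hd

theorem CornersNear.mono {q : Plane → ℝ} {c d d' : ℝ} {R : Rect} (h : CornersNear q c d R)
    (hd : d ≤ d') : CornersNear q c d' R := fun x hx y hy => (h x hx y hy).trans hd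

theorem cornersNear_of_rows {q : Plane → ℝ} {c d a b y₁ y₂ : ℝ}
    (h₁ : RowNear q c √((b - a) / 2 * (y₂ - y₁)) d a b y₁)
    (h₂ : RowNear q c √((b - a) / 2 * (y₂ - y₁)) d a b y₂) :
    ∀ I ∈ halves a b, CornersNear q c d ⟨I, (y₁, y₂)⟩ := by
  rintro I (rfl | rfl)
  all_goals
    intro x hx y hy
    simp only [mem_insert_iff, mem_singleton_iff] at hx hy
    simp only [Rect.width, Rect.height]
  · rw [show (a + b) / 2 - a = (b - a) / 2 by ring]
    rcases hy with rfl | rfl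
    · exact h₁ x (by rcases hx with rfl | rfl <;> simp)
    · exact h₂ x (by rcases hx with rfl | rfl <;> simp)
  · rw [show b - (a + b) / 2 = (b - a) / 2 by ring]
    rcases hy with rfl | rfl
    · exact h₁ x (by rcases hx with rfl | rfl <;> simp)
    · exact h₂ x (by rcases hx with rfl | rfl <;> simp)

/-- The bounds available on two cells side by side, with `h ≤ r w`. -/
theorem CornerControl.pair {P : Set Rect} {q : Plane → ℝ} {s : ℝ} (H : CornerControl P q s)
    {a b y₁ y₂ r : ℝ} (hab : a < b) (hP : ∀ I ∈ halves a b, (⟨I, (y₁, y₂)⟩ : Rect) ∈ P)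
    (hr : y₂ - y₁ ≤ r * ((b - a) / 2)) {w : ℝ} (hw : w = √((b - a) / 2 * (y₂ - y₁))) :
    |q ((a + b) / 2, y₂) - q ((a + b) / 2, y₁)| * w ≤ s * (1 + r) ∧
      |q ((a + b) / 2, y₂) + q (a, y₂) - q (a, y₁) - q ((a + b) / 2, y₁)| * w ≤ s * (1 + r) ∧
      |q (b, y₂) + q ((a + b) / 2, y₂) - q ((a + b) / 2, y₁) - q (b, y₁)| * w ≤ s * (1 + r) := by
  have m1 := hP (a, (a + b) / 2) (by simp [halves])
  have m2 := hP ((a + b) / 2, b) (by simp [halves])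
  have w1 : (a + b) / 2 - a = (b - a) / 2 := by ring
  have w2 : b - (a + b) / 2 = (b - a) / 2 := by ring
  have hr' : s * (1 + (y₂ - y₁) / ((b - a) / 2)) ≤ s * (1 + r) := by
    refine mul_le_mul_of_nonneg_left ?_ H.nonneg
    have : (y₂ - y₁) / ((b - a) / 2) ≤ r := by rwa [div_le_iff₀ (by linarith)]
    linarith
  have hn : IsRightNeighbour ⟨(a, (a + b) / 2), (y₁, y₂)⟩ ⟨((a + b) / 2, b), (y₁, y₂)⟩ :=
    ⟨rfl, rfl, by simp only [Rect.width]; ring⟩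
  have k1 := H.rightEdge _ m1 _ m2 hn
  have k2 := H.vertical _ m1
  have k3 := H.vertical _ m2
  simp only [Rect.width, Rect.height, w1, w2, ← hw] at k1 k2 k3
  exact ⟨k1.trans hr', k2.trans hr', k3.trans hr'⟩

/-- Control of a row of corner values passes to the next row below: the difference along the edge
in the middle gives the value in the middle, and the mean differences on the two cells give the
other two. -/
theorem CornerControl.propagate {P : Set Rect} {q : Plane → ℝ} {s : ℝ} (H : CornerControl P q s)
    {a b y₁ y₂ r c d : ℝ} (hab : a < b) (hP : ∀ I ∈ halves a b, (⟨I, (y₁, y₂)⟩ : Rect) ∈ P)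
    (hr : y₂ - y₁ ≤ r * ((b - a) / 2))
    (h : RowNear q c √((b - a) / 2 * (y₂ - y₁)) d a b y₂) :
    RowNear q c √((b - a) / 2 * (y₂ - y₁)) (d + 2 * (s * (1 + r))) a b y₁ := by
  obtain ⟨k1, k2, k3⟩ := H.pair hab hP hr rfl
  have hE : 0 ≤ s * (1 + r) := le_trans (by positivity) k1
  have n1 := h a (by simp)
  have n2 := h ((a + b) / 2) (by simp)
  have n3 := h b (by simp)
  set w := √((b - a) / 2 * (y₂ - y₁))
  have hw : 0 ≤ w := Real.sqrt_nonneg _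
  rw [← abs_of_nonneg hw, ← abs_mul, abs_le] at n1 n2 n3 k1 k2 k3
  intro x hx
  rw [← abs_of_nonneg hw, ← abs_mul, abs_le]
  rcases hx with rfl | rfl | rfl <;> constructor <;> linarith

/-- On two cells of bounded aspect ratio side by side, all corner values are controlled, by
comparison with the value at the upper end point of the common edge. -/
theorem CornerControl.isotropic {P : Set Rect} {q : Plane → ℝ} {s : ℝ} (H : CornerControl P q s)
    {a b y₁ y₂ r : ℝ} (hab : a < b) (hy : y₁ < y₂)
    (hP : ∀ I ∈ halves a b, (⟨I, (y₁, y₂)⟩ : Rect) ∈ P)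
    (hr : y₂ - y₁ ≤ r * ((b - a) / 2)) (hr' : (b - a) / 2 ≤ r * (y₂ - y₁)) :
    RowNear q (q ((a + b) / 2, y₂)) √((b - a) / 2 * (y₂ - y₁)) (4 * (s * (1 + r))) a b y₂ ∧
      RowNear q (q ((a + b) / 2, y₂)) √((b - a) / 2 * (y₂ - y₁)) (4 * (s * (1 + r))) a b y₁ := by
  obtain ⟨k1, k2, k3⟩ := H.pair hab hP hr rfl
  have hE : 0 ≤ s * (1 + r) := le_trans (by positivity) k1
  have m1 := hP (a, (a + b) / 2) (by simp [halves])
  have m2 := hP ((a + b) / 2, b) (by simp [halves])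
  have w1 : (a + b) / 2 - a = (b - a) / 2 := by ring
  have w2 : b - (a + b) / 2 = (b - a) / 2 := by ring
  have hr2 : s * (1 + (b - a) / 2 / (y₂ - y₁)) ≤ s * (1 + r) := by
    refine mul_le_mul_of_nonneg_left ?_ H.nonneg
    have : (b - a) / 2 / (y₂ - y₁) ≤ r := by rwa [div_le_iff₀ (by linarith)]
    linarith
  have k4 := H.horizontal _ m1
  have k5 := H.horizontal _ m2
  simp only [Rect.width, Rect.height, w1, w2] at k4 k5
  replace k4 := k4.trans hr2
  replace k5 := k5.trans hr2
  set w := √((b - a) / 2 * (y₂ - y₁))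
  have hw : 0 ≤ w := Real.sqrt_nonneg _
  rw [← abs_of_nonneg hw, ← abs_mul, abs_le] at k1 k2 k3 k4 k5
  constructor <;> intro x hx <;>
    rw [← abs_of_nonneg hw, ← abs_mul, abs_le] <;>
    rcases hx with rfl | rfl | rfl <;> constructor <;> linarith

/-- Control of the upper side of a thin strip passes to the whole strip, cut or not. The cells
satisfy `h ≤ 2 w`, so one step adds at most `6 s`. -/
theorem CornerControl.strip {P : Set Rect} {q : Plane → ℝ} {s : ℝ} (H : CornerControl P q s)
    {a b y t c d : ℝ} {refined : Bool} (hab : a < b) (ht : 0 < t) (htb : t ≤ b - a)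
    (hP : grid (halves a b) (pieces refined (y - t) y) ⊆ P)
    (h : RowNear q c √((b - a) / 2 * t) d a b y) :
    ∀ R ∈ grid (halves a b) (pieces refined (y - t) y), CornersNear q c (d + 12 * s) R := by
  have hs := H.nonneg
  cases refined
  · have hm : ∀ I ∈ halves a b, (⟨I, (y - t, y)⟩ : Rect) ∈ P := fun I hI =>
      hP ⟨hI, by simp [pieces]⟩
    have e : y - (y - t) = t := by ring
    have h1 := H.propagate (r := 2) (c := c) (d := d) hab hm (by linarith) (by rwa [e])
    rintro ⟨I, J⟩ ⟨hI, hJ⟩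
    have hJ' : J = (y - t, y) := by simpa [pieces] using hJ
    subst hJ'
    refine cornersNear_of_rows (h1.mono_right (by linarith)) ?_ I hI
    rw [e]
    exact h.mono_right (by linarith)
  · have hm1 : ∀ I ∈ halves a b, (⟨I, (y - t, (y - t + y) / 2)⟩ : Rect) ∈ P := fun I hI =>
      hP ⟨hI, by simp [pieces, halves]⟩
    have hm2 : ∀ I ∈ halves a b, (⟨I, ((y - t + y) / 2, y)⟩ : Rect) ∈ P := fun I hI =>
      hP ⟨hI, by simp [pieces, halves]⟩
    have e1 : y - (y - t + y) / 2 = t / 2 := by ring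
    have e2 : (y - t + y) / 2 - (y - t) = t / 2 := by ring
    have h0 : RowNear q c √((b - a) / 2 * (t / 2)) d a b y := by
      have := h.mono (w' := √((b - a) / 2 * (t / 2))) (m := 1) (by
        rw [one_mul]
        refine Real.sqrt_le_sqrt (mul_le_mul_of_nonneg_left (by linarith) (by linarith)))
        zero_le_one
      rwa [one_mul] at this
    have h1 := H.propagate (r := 2) (c := c) (d := d) hab hm2 (by linarith) (by rwa [e1])
    have h2 := H.propagate (r := 2) (c := c) hab hm1 (by linarith) (by rw [e2]; rwa [e1] at h1)
    rintro ⟨I, J⟩ ⟨hI, hJ⟩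
    have hJ' : J = (y - t, (y - t + y) / 2) ∨ J = ((y - t + y) / 2, y) := by
      simpa [pieces, halves] using hJ
    rcases hJ' with rfl | rfl
    · refine cornersNear_of_rows (h2.mono_right (by linarith)) ?_ I hI
      rw [e2]
      rw [e1] at h1
      exact h1.mono_right (by linarith)
    · refine cornersNear_of_rows (h1.mono_right (by linarith)) ?_ I hI
      rw [e1]
      exact h0.mono_right (by linarith)

theorem CornersNear.swap {q : Plane → ℝ} {c d : ℝ} {R : Rect}
    (h : CornersNear (q ∘ Prod.swap) c d R) : CornersNear q c d R.swap := fun x hx y hy => by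
  have := h y hy x hx
  rw [mul_comm R.width] at this
  exact this

theorem CornersNear.reflect {q : Plane → ℝ} {c d : ℝ} {R : Rect}
    (h : CornersNear (fun z => q (-z.1, z.2)) c d R) : CornersNear q c d R.reflect := by
  intro x hx y hy
  rw [R.reflect_width, R.reflect_height]
  have := h (-x) (by
    simp only [Rect.reflect, mem_insert_iff, mem_singleton_iff] at hx ⊢
    rcases hx with rfl | rfl <;> simp) y hy
  simpa using this

/-- On an edge patch all corner values of the pressure are controlled up to one constant, in the
scaling of `L²` on each cell. The constant `c` is the value of `q` at a mesh vertex on the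
boundary of the block `M'`. -/
theorem IsEdgePatch.exists_cornersNear {σ : ℝ} {P : Set Rect} (hP : IsEdgePatch σ P) :
    ∀ (q : Plane → ℝ) (s : ℝ), CornerControl P q s →
      ∃ c, ∀ R ∈ P, CornersNear q c ((12 * |σ| * (1 + |σ|) + 12) * s) R := by
  have hσ : ∀ {W T : ℝ}, 0 < W → 0 < T → W ≤ σ * T → T ≤ σ * W → 1 ≤ σ ∧ |σ| = σ := by
    intro W T hW hT h1 h2
    have h0 : 0 < σ := by
      by_contra h
      nlinarith
    refine ⟨?_, abs_of_pos h0⟩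
    by_contra h
    nlinarith
  have wt : ∀ {w m A B : ℝ}, 0 ≤ w → 1 ≤ m → 0 ≤ A → B ≤ m * A → √(w * B) ≤ m * √(w * A) := by
    intro w m A B hw hm hA hB
    rw [← Real.sqrt_sq (by linarith : 0 ≤ m), ← Real.sqrt_mul (sq_nonneg m)]
    refine Real.sqrt_le_sqrt ?_
    have h1 : B ≤ m ^ 2 * A := by
      nlinarith [mul_nonneg (mul_nonneg (by linarith : 0 ≤ m) (sub_nonneg.2 hm)) hA]
    calc w * B ≤ w * (m ^ 2 * A) := mul_le_mul_of_nonneg_left h1 hw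
      _ = m ^ 2 * (w * A) := by ring
  induction hP with
  | strip x₀ y₀ W T t refined hW hT hWT hTW ht htW =>
    intro q s H
    obtain ⟨h1, h2⟩ := hσ hW hT hWT hTW
    have hs := H.nonneg
    rw [h2]
    have hm : ∀ I ∈ halves x₀ (x₀ + W), (⟨I, (y₀, y₀ + T)⟩ : Rect) ∈
        grid (halves x₀ (x₀ + W)) (pieces refined (y₀ - t) y₀ ∪ {(y₀, y₀ + T)}) :=
      fun I hI => ⟨hI, Or.inr rfl⟩
    obtain ⟨r2, r1⟩ := H.isotropic (r := 2 * σ) (by linarith) (by linarith) hm (by linarith)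
      (by nlinarith)
    have e1 : (x₀ + W - x₀) / 2 = W / 2 := by ring
    have e2 : y₀ + T - y₀ = T := by ring
    refine ⟨q ((x₀ + (x₀ + W)) / 2, y₀ + T), ?_⟩
    rintro ⟨I, J⟩ ⟨hI, hJ | hJ⟩
    · have hrow := r1.mono (m := σ) (w' := √((x₀ + W - x₀) / 2 * t)) (by
        rw [e1, e2]
        exact wt (by linarith) h1 hT.le (htW.trans hWT)) (by linarith)
      refine (H.strip (by linarith) ht (by linarith)
        (fun R hR => ⟨hR.1, Or.inl hR.2⟩) hrow ⟨I, J⟩ ⟨hI, hJ⟩).mono ?_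
      have : 0 ≤ s * (σ * (2 + σ)) := by positivity
      nlinarith
    · have hJ' : J = (y₀, y₀ + T) := hJ
      subst hJ'
      refine (cornersNear_of_rows r1 r2 I hI).mono ?_
      have : 0 ≤ s * (σ * (σ - 1)) := by
        have : 0 ≤ σ - 1 := by linarith
        positivity
      have : 0 ≤ s * σ := by positivity
      nlinarith
  | overlapped x₀ y₀ W T t₁ t₂ refined₁ refined₂ hW hT hWT hTW ht₁ ht₁W ht₂ ht₂T =>
    intro q s H
    obtain ⟨h1, h2⟩ := hσ hW hT hWT hTW
    have hs := H.nonneg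
    rw [h2]
    have e1 : (x₀ + W - x₀) / 2 = W / 2 := by ring
    have e2 : y₀ + T - (y₀ + (y₀ + T)) / 2 = T / 2 := by ring
    have e3 : (y₀ + (y₀ + T)) / 2 - y₀ = T / 2 := by ring
    have e4 : (y₀ + T - y₀) / 2 = T / 2 := by ring
    -- the upper and the lower half of the isotropic block
    obtain ⟨r3, r2⟩ := H.isotropic (a := x₀) (b := x₀ + W) (y₁ := (y₀ + (y₀ + T)) / 2)
      (y₂ := y₀ + T) (r := σ) (by linarith) (by linarith)
      (fun I hI => Or.inl ⟨hI, Or.inr (by simp [halves])⟩) (by linarith) (by linarith)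
    have r1 := H.propagate (a := x₀) (b := x₀ + W) (y₁ := y₀) (y₂ := (y₀ + (y₀ + T)) / 2)
      (r := σ) (by linarith) (fun I hI => Or.inl ⟨hI, Or.inr (by simp [halves])⟩)
      (by linarith) (by rw [e3]; rwa [e2] at r2)
    rw [e1, e2] at r2 r3
    rw [e1, e3] at r1
    set c := q ((x₀ + (x₀ + W)) / 2, y₀ + T)
    refine ⟨c, ?_⟩
    have hsσ : 0 ≤ s * (1 + σ) := by positivity
    have hcol :
        RowNear (q ∘ Prod.swap) c √(T / 2 * (W / 2)) (6 * (s * (1 + σ))) y₀ (y₀ + T) x₀ := by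
      rw [mul_comm (T / 2)]
      rintro y (rfl | rfl | rfl)
      · exact (r1 x₀ (by simp)).trans (by linarith)
      · exact (r2 x₀ (by simp)).trans (by linarith)
      · exact (r3 x₀ (by simp)).trans (by linarith)
    have hfin : 2 * σ * (6 * (s * (1 + σ))) + 12 * s ≤ (12 * σ * (1 + σ) + 12) * s := by
      nlinarith
    have hsm : 6 * (s * (1 + σ)) ≤ (12 * σ * (1 + σ) + 12) * s := by
      have : 0 ≤ (σ - 1) * (s * (1 + σ)) := mul_nonneg (by linarith) hsσ
      nlinarith
    rintro ⟨I, J⟩ (⟨hI, hJ | hJ⟩ | ⟨hI, hJ⟩)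
    · have hrow := r1.mono (m := 2 * σ) (w' := √((x₀ + W - x₀) / 2 * t₁)) (by
        rw [e1]
        exact wt (by linarith) (by linarith) (by linarith) (by linarith)) (by linarith)
      refine (H.strip (by linarith) ht₁ (by linarith)
        (fun R hR => Or.inl ⟨hR.1, Or.inl hR.2⟩) hrow ⟨I, J⟩ ⟨hI, hJ⟩).mono ?_
      linarith
    · rcases hJ with hJ | hJ
      · have hJ' : J = (y₀, (y₀ + (y₀ + T)) / 2) := hJ
        subst hJ'
        refine (cornersNear_of_rows (d := 6 * (s * (1 + σ))) ?_ ?_ I hI).mono hsm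
        · rw [e1, e3]; exact r1.mono_right (by linarith)
        · rw [e1, e3]; exact r2.mono_right (by linarith)
      · have hJ' : J = ((y₀ + (y₀ + T)) / 2, y₀ + T) := hJ
        subst hJ'
        refine (cornersNear_of_rows (d := 6 * (s * (1 + σ))) ?_ ?_ I hI).mono hsm
        · rw [e1, e2]; exact r2.mono_right (by linarith)
        · rw [e1, e2]; exact r3.mono_right (by linarith)
    · -- the strip on the left is a strip below after exchanging the coordinates
      have hrow := hcol.mono (m := 2 * σ) (w' := √((y₀ + T - y₀) / 2 * t₂)) (by
        rw [e4]
        exact wt (by linarith) (by linarith) (by linarith) (by linarith)) (by linarith)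
      have := (H.swap.strip (by linarith) ht₂ (by linarith)
        (fun R hR => ⟨R.swap, Or.inr ⟨hR.2, hR.1⟩, rfl⟩) hrow ⟨J, I⟩ ⟨hJ, hI⟩).mono hfin
      exact CornersNear.swap this
  | swap h ih =>
    intro q s H
    have h1 := H.swap
    rw [image_image] at h1
    simp only [Rect.swap_swap, image_id'] at h1
    obtain ⟨c, hc⟩ := ih _ s h1
    refine ⟨c, ?_⟩
    rintro _ ⟨R, hR, rfl⟩
    exact (hc R hR).swap
  | reflect h ih =>
    intro q s H
    obtain ⟨c, hc⟩ := ih _ s H.of_reflect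
    refine ⟨c, ?_⟩
    rintro _ ⟨R, hR, rfl⟩
    exact (hc R hR).reflect

/-! ### Edge patches are rectangular partitions -/

/-- A family of nondegenerate intervals without common interior points. -/
def IsIntervalFamily (𝓘 : Set (ℝ × ℝ)) : Prop :=
  (∀ I ∈ 𝓘, I.1 < I.2) ∧ ∀ I ∈ 𝓘, ∀ J ∈ 𝓘, I ≠ J → I.2 ≤ J.1 ∨ J.2 ≤ I.1

theorem isIntervalFamily_halves {a b : ℝ} (h : a < b) : IsIntervalFamily (halves a b) := by
  constructor
  · rintro I (rfl | rfl) <;> simp only <;> linarith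
  · rintro I (rfl | rfl) J (rfl | rfl) hne
    · exact absurd rfl hne
    · exact Or.inl le_rfl
    · exact Or.inr le_rfl
    · exact absurd rfl hne

theorem isIntervalFamily_pieces {a b : ℝ} (h : a < b) (r : Bool) :
    IsIntervalFamily (pieces r a b) := by
  cases r
  · constructor
    · rintro I (rfl : I = (a, b)); exact h
    · rintro I (rfl : I = (a, b)) J (rfl : J = (a, b)) hne
      exact absurd rfl hne
  · exact isIntervalFamily_halves h

theorem halves_subset {a b : ℝ} (h : a < b) : ∀ I ∈ halves a b, a ≤ I.1 ∧ I.2 ≤ b := by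
  rintro I (rfl | rfl) <;> constructor <;> simp only <;> linarith

theorem pieces_subset {a b : ℝ} (h : a < b) (r : Bool) :
    ∀ I ∈ pieces r a b, a ≤ I.1 ∧ I.2 ≤ b := by
  cases r
  · rintro I (rfl : I = (a, b)); exact ⟨le_rfl, le_rfl⟩
  · exact halves_subset h

theorem IsIntervalFamily.union {𝓘 𝓙 : Set (ℝ × ℝ)} (hI : IsIntervalFamily 𝓘)
    (hJ : IsIntervalFamily 𝓙) {m : ℝ} (h1 : ∀ I ∈ 𝓘, I.2 ≤ m) (h2 : ∀ J ∈ 𝓙, m ≤ J.1) :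
    IsIntervalFamily (𝓘 ∪ 𝓙) := by
  constructor
  · rintro I (h | h)
    exacts [hI.1 I h, hJ.1 I h]
  · rintro I (h | h) J (h' | h') hne
    · exact hI.2 I h J h' hne
    · exact Or.inl ((h1 I h).trans (h2 J h'))
    · exact Or.inr ((h1 J h').trans (h2 I h))
    · exact hJ.2 I h J h' hne

theorem grid_eq_image (𝓘 𝓙 : Set (ℝ × ℝ)) :
    grid 𝓘 𝓙 = (fun p : (ℝ × ℝ) × (ℝ × ℝ) => (⟨p.1, p.2⟩ : Rect)) '' (𝓘 ×ˢ 𝓙) := by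
  ext R
  constructor
  · exact fun h => ⟨(R.x, R.y), h, rfl⟩
  · rintro ⟨p, hp, rfl⟩
    exact hp

theorem isRectPartition_grid {𝓘 𝓙 : Set (ℝ × ℝ)} (hI : IsIntervalFamily 𝓘)
    (hJ : IsIntervalFamily 𝓙) (fI : 𝓘.Finite) (fJ : 𝓙.Finite) : IsRectPartition (grid 𝓘 𝓙) := by
  refine ⟨?_, fun R hR => ⟨hI.1 _ hR.1, hJ.1 _ hR.2⟩, fun R hR R' hR' hne => ?_⟩
  · rw [grid_eq_image]
    exact (fI.prod fJ).image _
  · by_cases hx : R.x = R'.x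
    · have hy : R.y ≠ R'.y := fun hy => hne (Rect.ext hx hy)
      rcases hJ.2 _ hR.2 _ hR'.2 hy with h | h
      · exact Or.inr (Or.inr (Or.inl h))
      · exact Or.inr (Or.inr (Or.inr h))
    · rcases hI.2 _ hR.1 _ hR'.1 hx with h | h
      · exact Or.inl h
      · exact Or.inr (Or.inl h)

theorem ncard_grid_le {𝓘 𝓙 : Set (ℝ × ℝ)} (fI : 𝓘.Finite) (fJ : 𝓙.Finite) :
    (grid 𝓘 𝓙).ncard ≤ 𝓘.ncard * 𝓙.ncard := by
  rw [grid_eq_image, ← ncard_prod]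
  exact ncard_image_le (fI.prod fJ)

theorem finite_halves (a b : ℝ) : (halves a b).Finite :=
  (finite_singleton _).insert _

theorem finite_pieces (r : Bool) (a b : ℝ) : (pieces r a b).Finite := by
  cases r
  · exact finite_singleton _
  · exact finite_halves a b

theorem ncard_halves_le (a b : ℝ) : (halves a b).ncard ≤ 2 :=
  (ncard_insert_le _ _).trans (by rw [ncard_singleton])

theorem ncard_pieces_le (r : Bool) (a b : ℝ) : (pieces r a b).ncard ≤ 2 := by
  cases r
  · simp [pieces]
  · exact ncard_halves_le a b

/-- The cells of an edge patch do not overlap, and there are at most `4 + 4 + 4` of them. -/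
theorem IsEdgePatch.isRectPartition {σ : ℝ} {P : Set Rect} (hP : IsEdgePatch σ P) :
    IsRectPartition P ∧ P.ncard ≤ 12 := by
  induction hP with
  | strip x₀ y₀ W T t refined hW hT hWT hTW ht htW =>
    have hs : IsIntervalFamily {(y₀, y₀ + T)} := isIntervalFamily_pieces (by linarith) false
    have hf := (finite_pieces refined (y₀ - t) y₀).union (finite_singleton (y₀, y₀ + T))
    refine ⟨isRectPartition_grid (isIntervalFamily_halves (by linarith))
      ((isIntervalFamily_pieces (by linarith) refined).union hs (m := y₀)
        (fun I hI => (pieces_subset (by linarith) refined I hI).2)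
        fun J hJ => by rw [mem_singleton_iff.1 hJ]) (finite_halves _ _) hf, ?_⟩
    have h1 := ncard_grid_le (finite_halves x₀ (x₀ + W)) hf
    have h2 := ncard_union_le (pieces refined (y₀ - t) y₀) {(y₀, y₀ + T)}
    have h3 := ncard_pieces_le refined (y₀ - t) y₀
    rw [ncard_singleton] at h2
    have := Nat.mul_le_mul (ncard_halves_le x₀ (x₀ + W)) (h2.trans (Nat.add_le_add_right h3 1))
    omega
  | overlapped x₀ y₀ W T t₁ t₂ refined₁ refined₂ hW hT hWT hTW ht₁ ht₁W ht₂ ht₂T =>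
    have f1 := (finite_pieces refined₁ (y₀ - t₁) y₀).union (finite_halves y₀ (y₀ + T))
    have g1 := isRectPartition_grid (isIntervalFamily_halves (by linarith : x₀ < x₀ + W))
      ((isIntervalFamily_pieces (by linarith) refined₁).union
        (isIntervalFamily_halves (by linarith : y₀ < y₀ + T)) (m := y₀)
        (fun I hI => (pieces_subset (by linarith) refined₁ I hI).2)
        fun J hJ => (halves_subset (by linarith) J hJ).1) (finite_halves _ _) f1
    have g2 := isRectPartition_grid (isIntervalFamily_pieces (by linarith : x₀ - t₂ < x₀) refined₂)
      (isIntervalFamily_halves (by linarith : y₀ < y₀ + T)) (finite_pieces _ _ _)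
      (finite_halves _ _)
    have hlr : ∀ R ∈ grid (halves x₀ (x₀ + W))
        (pieces refined₁ (y₀ - t₁) y₀ ∪ halves y₀ (y₀ + T)),
        ∀ R' ∈ grid (pieces refined₂ (x₀ - t₂) x₀) (halves y₀ (y₀ + T)), R'.x.2 ≤ R.x.1 :=
      fun R hR R' hR' => (pieces_subset (by linarith) refined₂ _ hR'.1).2.trans
        (halves_subset (by linarith) _ hR.1).1
    refine ⟨⟨g1.finite.union g2.finite, ?_, ?_⟩, ?_⟩
    · rintro R (hR | hR)
      exacts [g1.nondeg R hR, g2.nondeg R hR]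
    · rintro R (hR | hR) R' (hR' | hR') hne
      · exact g1.sep R hR R' hR' hne
      · exact Or.inr (Or.inl (hlr R hR R' hR'))
      · exact Or.inl (hlr R' hR' R hR)
      · exact g2.sep R hR R' hR' hne
    · refine (ncard_union_le _ _).trans ?_
      have h1 := ncard_grid_le (finite_halves x₀ (x₀ + W)) f1
      have h2 := ncard_union_le (pieces refined₁ (y₀ - t₁) y₀) (halves y₀ (y₀ + T))
      have h3 := Nat.mul_le_mul (ncard_halves_le x₀ (x₀ + W))
        (h2.trans (Nat.add_le_add (ncard_pieces_le refined₁ (y₀ - t₁) y₀)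
          (ncard_halves_le y₀ (y₀ + T))))
      have h4 := ncard_grid_le (finite_pieces refined₂ (x₀ - t₂) x₀) (finite_halves y₀ (y₀ + T))
      have h5 := Nat.mul_le_mul (ncard_pieces_le refined₂ (x₀ - t₂) x₀)
        (ncard_halves_le y₀ (y₀ + T))
      omega
  | swap h ih => exact ⟨ih.1.swap, (ncard_image_le ih.1.finite).trans ih.2⟩
  | reflect h ih => exact ⟨ih.1.reflect, (ncard_image_le ih.1.finite).trans ih.2⟩

/-! ### From corner values to the `L²` norm -/

theorem abs_convex_comb_le {a b c d α β γ δ e : ℝ} (ha : |a| ≤ e) (hb : |b| ≤ e) (hc : |c| ≤ e)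
    (hd : |d| ≤ e) (hα : 0 ≤ α) (hβ : 0 ≤ β) (hγ : 0 ≤ γ) (hδ : 0 ≤ δ)
    (h : α + β + γ + δ = 1) : |α * a + β * b + γ * c + δ * d| ≤ e := by
  rw [abs_le] at *
  have h1 := mul_le_mul_of_nonneg_left ha.1 hα
  have h2 := mul_le_mul_of_nonneg_left ha.2 hα
  have h3 := mul_le_mul_of_nonneg_left hb.1 hβ
  have h4 := mul_le_mul_of_nonneg_left hb.2 hβ
  have h5 := mul_le_mul_of_nonneg_left hc.1 hγ
  have h6 := mul_le_mul_of_nonneg_left hc.2 hγ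
  have h7 := mul_le_mul_of_nonneg_left hd.1 hδ
  have h8 := mul_le_mul_of_nonneg_left hd.2 hδ
  have e1 : α * e + β * e + γ * e + δ * e = e := by rw [← add_mul, ← add_mul, ← add_mul, h, one_mul]
  constructor <;> linarith

/-- On every cell a pressure takes values between its corner values. -/
theorem abs_sub_le_of_corners {P : Set Rect} (hP : IsRectPartition P) {D : Option (Rect → Bool)}
    {q : Plane → ℝ} (hq : q ∈ feSpace (meshCells P D) (prePoly D)) {R : Rect} (hR : R ∈ P)
    {c e : ℝ} (h : ∀ x ∈ ({R.x.1, R.x.2} : Set ℝ), ∀ y ∈ ({R.y.1, R.y.2} : Set ℝ),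
      |q (x, y) - c| ≤ e) {z : Plane} (hz : z ∈ R.toSet) : |q z - c| ≤ e := by
  have hn := hP.nondeg R hR
  have c1 := h R.x.1 (by simp) R.y.1 (by simp)
  have c2 := h R.x.2 (by simp) R.y.1 (by simp)
  have c3 := h R.x.1 (by simp) R.y.2 (by simp)
  have c4 := h R.x.2 (by simp) R.y.2 (by simp)
  obtain ⟨⟨u0, u1⟩, v0, v1⟩ := (hn.mem_toSet_iff z).1 hz
  have hz1 := hn.fst_eq z
  have hz2 := hn.snd_eq z
  have hx := hn.1.le
  have hy := hn.2.le
  have m1 : (R.x.1, R.y.1) ∈ R.toSet := ⟨⟨le_rfl, hx⟩, le_rfl, hy⟩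
  have m2 : (R.x.2, R.y.1) ∈ R.toSet := ⟨⟨hx, le_rfl⟩, le_rfl, hy⟩
  have m3 : (R.x.1, R.y.2) ∈ R.toSet := ⟨⟨le_rfl, hx⟩, hy, le_rfl⟩
  have m4 : (R.x.2, R.y.2) ∈ R.toSet := ⟨⟨hx, le_rfl⟩, hy, le_rfl⟩
  have w2 : R.x.2 = R.x.1 + R.width := by simp [Rect.width]
  have h2 : R.y.2 = R.y.1 + R.height := by simp [Rect.height]
  cases D with
  | none =>
    obtain ⟨a, b, c', d, hf⟩ := pressure_quad hq hR
    have key := abs_convex_comb_le (α := (1 - R.u z) * (1 - R.v z)) (β := R.u z * (1 - R.v z))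
      (γ := (1 - R.u z) * R.v z) (δ := R.u z * R.v z) c1 c2 c3 c4
      (mul_nonneg (by linarith) (by linarith)) (mul_nonneg (by linarith) (by linarith))
      (mul_nonneg (by linarith) (by linarith)) (mul_nonneg (by linarith) (by linarith)) (by ring)
    refine le_trans (le_of_eq ?_) key
    congr 1
    rw [hf z hz, hf _ m1, hf _ m2, hf _ m3, hf _ m4, hz1, hz2, w2, h2]
    ring
  | some d =>
    have u1' : ∀ y, R.u (R.x.1, y) = 0 := fun y => by simp [Rect.u]
    have u2' : ∀ y, R.u (R.x.2, y) = 1 := fun y => by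
      simp only [Rect.u]; exact div_self hn.width_pos.ne'
    have v1' : ∀ x, R.v (x, R.y.1) = 0 := fun x => by simp [Rect.v]
    have v2' : ∀ x, R.v (x, R.y.2) = 1 := fun x => by
      simp only [Rect.v]; exact div_self hn.height_pos.ne'
    obtain ⟨s, hs⟩ := Rect.exists_mem_halfSet (d R) hz
    obtain ⟨a, b, c', hf⟩ := pressure_tri hP hq hR s
    have hfz := hf z hs
    rw [hz1, hz2] at hfz
    cases hd : d R <;> cases s <;> rw [hd] at hs hf <;> have hs' := hs.2
    · have n1 := hf _ ⟨m1, by rw [u1', v1']; norm_num⟩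
      have n2 := hf _ ⟨m2, by rw [u2', v1']; norm_num⟩
      have n3 := hf _ ⟨m3, by rw [u1', v2']; norm_num⟩
      have key := abs_convex_comb_le (α := 1 - R.u z - R.v z) (β := R.u z) (γ := R.v z) (δ := 0)
        c1 c2 c3 c4 (by linarith) u0 v0 le_rfl (by ring)
      refine le_trans (le_of_eq ?_) key
      congr 1
      rw [hfz, n1, n2, n3, w2, h2]
      ring
    · have n2 := hf _ ⟨m2, by rw [u2', v1']; norm_num⟩
      have n3 := hf _ ⟨m3, by rw [u1', v2']; norm_num⟩
      have n4 := hf _ ⟨m4, by rw [u2', v2']; norm_num⟩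
      have key := abs_convex_comb_le (α := 0) (β := 1 - R.v z) (γ := 1 - R.u z)
        (δ := R.u z + R.v z - 1) c1 c2 c3 c4 le_rfl (by linarith) (by linarith) (by linarith)
        (by ring)
      refine le_trans (le_of_eq ?_) key
      congr 1
      rw [hfz, n2, n3, n4, w2, h2]
      ring
    · have n1 := hf _ ⟨m1, by rw [u1', v1']⟩
      have n2 := hf _ ⟨m2, by rw [u2', v1']; norm_num⟩
      have n4 := hf _ ⟨m4, by rw [u2', v2']⟩
      have key := abs_convex_comb_le (α := 1 - R.u z) (β := R.u z - R.v z) (γ := 0)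
        (δ := R.v z) c1 c2 c3 c4 (by linarith) (by linarith) le_rfl v0 (by ring)
      refine le_trans (le_of_eq ?_) key
      congr 1
      rw [hfz, n1, n2, n4, w2, h2]
      ring
    · have n1 := hf _ ⟨m1, by rw [u1', v1']⟩
      have n3 := hf _ ⟨m3, by rw [u1', v2']; norm_num⟩
      have n4 := hf _ ⟨m4, by rw [u2', v2']⟩
      have key := abs_convex_comb_le (α := 1 - R.v z) (β := 0) (γ := R.v z - R.u z)
        (δ := R.u z) c1 c2 c3 c4 (by linarith) le_rfl (by linarith) u0 (by ring)
      refine le_trans (le_of_eq ?_) key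
      congr 1
      rw [hfz, n1, n3, n4, w2, h2]
      ring

/-- A mean-zero pressure is bounded by its corner values relative to any constant. -/
theorem l2Norm_sq_le {P : Set Rect} (hP : IsRectPartition P) {D : Option (Rect → Bool)}
    {q : Plane → ℝ} (hq : q ∈ pressureSpace (meshCells P D) (prePoly D)) {c d : ℝ}
    (h : ∀ R ∈ P, CornersNear q c d R) :
    l2Norm (domain (meshCells P D)) q ^ 2 ≤ P.ncard * d ^ 2 := by
  set Ω := domain (meshCells P D) with hΩ
  obtain ⟨hfe, hq2, hmean⟩ := hq
  have hfin : IsFiniteMeasure (volume.restrict Ω) :=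
    ⟨by simpa using (hP.isBounded_domain D).measure_lt_top⟩
  have hqi : IntegrableOn q Ω := hq2.integrable (by norm_num)
  have hqs : IntegrableOn (fun z => q z ^ 2) Ω := hq2.integrable_sq
  -- subtracting a constant increases the norm of a function with zero mean
  have h1 : l2Norm Ω q ^ 2 ≤ ∫ z in Ω, (q z - c) ^ 2 := by
    rw [l2Norm, Real.sq_sqrt (integral_nonneg fun z => sq_nonneg _)]
    have e : ∀ z, (q z - c) ^ 2 = q z ^ 2 - 2 * c * q z + c ^ 2 := fun z => by ring
    simp_rw [e]
    have hsub : IntegrableOn (fun z => q z ^ 2 - 2 * c * q z) Ω := hqs.sub (hqi.const_mul _)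
    rw [integral_add hsub (integrable_const _),
      integral_sub hqs (hqi.const_mul _), integral_const_mul, hmean, mul_zero, sub_zero]
    have : 0 ≤ ∫ _ in Ω, c ^ 2 := integral_nonneg fun z => sq_nonneg _
    linarith
  refine h1.trans ?_
  let F : Rect → Plane → ℝ := fun R =>
    R.toSet.indicator fun _ => d ^ 2 / (R.width * R.height)
  have hF0 : ∀ R ∈ P, ∀ z, 0 ≤ F R z := fun R hR z => by
    have := (hP.nondeg R hR).width_pos
    have := (hP.nondeg R hR).height_pos
    exact indicator_nonneg (fun _ _ => by positivity) z
  have hmeas : ∀ R : Rect, MeasurableSet R.toSet := fun R =>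
    measurableSet_Icc.prod measurableSet_Icc
  have hFint : ∀ R, Integrable (F R) := fun R =>
    (integrable_indicator_iff (hmeas R)).2
      (integrableOn_const ((isCompact_Icc.prod isCompact_Icc).measure_lt_top.ne))
  have hFi : ∀ R ∈ P, ∫ z, F R z = d ^ 2 := fun R hR => by
    have hw := (hP.nondeg R hR).width_pos
    have hh := (hP.nondeg R hR).height_pos
    have hm : volume.real R.toSet = R.width * R.height := by
      rw [Rect.toSet, Measure.volume_eq_prod, measureReal_prod_prod,
        Real.volume_real_Icc_of_le (hP.nondeg R hR).1.le,
        Real.volume_real_Icc_of_le (hP.nondeg R hR).2.le]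
      rfl
    rw [integral_indicator (hmeas R), setIntegral_const, hm, smul_eq_mul]
    field_simp
  have hpt : ∀ z ∈ Ω, (q z - c) ^ 2 ≤ ∑ R ∈ hP.finite.toFinset, F R z := fun z hz => by
    have hz' : z ∈ region (meshCells P D) := interior_subset hz
    rw [hP.region_meshCells] at hz'
    obtain ⟨R, hR, hzR⟩ := mem_iUnion₂.1 hz'
    have hw := (hP.nondeg R hR).width_pos
    have hh := (hP.nondeg R hR).height_pos
    have hr : 0 < √(R.width * R.height) := Real.sqrt_pos.2 (mul_pos hw hh)
    have h2 : |q z - c| ≤ d / √(R.width * R.height) :=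
      abs_sub_le_of_corners hP hfe hR (fun x hx y hy => by
        rw [le_div_iff₀ hr]; exact h R hR x hx y hy) hzR
    have h3 : (q z - c) ^ 2 ≤ F R z := by
      simp only [F, indicator_of_mem hzR]
      rw [← sq_abs]
      refine (pow_le_pow_left₀ (abs_nonneg _) h2 2).trans (le_of_eq ?_)
      rw [div_pow, Real.sq_sqrt (mul_pos hw hh).le]
    exact h3.trans (Finset.single_le_sum (f := fun R => F R z)
      (fun S hS => hF0 S (hP.finite.mem_toFinset.1 hS) z) (hP.finite.mem_toFinset.2 hR))
  have hsum : Integrable fun z => ∑ R ∈ hP.finite.toFinset, F R z :=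
    integrable_finsetSum _ fun R _ => hFint R
  calc ∫ z in Ω, (q z - c) ^ 2 ≤ ∫ z in Ω, ∑ R ∈ hP.finite.toFinset, F R z := by
        refine integral_mono_of_nonneg (Eventually.of_forall fun z => sq_nonneg _)
          hsum.integrableOn ?_
        exact (ae_restrict_iff' isOpen_interior.measurableSet).2 (Eventually.of_forall hpt)
    _ ≤ ∫ z, ∑ R ∈ hP.finite.toFinset, F R z :=
        setIntegral_le_integral hsum (Eventually.of_forall fun z =>
          Finset.sum_nonneg fun R hR => hF0 R (hP.finite.mem_toFinset.1 hR) z)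
    _ = ∑ R ∈ hP.finite.toFinset, d ^ 2 := by
        rw [integral_finsetSum _ fun R _ => hFint R]
        exact Finset.sum_congr rfl fun R hR => hFi R (hP.finite.mem_toFinset.1 hR)
    _ = P.ncard * d ^ 2 := by
        rw [Finset.sum_const, nsmul_eq_mul, ncard_eq_toFinset_card P hP.finite]

/-- The inf-sup bound for both pairs at once. An edge patch has at most twelve cells, and the
factor `100000` makes the resulting estimate read `‖q‖² ≤ 12 / 25 ‖q‖²`. -/
theorem le_infSup_meshCells {σ : ℝ} {P : Set Rect} (hP : IsEdgePatch σ P)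
    (D : Option (Rect → Bool)) :
    ((1 / (100000 * (12 * |σ| * (1 + |σ|) + 12)) : ℝ) : EReal) ≤
      infSup (domain (meshCells P D)) (velocitySpace (meshCells P D) (velPoly D))
        (pressureSpace (meshCells P D) (prePoly D)) := by
  obtain ⟨hR, hcard⟩ := hP.isRectPartition
  set K : ℝ := 12 * |σ| * (1 + |σ|) + 12 with hK
  have hKpos : 0 < K := by positivity
  set β : ℝ := 1 / (100000 * K) with hβ
  have hβpos : 0 < β := by positivity
  refine le_iInf₂ fun q hq => ?_
  obtain ⟨hqM, hq0⟩ := hq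
  by_contra hlt
  rw [not_le] at hlt
  set Ω := domain (meshCells P D)
  have hn : 0 < l2Norm Ω q := lt_of_le_of_ne (Real.sqrt_nonneg _) (Ne.symm hq0)
  have H := weakBound_of_forall_le (S := velPoly D) (hR.isBounded_domain D) hq0 (β := β)
    fun v hv hv0 => EReal.coe_le_coe_iff.1 ((le_iSup₂ (f := fun v (_ : v ∈ {v | v ∈
      velocitySpace (meshCells P D) (velPoly D) ∧ h1Seminorm Ω v ≠ 0}) =>
        (((∫ z in Ω, divergence Ω v z * q z) / (h1Seminorm Ω v * l2Norm Ω q) : ℝ) : EReal))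
          v ⟨hv, hv0⟩).trans hlt.le)
  have hcc := cornerControl_of_weakBound hR hqM.1 hqM.2.1 (by positivity) H
  obtain ⟨c, hc⟩ := hP.exists_cornersNear q _ hcc
  have h1 := l2Norm_sq_le hR hqM hc
  have h2 : K * (20000 * (β * l2Norm Ω q)) = l2Norm Ω q / 5 := by
    rw [hβ]; field_simp; norm_num
  rw [h2] at h1
  have h3 : (P.ncard : ℝ) ≤ 12 := by exact_mod_cast hcard
  have h4 := mul_le_mul_of_nonneg_right h3 (sq_nonneg (l2Norm Ω q / 5))
  nlinarith [sq_pos_of_pos hn]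

end TaylorHood

/-- Uniform inf-sup stability of the lowest order Taylor-Hood pair on anisotropic edge patches, and
on their triangulated versions; the constant depends only on the shape regularity `σ` of the
isotropic block. -/
theorem theorem3p1 (σ : ℝ) :
    ∃ β : ℝ, 0 < β ∧ ∀ P : Set TaylorHood.Rect, TaylorHood.IsEdgePatch σ P →
      (β : EReal) ≤ TaylorHood.infSupQ2Q1 (TaylorHood.rectCells P) ∧
        ∀ d : TaylorHood.Rect → Bool,
          (β : EReal) ≤ TaylorHood.infSupP2P1 (TaylorHood.triCells P d) :=
  ⟨1 / (100000 * (12 * |σ| * (1 + |σ|) + 12)), by positivity, fun _ hP =>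
    ⟨TaylorHood.le_infSup_meshCells hP none, fun d =>
      TaylorHood.le_infSup_meshCells hP (some d)⟩⟩
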